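/- Let $G=\mathrm{PGL}(n+1,\mathbb{R})$, $\mathfrak{g}=\mathfrak{sl}(n+1,\mathbb{R})$ its Lie algebra, and let $G_0\subset G$ (with Lie algebra $\mathfrak{g}_0$) be the stabilizer of the point $[e_0]=[1:0:\dots:0]\in\mathbb{RP}^n$. A *projective connection* on a smooth $n$-manifold $M$ is a smooth principal right $G_0$-bundle $\pi:E\to M$ (with right action $r_g$ of $g \in G_0$ on $E$) together with a smooth 1-form $\Omega$ on $E$ with values in $\mathfrak{g}$, such that 1. $\Omega_e:T_eE\to\mathfrak{g}$ is a linear isomorphism for every $e\in E$; 2. $r_g^*\Omega=\mathrm{Ad}(g)^{-1}\Omega$ for every $g\in G_0$; 3. for every $A\in\mathfrak{g}_0$, the flow at time $t$ of the vector field $\vec A$ on $E$ defined by $\Omega(\vec A)=A$ is $r_{e^{tA}}$. It is *flat* if its curvature $d\Omega+\Omega\wedge\Omega$ vanishes. The *model* is the projective connection on $\mathbb{RP}^n$ with total space $G$, projection $g\mapsto g[e_0]$, right multiplication by $G_0$, and the left invariant Maurer–Cartan form $\Omega=g^{-1}dg$. If $\delta:X\to\mathbb{RP}^n$ is a local diffeomorphism,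 the *pullback of the model* along $\delta$ is the bundle $\delta^*G=\{(x,g)\in X\times G : g[e_0]=\delta(x)\}$ over $X$ with the pullback of the Maurer–Cartan form under $(x,g)\mapsto g$. **Theorem (developing map).** Let $(E\to M,\Omega)$ be a flat projective connection on a connected $n$-manifold $M$, let $p:\tilde M\to M$ be the universal covering, and let $\pi_1(M)$ act on $\tilde M$ by deck transformations. Then there are a local diffeomorphism $\delta:\tilde M\to\mathbb{RP}^n$ (the developing map) and a group morphism $\rho:\pi_1(M)\to\mathrm{PGL}(n+1,\mathbb{R})$ with $$\delta(\gamma x)=\rho(\gamma)\,\delta(x)\qquad(\gamma\in\pi_1(M),\ x\in\tilde M),$$ such that $E\to M$ is the quotient of the pullback of the model along $\delta$ by the action $\gamma(x,g)=(\gamma x,\rho(\gamma)g)$ of $\pi_1(M)$. That is, there is a surjective local diffeomorphism $q:\delta^*G\to E$ whose fibers are exactly the $\pi_1(M)$-orbits, which covers $p$, is $G_0$-equivariant, and pulls $\Omega$ back to the connection form of $\delta^*G$. -/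

import Mathlib

open Set Topology Manifold
open scoped LinearAlgebra.Projectivization Matrix MatrixGroups ContDiff

noncomputable section

namespace ProjConn

/-! ### The Lie algebra -/

/-- Square real matrices of size `n + 1`. -/
abbrev Mat (n : ℕ) := Matrix (Fin (n + 1)) (Fin (n + 1)) ℝ

/-- The group `GL(n+1, ℝ)`. -/
abbrev GLn (n : ℕ) := GL (Fin (n + 1)) ℝ

/-- The subspace of trace free matrices. -/
abbrev slSubmodule (n : ℕ) : Submodule ℝ (Mat n) :=
  LinearMap.ker (Matrix.traceLinearMap (Fin (n + 1)) ℝ ℝ)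

/-- The Lie algebra `𝔤 = 𝔰𝔩(n+1, ℝ)` of `PGL(n+1, ℝ)`: trace free matrices. -/
def 𝔤 (n : ℕ) : Type := slSubmodule n

section
attribute [local instance] Matrix.normedAddCommGroup Matrix.normedSpace

/-- The (sup) norm only serves to make `𝔤` a model space of manifolds. -/
instance (n : ℕ) : NormedAddCommGroup (𝔤 n) := inferInstanceAs (NormedAddCommGroup (slSubmodule n))

instance (n : ℕ) : NormedSpace ℝ (𝔤 n) := inferInstanceAs (NormedSpace ℝ (slSubmodule n))

end

instance (n : ℕ) : FiniteDimensional ℝ (𝔤 n) :=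
  inferInstanceAs (FiniteDimensional ℝ (slSubmodule n))

/-- The matrix underlying an element of `𝔤`. -/
def toMat (n : ℕ) : 𝔤 n →ₗ[ℝ] Mat n := (slSubmodule n).subtype

instance (n : ℕ) : CoeOut (𝔤 n) (Mat n) := ⟨fun A => toMat n A⟩

theorem toMat_injective (n : ℕ) : Function.Injective (toMat n) := Subtype.val_injective

theorem trace_toMat {n : ℕ} (A : 𝔤 n) : (toMat n A).trace = 0 := A.2

theorem continuous_toMat (n : ℕ) : Continuous (toMat n) :=
  LinearMap.continuous_of_finiteDimensional _

/-- The trace free part `A - (tr A / (n+1)) 1` of a matrix. -/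
def traceFree (n : ℕ) : Mat n →ₗ[ℝ] 𝔤 n :=
  LinearMap.codRestrict (slSubmodule n)
    (LinearMap.id - (Matrix.traceLinearMap (Fin (n + 1)) ℝ ℝ).smulRight
      (((n : ℝ) + 1)⁻¹ • (1 : Mat n)))
    (fun A => by
      have h : ((n : ℝ) + 1) ≠ 0 := by positivity
      simp [Matrix.trace_sub, Matrix.trace_smul, h])

theorem continuous_traceFree (n : ℕ) : Continuous (traceFree n) :=
  LinearMap.continuous_of_finiteDimensional _

theorem traceFree_coe (n : ℕ) (A : Mat n) :
    toMat n (traceFree n A) =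
      A - A.trace • (((n : ℝ) + 1)⁻¹ • (1 : Mat n)) := rfl

/-! ### Invertible matrices and the topology of `PGL` -/

/-- The element of `GL` given by a matrix of nonzero determinant (and `1` otherwise). -/
def toGL {n : ℕ} (A : Mat n) : GLn n :=
  open Classical in
  if h : A.det ≠ 0 then Matrix.GeneralLinearGroup.mkOfDetNeZero A h else 1

theorem toGL_coe {n : ℕ} {A : Mat n} (h : A.det ≠ 0) :
    ((toGL A : GLn n) : Mat n) = A := by
  simp [toGL, h, Matrix.GeneralLinearGroup.mkOfDetNeZero]

theorem toGL_val {n : ℕ} (g : GLn n) :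
    toGL (g : Mat n) = g :=
  Units.ext (toGL_coe g.det_ne_zero)

theorem continuousOn_toGL {n : ℕ} :
    ContinuousOn (toGL (n := n)) {A | A.det ≠ 0} := by
  rw [continuousOn_iff_continuous_domRestrict, Units.continuous_iff]
  constructor
  · refine continuous_subtype_val.congr fun A => ?_
    exact (toGL_coe A.2).symm
  · have : ∀ A : {A : Mat n | A.det ≠ 0},
        (A.1.det)⁻¹ • A.1.adjugate =
          (((toGL A.1)⁻¹ : GLn n) : Mat n) := by
      intro A
      rw [Matrix.coe_units_inv, toGL_coe A.2, Matrix.inv_def, Ring.inverse_eq_inv']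
    refine Continuous.congr ?_ this
    exact ((continuous_subtype_val.matrix_det).inv₀ fun A => A.2).smul
      continuous_subtype_val.matrix_adjugate

/-- `G = PGL(n+1, ℝ)`. -/
abbrev G (n : ℕ) := Matrix.ProjGenLinGroup (Fin (n + 1)) ℝ

/-- The class `[g]` of `g`. -/
abbrev cls {n : ℕ} (g : GLn n) : G n := Matrix.ProjGenLinGroup.mk g

/-- The quotient topology on `PGL(n+1, ℝ)`. -/
instance (n : ℕ) : TopologicalSpace (G n) :=
  inferInstanceAs (TopologicalSpace (GLn n ⧸ Subgroup.center (GLn n)))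

instance (n : ℕ) : IsTopologicalGroup (G n) :=
  inferInstanceAs
    (IsTopologicalGroup (GLn n ⧸ Subgroup.center (GLn n)))

theorem isOpenQuotientMap_cls {n : ℕ} : IsOpenQuotientMap (cls (n := n)) :=
  QuotientGroup.isOpenQuotientMap_mk

/-- A function on `GL` which is invariant under scaling descends to `PGL`. -/
def descend {n : ℕ} {X : Type*} (f : Mat n → X)
    (hf : ∀ (c : ℝ) (A), c ≠ 0 → f (c • A) = f A) : G n → X :=
  Quotient.lift (fun g : GLn n => f g) (by
    intro a b h
    have h1 : cls a = cls b := Quotient.sound h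
    obtain ⟨u, rfl⟩ := Matrix.ProjGenLinGroup.mk_eq_mk_iff.1 h1
    have : ((a * Matrix.GeneralLinearGroup.scalar (Fin (n + 1)) u : GLn n) :
        Mat n) = (u : ℝ) • (a : Mat n) := by
      simp [← Matrix.smul_eq_mul_diagonal]
    simp only [this]
    exact (hf _ _ u.ne_zero).symm)

theorem descend_cls {n : ℕ} {X : Type*} (f : Mat n → X)
    (hf : ∀ (c : ℝ) (A), c ≠ 0 → f (c • A) = f A) (g : GLn n) :
    descend f hf (cls g) = f g := rfl

theorem cls_toGL_smul {n : ℕ} {A : Mat n} (h : A.det ≠ 0)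
    {c : ℝ} (hc : c ≠ 0) : cls (toGL (c • A)) = cls (toGL A) := by
  symm
  rw [Matrix.ProjGenLinGroup.mk_eq_mk_iff]
  refine ⟨Units.mk0 c hc, Units.ext ?_⟩
  have h2 : (c • A).det ≠ 0 := by
    rw [Matrix.det_smul]; exact mul_ne_zero (pow_ne_zero _ hc) h
  rw [toGL_coe h2]
  simp [toGL_coe h, ← Matrix.smul_eq_mul_diagonal]

/-! ### The smooth structure of `PGL` -/

theorem normalise_smul {n : ℕ} (c : ℝ) (A : Mat n) (hc : c ≠ 0) :
    (((n : ℝ) + 1) / (c • A).trace) • (c • A) = (((n : ℝ) + 1) / A.trace) • A := by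
  rw [Matrix.trace_smul, smul_smul, smul_eq_mul]
  congr 1
  by_cases h : A.trace = 0
  · simp [h]
  · field_simp

theorem one_add_traceFree_normalise {n : ℕ} {A : Mat n}
    (h : A.trace ≠ 0) :
    1 + toMat n (traceFree n ((((n : ℝ) + 1) / A.trace) • A)) =
      (((n : ℝ) + 1) / A.trace) • A := by
  have hn : ((n : ℝ) + 1) ≠ 0 := by positivity
  rw [traceFree_coe, Matrix.trace_smul, smul_eq_mul, div_mul_cancel₀ _ h, smul_smul,
    mul_inv_cancel₀ hn, one_smul]
  abel

/-- The chart of `PGL(n+1, ℝ)` at the identity, with values in `𝔤`: it is defined on the classes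
`[h]` with `tr h ≠ 0`, and maps `[1 + A]` to `A` for `A ∈ 𝔤`. -/
def chartOne (n : ℕ) : OpenPartialHomeomorph (G n) (𝔤 n) where
  toFun := descend (fun A => traceFree n ((((n : ℝ) + 1) / A.trace) • A))
    (fun c A hc => by rw [normalise_smul c A hc])
  invFun A := cls (toGL (1 + toMat n A))
  source := {x | descend (fun A => A.trace ≠ 0) (fun c A hc => by simp [hc]) x}
  target := {A | (1 + toMat n A).det ≠ 0}
  map_source' := by
    intro x hx
    obtain ⟨g, rfl⟩ := Matrix.ProjGenLinGroup.mk_surjective x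
    have hx' : (g : Mat n).trace ≠ 0 := hx
    have hn : ((n : ℝ) + 1) ≠ 0 := by positivity
    simp only [mem_ofPred_eq, descend_cls]
    rw [one_add_traceFree_normalise hx', Matrix.det_smul]
    exact mul_ne_zero (pow_ne_zero _ (div_ne_zero hn hx')) g.det_ne_zero
  map_target' := by
    intro A hA
    have hn : ((n : ℝ) + 1) ≠ 0 := by positivity
    have hA' : (toMat n A).trace = 0 := trace_toMat A
    simp only [mem_ofPred_eq, descend_cls, toGL_coe hA]
    simp [Matrix.trace_add, hA', hn]
  left_inv' := by
    intro x hx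
    obtain ⟨g, rfl⟩ := Matrix.ProjGenLinGroup.mk_surjective x
    have hx' : (g : Mat n).trace ≠ 0 := hx
    have hn : ((n : ℝ) + 1) ≠ 0 := by positivity
    simp only [descend_cls]
    rw [one_add_traceFree_normalise hx', cls_toGL_smul g.det_ne_zero (div_ne_zero hn hx'), toGL_val]
  right_inv' := by
    intro A hA
    have hn : ((n : ℝ) + 1) ≠ 0 := by positivity
    have hA' : (toMat n A).trace = 0 := trace_toMat A
    apply toMat_injective
    simp only [descend_cls, toGL_coe hA, traceFree_coe]
    simp [Matrix.trace_add, hA', hn]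
  open_source := by
    rw [← isOpenQuotientMap_cls.isQuotientMap.isOpen_preimage]
    exact isOpen_ne_fun (Units.continuous_val.matrix_trace) continuous_const
  open_target :=
    isOpen_ne_fun (continuous_const.add (continuous_toMat n)).matrix_det continuous_const
  continuousOn_toFun := by
    have h : IsOpen {x : G n | descend (fun A => A.trace ≠ 0) (fun c A hc => by simp [hc]) x} := by
      rw [← isOpenQuotientMap_cls.isQuotientMap.isOpen_preimage]
      exact isOpen_ne_fun (Units.continuous_val.matrix_trace) continuous_const
    rw [isOpenQuotientMap_cls.isQuotientMap.continuousOn_isOpen_iff h]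
    refine (continuous_traceFree n).comp_continuousOn ?_
    refine ContinuousOn.fun_smul ?_ Units.continuous_val.continuousOn
    have htr : Continuous fun g : GLn n =>
        (g : Mat n).trace := Units.continuous_val.matrix_trace
    exact continuousOn_const.div htr.continuousOn fun g hg => hg
  continuousOn_invFun := by
    refine isOpenQuotientMap_cls.continuous.comp_continuousOn ?_
    exact continuousOn_toGL.comp
      (continuous_const.add (continuous_toMat n)).continuousOn fun A hA => hA

/-- The chart `[h] ↦ chartOne [g⁻¹ h]` of `PGL(n+1, ℝ)` at `[g]`. -/
def chartPGL {n : ℕ} (g : G n) : OpenPartialHomeomorph (G n) (𝔤 n) :=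
  (Homeomorph.mulLeft g⁻¹).toOpenPartialHomeomorph.trans (chartOne n)

instance (n : ℕ) : ChartedSpace (𝔤 n) (G n) where
  atlas := range chartPGL
  chartAt := chartPGL
  mem_chart_source g := by
    have hn : ((n : ℝ) + 1) ≠ 0 := by positivity
    have : (1 : G n) ∈ (chartOne n).source := by
      change (1 : Mat n).trace ≠ 0
      simpa using hn
    simp [chartPGL, this]
  chart_mem_atlas g := ⟨g, rfl⟩

instance (n : ℕ) : IsManifold 𝓘(ℝ, 𝔤 n) ∞ (G n) := by
  refine isManifold_of_contDiffOn _ _ _ ?_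
  rintro _ _ ⟨a, rfl⟩ ⟨b, rfl⟩
  obtain ⟨k, hk⟩ := Matrix.ProjGenLinGroup.mk_surjective (b⁻¹ * a)
  simp only [modelWithCornersSelf_coe, modelWithCornersSelf_coe_symm,
    preimage_id, range_id, inter_univ, CompTriple.comp_eq]
  have key : ∀ A ∈ ((chartPGL a).symm.trans (chartPGL b)).source,
      (1 + toMat n A).det ≠ 0 ∧
      ((k : Mat n) * (1 + toMat n A)).trace ≠ 0 ∧
      (chartPGL b ∘ (chartPGL a).symm) A = traceFree n ((((n : ℝ) + 1) /
        ((k : Mat n) * (1 + toMat n A)).trace) •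
          ((k : Mat n) * (1 + toMat n A))) := by
    intro A hA
    have h1 : (1 + toMat n A).det ≠ 0 := by
      have : A ∈ (chartOne n).target := by simpa [chartPGL] using hA.1
      exact this
    have h3 : b⁻¹ * (a * cls (toGL (1 + toMat n A))) =
        cls (k * toGL (1 + toMat n A)) := by
      rw [← mul_assoc, ← hk, ← map_mul]
    have h2 : b⁻¹ * (a * cls (toGL (1 + toMat n A))) ∈
        (chartOne n).source := by
      have : b⁻¹ * ((a⁻¹)⁻¹ * cls (toGL (1 + toMat n A))) ∈ (chartOne n).source := hA.2.2
      rwa [inv_inv] at this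
    rw [h3] at h2
    refine ⟨h1, ?_, ?_⟩
    · have : ((k * toGL (1 + toMat n A) :
        GLn n) : Mat n).trace ≠ 0 := h2
      rwa [Units.val_mul, toGL_coe h1] at this
    · change chartOne n (b⁻¹ * ((a⁻¹)⁻¹ *
        cls (toGL (1 + toMat n A)))) = _
      rw [inv_inv, h3]
      change traceFree n _ = _
      rw [Units.val_mul, toGL_coe h1]
  have key2 : ∀ A : 𝔤 n, traceFree n ((((n : ℝ) + 1) /
        ((k : Mat n) * (1 + toMat n A)).trace) •
          ((k : Mat n) * (1 + toMat n A))) =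
      (((n : ℝ) + 1) / ((k : Mat n) * (1 + toMat n A)).trace) •
        (traceFree n k + ((traceFree n).comp ((LinearMap.mulLeft ℝ
          (k : Mat n)).comp (toMat n))).toContinuousLinearMap A) := by
    intro A
    rw [map_smul, mul_add, mul_one, map_add]
    rfl
  refine ContDiffOn.congr ?_ fun A hA => ((key A hA).2.2.trans (key2 A))
  refine ContDiffOn.fun_smul ?_ (contDiff_const.add (ContinuousLinearMap.contDiff _)).contDiffOn
  refine contDiffOn_const.div ?_ fun A hA => (key A hA).2.1
  have key3 : ∀ A : 𝔤 n, ((k : Mat n) * (1 + toMat n A)).trace =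
      (k : Mat n).trace +
      ((Matrix.traceLinearMap (Fin (n + 1)) ℝ ℝ).comp ((LinearMap.mulLeft ℝ
          (k : Mat n)).comp (toMat n))).toContinuousLinearMap A := by
    intro A
    rw [mul_add, mul_one, Matrix.trace_add]
    rfl
  refine ContDiffOn.congr ?_ fun A _ => key3 A
  exact (contDiff_const.add (ContinuousLinearMap.contDiff _)).contDiffOn

/-! ### Real projective space -/

/-- Real projective space `ℝPⁿ`. -/
abbrev RP (n : ℕ) := ℙ ℝ (Fin (n + 1) → ℝ)

/-- The quotient topology on `ℝPⁿ`. -/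
instance (n : ℕ) : TopologicalSpace (RP n) :=
  inferInstanceAs (TopologicalSpace (Quotient (projectivizationSetoid ℝ (Fin (n + 1) → ℝ))))

theorem isQuotientMap_mk' (n : ℕ) :
    IsQuotientMap (Projectivization.mk' ℝ : {v : Fin (n + 1) → ℝ // v ≠ 0} → RP n) :=
  isQuotientMap_quot_mk

theorem isOpen_coord_ne {n : ℕ} (i : Fin (n + 1)) :
    IsOpen {x : RP n | Projectivization.lift (fun v : {v : Fin (n + 1) → ℝ // v ≠ 0} => v.1 i ≠ 0)
      (fun a b t h => by
        have ht : t ≠ 0 := by rintro rfl; exact a.2 (by simpa using h)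
        simp [h, ht]) x} := by
  rw [← (isQuotientMap_mk' n).isOpen_preimage]
  exact isOpen_ne_fun ((continuous_apply i).comp continuous_subtype_val) continuous_const

/-- The vector with `i`-th coordinate `1` and remaining coordinates `y`. -/
def homog {n : ℕ} (i : Fin (n + 1)) (y : EuclideanSpace ℝ (Fin n)) : Fin (n + 1) → ℝ :=
  i.insertNth (α := fun _ => ℝ) 1 y.ofLp

theorem homog_self {n : ℕ} (i : Fin (n + 1)) (y : EuclideanSpace ℝ (Fin n)) : homog i y i = 1 := by
  simp [homog]

theorem homog_ne_zero {n : ℕ} (i : Fin (n + 1)) (y : EuclideanSpace ℝ (Fin n)) : homog i y ≠ 0 :=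
  fun h => one_ne_zero ((homog_self i y).symm.trans (congrFun h i))

theorem homog_succAbove {n : ℕ} (i : Fin (n + 1)) (y : EuclideanSpace ℝ (Fin n)) (j : Fin n) :
    homog i y (i.succAbove j) = y.ofLp j := by
  simp [homog]

theorem contDiff_homog {n : ℕ} (i : Fin (n + 1)) (k : Fin (n + 1)) :
    ContDiff ℝ ∞ fun y => homog i y k := by
  induction k using Fin.succAboveCases i with
  | x => simpa [homog_self] using contDiff_const
  | p j => simpa only [homog_succAbove] using contDiff_piLp_apply (p := 2) (i := j)

/-- The affine chart `[x] ↦ (x_j / x_i)_{j ≠ i}` of `ℝPⁿ`, defined where `x_i ≠ 0`. -/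
def affineChart {n : ℕ} (i : Fin (n + 1)) :
    OpenPartialHomeomorph (RP n) (EuclideanSpace ℝ (Fin n)) where
  toFun := Projectivization.lift
    (fun v => WithLp.toLp 2 fun j : Fin n => v.1 (i.succAbove j) / v.1 i)
    (fun a b t h => by
      have ht : t ≠ 0 := by rintro rfl; exact a.2 (by simpa using h)
      congr 1; funext j
      simp [h, mul_div_mul_left _ _ ht])
  invFun y := Projectivization.mk ℝ (homog i y) (homog_ne_zero i y)
  source := {x | Projectivization.lift (fun v : {v : Fin (n + 1) → ℝ // v ≠ 0} => v.1 i ≠ 0)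
      (fun a b t h => by
        have ht : t ≠ 0 := by rintro rfl; exact a.2 (by simpa using h)
        simp [h, ht]) x}
  target := univ
  map_source' _ _ := mem_univ _
  map_target' y _ := by
    change homog i y i ≠ 0
    rw [homog_self]; exact one_ne_zero
  left_inv' x hx := by
    induction x using Projectivization.ind with | _ v hv =>
    have hi : v i ≠ 0 := hx
    change Projectivization.mk ℝ (homog i (WithLp.toLp 2 fun j => v (i.succAbove j) / v i))
      (homog_ne_zero i _) = _
    rw [Projectivization.mk_eq_mk_iff']
    refine ⟨(v i)⁻¹, ?_⟩
    funext k
    induction k using Fin.succAboveCases i with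
    | x => simp [hi, homog_self]
    | p j => simp [homog_succAbove]; ring
  right_inv' y _ := by
    change WithLp.toLp 2 (fun j : Fin n =>
      homog i y (i.succAbove j) / homog i y i) = y
    simp [homog_self, homog_succAbove]
  open_source := isOpen_coord_ne i
  open_target := isOpen_univ
  continuousOn_toFun := by
    rw [(isQuotientMap_mk' n).continuousOn_isOpen_iff (isOpen_coord_ne i)]
    refine (PiLp.continuous_toLp 2 _).comp_continuousOn ?_
    refine continuousOn_pi.2 fun j => ?_
    exact ((continuous_apply _).comp continuous_subtype_val).continuousOn.div
      ((continuous_apply _).comp continuous_subtype_val).continuousOn fun v hv => hv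
  continuousOn_invFun := by
    refine Continuous.continuousOn ?_
    refine (isQuotientMap_mk' n).continuous.comp (Continuous.subtype_mk ?_ _)
    exact continuous_pi fun k => (contDiff_homog i k).continuous

theorem exists_affineChart {n : ℕ} (x : RP n) : ∃ i, x ∈ (affineChart i).source := by
  induction x using Projectivization.ind with | _ v hv =>
  obtain ⟨i, hi⟩ := Function.ne_iff.1 hv
  exact ⟨i, hi⟩

instance (n : ℕ) : ChartedSpace (EuclideanSpace ℝ (Fin n)) (RP n) where
  atlas := range affineChart
  chartAt x := affineChart (exists_affineChart x).choose
  mem_chart_source x := (exists_affineChart x).choose_spec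
  chart_mem_atlas _ := ⟨_, rfl⟩

instance (n : ℕ) : IsManifold 𝓘(ℝ, EuclideanSpace ℝ (Fin n)) ∞ (RP n) := by
  refine isManifold_of_contDiffOn _ _ _ ?_
  rintro _ _ ⟨a, rfl⟩ ⟨b, rfl⟩
  simp only [modelWithCornersSelf_coe, modelWithCornersSelf_coe_symm,
    preimage_id, range_id, inter_univ, CompTriple.comp_eq]
  refine contDiffOn_euclidean.2 fun j => ?_
  refine ContDiffOn.congr (f := fun y : EuclideanSpace ℝ (Fin n) =>
    homog a y (b.succAbove j) / homog a y b) ?_ fun y _ => by rfl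
  exact (contDiff_homog _ _).contDiffOn.div (contDiff_homog _ _).contDiffOn fun y hy => hy.2

theorem single_ne_zero (n : ℕ) : (Pi.single 0 1 : Fin (n + 1) → ℝ) ≠ 0 := by
  intro h
  simpa using congrFun h 0

/-- The point `[e₀] = [1 : 0 : ⋯ : 0]` of `ℝPⁿ`. -/
def basePt (n : ℕ) : RP n :=
  Projectivization.mk ℝ (Pi.single 0 1) (single_ne_zero n)

/-! ### The structure group -/

/-- The structure group `G₀ ⊂ PGL(n+1, ℝ)`: the stabilizer of `[e₀]`. -/
abbrev G₀ (n : ℕ) : Subgroup (G n) := MulAction.stabilizer (G n) (basePt n)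

theorem cls_smul_basePt {n : ℕ} (g : GLn n) :
    cls g • basePt n = Projectivization.mk ℝ (fun i => (g : Mat n) i 0)
      (fun h => by
        have := (smul_ne_zero_iff_ne g).2 (single_ne_zero n)
        refine this ?_
        rw [← h, Units.smul_def]
        funext i
        simp) := by
  rw [basePt, Projectivization.PGL.mk_smul_mk]
  congr 1
  rw [Units.smul_def]
  funext i
  simp

/-- `[g]` lies in `G₀` exactly when the first column of `g` vanishes below the first entry. -/
theorem cls_mem_G₀ {n : ℕ} (g : GLn n) :
    cls g ∈ G₀ n ↔ ∀ i : Fin n, (g : Mat n) i.succ 0 = 0 := by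
  rw [MulAction.mem_stabilizer_iff, cls_smul_basePt, basePt, Projectivization.mk_eq_mk_iff']
  constructor
  · rintro ⟨a, ha⟩ i
    simpa using (congrFun ha i.succ).symm
  · intro h
    refine ⟨(g : Mat n) 0 0, ?_⟩
    funext i
    refine Fin.cases ?_ (fun i => ?_) i
    · simp
    · simp [h i]

theorem entry_ne_zero {n : ℕ} {g : GLn n} (h : cls g ∈ G₀ n) : (g : Mat n) 0 0 ≠ 0 := by
  rw [cls_mem_G₀] at h
  intro h0
  refine g.det_ne_zero (Matrix.det_eq_zero_of_column_eq_zero 0 fun i => ?_)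
  exact Fin.cases h0 h i

/-- The matrix with first column `e₀` and the columns of `B` after it. -/
def normalMat {n : ℕ} (B : Fin (n + 1) → Fin n → ℝ) : Mat n :=
  Matrix.of fun i => Fin.cons ((Pi.single 0 1 : Fin (n + 1) → ℝ) i) (B i)

theorem cls_normalMat_mem {n : ℕ} {B : Fin (n + 1) → Fin n → ℝ} (h : (normalMat B).det ≠ 0) :
    cls (toGL (normalMat B)) ∈ G₀ n := by
  rw [cls_mem_G₀]
  intro i
  rw [toGL_coe h]
  simp [normalMat]

theorem continuous_normalMat {n : ℕ} : Continuous (normalMat (n := n)) := by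
  refine continuous_matrix fun i j => ?_
  refine Fin.cases ?_ (fun j => ?_) j
  · simpa [normalMat] using continuous_const
  · simpa [normalMat] using continuous_apply_apply i j

/-- The columns after the first one, divided by the upper left entry. -/
def normalCols {n : ℕ} : G n → Fin (n + 1) → Fin n → ℝ :=
  descend (fun A i j => A i j.succ / A 0 0)
    (fun c A hc => by funext i j; simp [mul_div_mul_left _ _ hc])

/-- Every element of `G₀` has a unique representative whose first column is `e₀`. The other
columns of this representative are a global chart of `G₀`. -/
def chartG₀ (n : ℕ) : OpenPartialHomeomorph (G₀ n) (Fin (n + 1) → Fin n → ℝ) where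
  toFun g := normalCols g.1
  invFun B := open Classical in
    if h : (normalMat B).det ≠ 0 then ⟨cls (toGL (normalMat B)), cls_normalMat_mem h⟩ else 1
  source := univ
  target := {B | (normalMat B).det ≠ 0}
  map_source' := by
    rintro ⟨x, hx⟩ -
    obtain ⟨g, rfl⟩ := Matrix.ProjGenLinGroup.mk_surjective x
    have h0 := entry_ne_zero hx
    have : normalMat (normalCols (cls g)) = ((g : Mat n) 0 0)⁻¹ • (g : Mat n) := by
      ext i j
      refine Fin.cases ?_ (fun j => ?_) j
      · refine Fin.cases ?_ (fun i => ?_) i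
        · simp [normalMat, h0]
        · simp [normalMat, (cls_mem_G₀ g).1 hx i]
      · simp [normalMat, normalCols, descend_cls]; ring
    change (normalMat (normalCols (cls g))).det ≠ 0
    rw [this, Matrix.det_smul]
    exact mul_ne_zero (pow_ne_zero _ (inv_ne_zero h0)) g.det_ne_zero
  map_target' _ _ := mem_univ _
  left_inv' := by
    rintro ⟨x, hx⟩ -
    obtain ⟨g, rfl⟩ := Matrix.ProjGenLinGroup.mk_surjective x
    have h0 := entry_ne_zero hx
    have : normalMat (normalCols (cls g)) = ((g : Mat n) 0 0)⁻¹ • (g : Mat n) := by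
      ext i j
      refine Fin.cases ?_ (fun j => ?_) j
      · refine Fin.cases ?_ (fun i => ?_) i
        · simp [normalMat, h0]
        · simp [normalMat, (cls_mem_G₀ g).1 hx i]
      · simp [normalMat, normalCols, descend_cls]; ring
    have hd : (normalMat (normalCols (cls g))).det ≠ 0 := by
      rw [this, Matrix.det_smul]
      exact mul_ne_zero (pow_ne_zero _ (inv_ne_zero h0)) g.det_ne_zero
    apply Subtype.ext
    rw [dif_pos hd]
    change cls (toGL (normalMat (normalCols (cls g)))) = cls g
    rw [this, cls_toGL_smul g.det_ne_zero (inv_ne_zero h0), toGL_val]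
  right_inv' := by
    intro B hB
    have hB' : (normalMat B).det ≠ 0 := hB
    rw [dif_pos hB']
    funext i j
    change (toGL (normalMat B) : Mat n) i j.succ / (toGL (normalMat B) : Mat n) 0 0 = B i j
    rw [toGL_coe hB]
    simp [normalMat]
  open_source := isOpen_univ
  open_target := isOpen_ne_fun continuous_normalMat.matrix_det continuous_const
  continuousOn_toFun := by
    rw [continuousOn_univ]
    have ho : IsOpen {x : G n | descend (fun A => A 0 0 ≠ 0) (fun c A hc => by simp [hc]) x} := by
      rw [← isOpenQuotientMap_cls.isQuotientMap.isOpen_preimage]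
      exact isOpen_ne_fun (Units.continuous_val.matrix_elem 0 0) continuous_const
    have hc : ContinuousOn (normalCols (n := n))
        {x : G n | descend (fun A => A 0 0 ≠ 0) (fun c A hc => by simp [hc]) x} := by
      rw [isOpenQuotientMap_cls.isQuotientMap.continuousOn_isOpen_iff ho]
      refine continuousOn_pi.2 fun i => continuousOn_pi.2 fun j => ?_
      have hij : ∀ i j, Continuous fun g : GLn n => (g : Mat n) i j :=
        fun i j => Units.continuous_val.matrix_elem i j
      exact (hij i j.succ).continuousOn.div (hij 0 0).continuousOn fun g hg => hg
    refine hc.comp_continuous continuous_subtype_val ?_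
    rintro ⟨x, hx⟩
    obtain ⟨g, rfl⟩ := Matrix.ProjGenLinGroup.mk_surjective x
    exact entry_ne_zero hx
  continuousOn_invFun := by
    rw [Topology.IsInducing.subtypeVal.continuousOn_iff]
    refine ContinuousOn.congr (f := fun B => cls (toGL (normalMat B))) ?_ ?_
    · exact isOpenQuotientMap_cls.continuous.comp_continuousOn
        (continuousOn_toGL.comp continuous_normalMat.continuousOn fun B hB => hB)
    · intro B hB
      have hB' : (normalMat B).det ≠ 0 := hB
      simp [hB']

instance (n : ℕ) : ChartedSpace (Fin (n + 1) → Fin n → ℝ) (G₀ n) :=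
  (chartG₀ n).singletonChartedSpace rfl

instance (n : ℕ) : IsManifold 𝓘(ℝ, Fin (n + 1) → Fin n → ℝ) ∞ (G₀ n) :=
  (chartG₀ n).isManifold_singleton rfl

/-- The Lie algebra `𝔤₀` of `G₀`. -/
def 𝔤₀ (n : ℕ) : Submodule ℝ (𝔤 n) where
  carrier := {A | ∀ i : Fin n, toMat n A i.succ 0 = 0}
  add_mem' ha hb i := by simp [ha i, hb i]
  zero_mem' i := by simp
  smul_mem' c A ha i := by simp [ha i]

theorem det_exp_ne_zero {n : ℕ} (A : Mat n) : (NormedSpace.exp A).det ≠ 0 :=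
  ((Matrix.isUnit_iff_isUnit_det _).1 (Matrix.isUnit_exp A)).ne_zero

/-- The exponential map `A ↦ [e^A]` of `G₀`. -/
def expG₀ {n : ℕ} (A : 𝔤₀ n) : G₀ n :=
  ⟨cls (toGL (NormedSpace.exp (toMat n A.1))), by
    rw [cls_mem_G₀]
    intro i
    rw [toGL_coe (det_exp_ne_zero _)]
    have h : (toMat n A.1).BlockTriangular (fun i : Fin (n + 1) => if i = 0 then 0 else 1) := by
      intro i j hij
      have hj : j = 0 := by by_contra hj; simp [hj] at hij; split_ifs at hij <;> omega
      have hi : i ≠ 0 := by rintro rfl; simp [hj] at hij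
      obtain ⟨i, rfl⟩ := Fin.exists_succ_eq.2 hi
      rw [hj]
      exact A.2 i
    exact h.exp (by simp)⟩

/-- The adjoint representation of `GL(n+1, ℝ)` on `𝔤`: `A ↦ g A g⁻¹`. -/
def AdGL (n : ℕ) : GLn n →* Module.End ℝ (𝔤 n) where
  toFun g := LinearMap.codRestrict (slSubmodule n)
    ((LinearMap.mulRight ℝ ((g⁻¹ : GLn n) : Mat n)).comp
      ((LinearMap.mulLeft ℝ (g : Mat n)).comp (toMat n))) (fun A => by
        change ((g : Mat n) * toMat n A * ((g⁻¹ : GLn n) : Mat n)).trace = 0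
        rw [Matrix.trace_mul_comm, ← mul_assoc, Units.inv_mul, one_mul, trace_toMat])
  map_one' := by
    refine LinearMap.ext fun A => toMat_injective n ?_
    change ((1 : GLn n) : Mat n) * toMat n A * (((1 : GLn n)⁻¹ : GLn n) : Mat n) = toMat n A
    simp
  map_mul' g h := by
    refine LinearMap.ext fun A => toMat_injective n ?_
    change ((g * h : GLn n) : Mat n) * toMat n A * (((g * h)⁻¹ : GLn n) : Mat n) =
      (g : Mat n) * ((h : Mat n) * toMat n A * ((h⁻¹ : GLn n) : Mat n)) * ((g⁻¹ : GLn n) : Mat n)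
    rw [mul_inv_rev, Units.val_mul, Units.val_mul]
    simp only [mul_assoc]

/-- The adjoint representation of `PGL(n+1, ℝ)` on `𝔤`. -/
def Ad (n : ℕ) : G n →* Module.End ℝ (𝔤 n) :=
  QuotientGroup.lift (Subgroup.center (GLn n)) (AdGL n) (by
    intro g hg
    refine LinearMap.ext fun A => toMat_injective n ?_
    change (g : Mat n) * toMat n A * ((g⁻¹ : GLn n) : Mat n) = toMat n A
    obtain ⟨u, hu⟩ := Matrix.GeneralLinearGroup.mem_center_iff_val_mem_range_scalar.1 hg
    have h : (g : Mat n) * toMat n A = toMat n A * (g : Mat n) := by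
      rw [← hu]
      exact (Matrix.scalar_commute u (fun r => mul_comm _ _) _).eq
    rw [h, mul_assoc, Units.mul_inv, mul_one])

theorem toMat_Ad {n : ℕ} (g : GLn n) (A : 𝔤 n) :
    toMat n (Ad n (cls g) A) = (g : Mat n) * toMat n A * ((g⁻¹ : GLn n) : Mat n) := rfl

/-! ### Projective connections -/

section Connections

variable {n : ℕ} {N E W : Type*} [TopologicalSpace N] [TopologicalSpace E]
  [NormedAddCommGroup W] [NormedSpace ℝ W] [ChartedSpace W E]

/-- The data of a projective connection `E → N`: a bundle projection, a right action `r_g` of `G₀`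
on the total space along the fibers, and a 1-form `Ω` on the total space with values in `𝔤`.
The total space is charted on a vector space `W`. -/
structure ConnectionData (n : ℕ) (N E W : Type*) [TopologicalSpace N] [TopologicalSpace E]
    [NormedAddCommGroup W] [NormedSpace ℝ W] [ChartedSpace W E] where
  /-- the bundle projection -/
  proj : C(E, N)
  /-- the right action `act e g = r_g e` -/
  act : E → G₀ n → E
  proj_act : ∀ e g, proj (act e g) = proj e
  /-- the connection form `Ω` -/
  form : ∀ e : E, TangentSpace 𝓘(ℝ, W) e →L[ℝ] 𝔤 n

namespace ConnectionData

/-- The vector field `A⃗` on the total space with `Ω(A⃗) = A`. -/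
def vec (D : ConnectionData n N E W) (A : 𝔤 n) (e : E) : TangentSpace 𝓘(ℝ, W) e :=
  (D.form e).inverse A

/-- The data `D` form a projective connection on the `n`-manifold `N`: the total space is a smooth
principal right `G₀`-bundle over `N`, each `Ω_e` is a linear isomorphism, `r_g^* Ω = Ad(g)⁻¹ Ω`,
and for `A ∈ 𝔤₀` the flow of `A⃗` is `r_{exp(tA)}`. -/
structure IsProjectiveConnection [ChartedSpace (EuclideanSpace ℝ (Fin n)) N]
    [IsManifold 𝓘(ℝ, W) ∞ E]
    (D : ConnectionData n N E W) : Prop where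
  act_one : ∀ e, D.act e 1 = e
  act_mul : ∀ e g h, D.act e (g * h) = D.act (D.act e g) h
  contMDiff_proj : ContMDiff 𝓘(ℝ, W) 𝓘(ℝ, EuclideanSpace ℝ (Fin n)) ∞ D.proj
  contMDiff_act : ContMDiff (𝓘(ℝ, W).prod 𝓘(ℝ, Fin (n + 1) → Fin n → ℝ)) 𝓘(ℝ, W) ∞
    (fun x : E × G₀ n => D.act x.1 x.2)
  /-- Over an open neighbourhood `U` of each point the bundle is, `G₀`-equivariantly and over `U`,
  diffeomorphic to `U × G₀`. -/
  locally_trivial : ∀ x : N, ∃ (U : Set N) (φ : OpenPartialHomeomorph (N × G₀ n) E),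
    IsOpen U ∧ x ∈ U ∧ φ.source = U ×ˢ univ ∧ φ.target = D.proj ⁻¹' U ∧
    (∀ u ∈ U, ∀ g, D.proj (φ (u, g)) = u) ∧
    (∀ u ∈ U, ∀ g h, φ (u, g * h) = D.act (φ (u, g)) h) ∧
    ContMDiffOn (𝓘(ℝ, EuclideanSpace ℝ (Fin n)).prod 𝓘(ℝ, Fin (n + 1) → Fin n → ℝ)) 𝓘(ℝ, W) ∞
      φ φ.source ∧
    ContMDiffOn 𝓘(ℝ, W) (𝓘(ℝ, EuclideanSpace ℝ (Fin n)).prod 𝓘(ℝ, Fin (n + 1) → Fin n → ℝ)) ∞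
      φ.symm φ.target
  /-- `Ω` is a smooth 1-form. -/
  contMDiff_form : ContMDiff 𝓘(ℝ, W).tangent 𝓘(ℝ, 𝔤 n) ∞
    (fun v : TangentBundle 𝓘(ℝ, W) E => D.form v.1 v.2)
  form_isInvertible : ∀ e, (D.form e).IsInvertible
  form_equivariant : ∀ (g : G₀ n) (e : E) (v : TangentSpace 𝓘(ℝ, W) e),
    D.form (D.act e g) (mfderiv 𝓘(ℝ, W) 𝓘(ℝ, W) (fun x => D.act x g) e v) =
      Ad n (g : G n)⁻¹ (D.form e v)
  flow_eq : ∀ (A : 𝔤₀ n) (e : E),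
    IsMIntegralCurve (I := 𝓘(ℝ, W)) (fun t : ℝ => D.act e (expG₀ (t • A))) (D.vec A)

/-- The form `Ω` in the chart at `e`. -/
def formInChart (D : ConnectionData n N E W) (e : E) (y : W) : W →L[ℝ] 𝔤 n :=
  (D.form ((chartAt W e).symm y)).comp (mfderiv 𝓘(ℝ, W) 𝓘(ℝ, W) (chartAt W e).symm y)

/-- The value `dΩ(u, v)` of the exterior derivative of `Ω`. -/
def dForm (D : ConnectionData n N E W) (e : E) (u v : TangentSpace 𝓘(ℝ, W) e) : 𝔤 n :=
  fderiv ℝ (D.formInChart e) (chartAt W e e) u v - fderiv ℝ (D.formInChart e) (chartAt W e e) v u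

/-- The curvature 2-form `dΩ + Ω ∧ Ω`. Its components are those of the structure equations:
`∇ω^i = (dΩ + Ω ∧ Ω)^i_0`, `∇γ^i_j = (dΩ + Ω ∧ Ω)^i_j - δ^i_j (dΩ + Ω ∧ Ω)^0_0` and
`∇ω_j = (dΩ + Ω ∧ Ω)^0_j`, where `ω^i = Ω^i_0`, `γ^i_j = Ω^i_j - δ^i_j Ω^0_0`, `ω_j = Ω^0_j`. -/
def curvature (D : ConnectionData n N E W) (e : E) (u v : TangentSpace 𝓘(ℝ, W) e) : Mat n :=
  toMat n (D.dForm e u v) +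
    (toMat n (D.form e u) * toMat n (D.form e v) - toMat n (D.form e v) * toMat n (D.form e u))

/-- A projective connection is flat if its curvature vanishes. -/
def IsFlat (D : ConnectionData n N E W) : Prop :=
  ∀ (e : E) (u v : TangentSpace 𝓘(ℝ, W) e), D.curvature e u v = 0

end ConnectionData

end Connections

/-! ### The model -/

theorem continuous_smul_basePt (n : ℕ) : Continuous fun g : G n => g • basePt n := by
  rw [isOpenQuotientMap_cls.isQuotientMap.continuous_iff]
  have h : ∀ g : GLn n, ((fun i => (g : Mat n) i 0) : Fin (n + 1) → ℝ) ≠ 0 := fun g h =>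
    g.det_ne_zero (Matrix.det_eq_zero_of_column_eq_zero 0 fun i => congrFun h i)
  have hc : Continuous fun g : GLn n =>
      (Projectivization.mk' ℝ ⟨fun i => (g : Mat n) i 0, h g⟩ : RP n) :=
    (isQuotientMap_mk' n).continuous.comp
      (Continuous.subtype_mk (continuous_pi fun i => Units.continuous_val.matrix_elem i 0) _)
  exact hc.congr fun g => (cls_smul_basePt g).symm

/-- The model: `E = G = PGL(n+1, ℝ)` with right multiplication by `G₀`, the projection
`g ↦ g [e₀]` to `ℝPⁿ` and the left invariant Maurer–Cartan form `Ω = g⁻¹ dg`. At `g` the latter is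
the derivative of left translation by `g⁻¹` followed by the identification of the tangent space at
the identity with `𝔤`, which is the derivative of `chartOne` (the velocity of `[1 + tA]` is `A`). -/
def model (n : ℕ) : ConnectionData n (RP n) (G n) (𝔤 n) where
  proj := ⟨fun g => g • basePt n, continuous_smul_basePt n⟩
  act g h := g * h
  proj_act g h := by
    change (g * (h : G n)) • basePt n = g • basePt n
    rw [mul_smul, h.2]
  form g := mfderiv 𝓘(ℝ, 𝔤 n) 𝓘(ℝ, 𝔤 n) (fun h => chartOne n (g⁻¹ * h)) g

/-! ### Pulling back along a local diffeomorphism -/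

section Pullback

variable {n : ℕ} {N E W X : Type*} [TopologicalSpace N] [TopologicalSpace E] [TopologicalSpace X]
  [NormedAddCommGroup W] [NormedSpace ℝ W] [ChartedSpace W E]

/-- The pullback bundle `δ^* E = {(x, e) | δ x = π e}`. -/
def Pullback (D : ConnectionData n N E W) {δ : X → N} (_hδ : IsLocalHomeomorph δ) : Type _ :=
  {y : X × E // δ y.1 = D.proj y.2}

variable (D : ConnectionData n N E W) {δ : X → N} (hδ : IsLocalHomeomorph δ)

instance : TopologicalSpace (Pullback D hδ) :=
  inferInstanceAs (TopologicalSpace {y : X × E // δ y.1 = D.proj y.2})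

namespace Pullback

/-- The projection `δ^* E → X`. -/
def fst (y : Pullback D hδ) : X := y.1.1

/-- The canonical map `δ^* E → E`. -/
def snd (y : Pullback D hδ) : E := y.1.2

theorem continuous_fst : Continuous (fst D hδ) := _root_.continuous_fst.comp continuous_subtype_val

theorem continuous_snd : Continuous (snd D hδ) := _root_.continuous_snd.comp continuous_subtype_val

theorem isLocalHomeomorph_snd : IsLocalHomeomorph (snd D hδ) := by
  refine IsLocalHomeomorph.mk _ fun y => ?_
  obtain ⟨ψ, hy, hψ⟩ := hδ y.1.1
  have hinv : ∀ e, D.proj e ∈ ψ.target → δ (ψ.symm (D.proj e)) = D.proj e := by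
    intro e h
    rw [hψ]; exact ψ.right_inv h
  let inv : E → Pullback D hδ := fun e => open Classical in
    if h : D.proj e ∈ ψ.target then ⟨(ψ.symm (D.proj e), e), hinv e h⟩ else y
  have hinv' : ∀ e (h : D.proj e ∈ ψ.target), inv e = ⟨(ψ.symm (D.proj e), e), hinv e h⟩ :=
    fun e h => dif_pos h
  have hz : ∀ z : Pullback D hδ, D.proj z.1.2 = ψ z.1.1 := fun z =>
    z.2.symm.trans (congrFun hψ z.1.1)
  refine ⟨{
    toFun := snd D hδ
    invFun := inv
    source := fst D hδ ⁻¹' ψ.source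
    target := D.proj ⁻¹' ψ.target
    map_source' := fun z h => ?_
    map_target' := fun e he => ?_
    left_inv' := fun z h => ?_
    right_inv' := fun e he => ?_
    open_source := ψ.open_source.preimage (continuous_fst D hδ)
    open_target := ψ.open_target.preimage D.proj.continuous
    continuousOn_toFun := (continuous_snd D hδ).continuousOn
    continuousOn_invFun := ?_ }, hy, fun _ _ => rfl⟩
  · change D.proj z.1.2 ∈ ψ.target
    rw [hz z]
    exact ψ.map_source h
  · rw [hinv' e he]
    exact ψ.map_target he
  · have ht : D.proj z.1.2 ∈ ψ.target := by
      rw [hz z]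
      exact ψ.map_source h
    refine (hinv' z.1.2 ht).trans (Subtype.ext (Prod.ext ?_ rfl))
    change ψ.symm (D.proj z.1.2) = z.1.1
    rw [hz z]
    exact ψ.left_inv h
  · rw [hinv' e he]
    rfl
  · have hval : IsInducing (fun z : Pullback D hδ => z.1) := IsInducing.subtypeVal
    rw [hval.continuousOn_iff]
    refine ContinuousOn.congr (f := fun e => (ψ.symm (D.proj e), e)) ?_ ?_
    · exact (ψ.continuousOn_symm.comp D.proj.continuous.continuousOn fun e he => he).prodMk
        continuousOn_id
    · intro e he
      exact congrArg Subtype.val (hinv' e he)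

/-- The smooth structure on `δ^* E`: its charts are the charts of `E`, composed with local
inverses of the local homeomorphism `δ^* E → E`. -/
instance : ChartedSpace W (Pullback D hδ) where
  atlas := range fun y => (isLocalHomeomorph_snd D hδ y).choose.trans (chartAt W (snd D hδ y))
  chartAt y := (isLocalHomeomorph_snd D hδ y).choose.trans (chartAt W (snd D hδ y))
  mem_chart_source y := by
    obtain ⟨h1, h2⟩ := (isLocalHomeomorph_snd D hδ y).choose_spec
    refine ⟨h1, ?_⟩
    have h3 : (isLocalHomeomorph_snd D hδ y).choose y = snd D hδ y := (congrFun h2 y).symm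
    change (isLocalHomeomorph_snd D hδ y).choose y ∈ (chartAt W (snd D hδ y)).source
    rw [h3]
    exact mem_chart_source W _
  chart_mem_atlas y := ⟨y, rfl⟩

instance [IsManifold 𝓘(ℝ, W) ∞ E] : IsManifold 𝓘(ℝ, W) ∞ (Pullback D hδ) := by
  refine isManifold_of_contDiffOn _ _ _ ?_
  rintro _ _ ⟨a, rfl⟩ ⟨b, rfl⟩
  obtain ⟨ha1, ha2⟩ := (isLocalHomeomorph_snd D hδ a).choose_spec
  obtain ⟨hb1, hb2⟩ := (isLocalHomeomorph_snd D hδ b).choose_spec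
  set ea := (isLocalHomeomorph_snd D hδ a).choose
  set eb := (isLocalHomeomorph_snd D hδ b).choose
  have hc := (contDiffGroupoid ∞ 𝓘(ℝ, W)).compatible
    (chart_mem_atlas W (snd D hδ a)) (chart_mem_atlas W (snd D hδ b))
  have hc' := (contDiffGroupoid ∞ 𝓘(ℝ, W)).mem_of_eqOnSource hc (Setoid.refl _)
  rw [contDiffGroupoid, mem_groupoid_of_pregroupoid] at hc'
  have hc1 := hc'.1
  simp only [contDiffPregroupoid, modelWithCornersSelf_coe, modelWithCornersSelf_coe_symm,
    preimage_id, range_id, inter_univ, CompTriple.comp_eq] at hc1 ⊢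
  have key : ∀ z ∈ ((ea.trans (chartAt W (snd D hδ a))).symm.trans
      (eb.trans (chartAt W (snd D hδ b)))).source,
      eb (ea.symm ((chartAt W (snd D hδ a)).symm z)) = (chartAt W (snd D hδ a)).symm z := by
    intro z hz
    rw [← hb2]
    nth_rewrite 1 [ha2]
    exact ea.right_inv hz.1.2
  refine (hc1.mono ?_).congr ?_
  · intro z hz
    refine ⟨hz.1.1, ?_⟩
    have h := hz.2.2
    change eb (ea.symm ((chartAt W (snd D hδ a)).symm z)) ∈ (chartAt W (snd D hδ b)).source at h
    rwa [key z hz] at h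
  · intro z hz
    change chartAt W (snd D hδ b) (eb (ea.symm ((chartAt W (snd D hδ a)).symm z))) = _
    rw [key z hz]
    rfl

end Pullback

/-- The pullback of `D` along the local homeomorphism `δ` : the bundle `δ^* E` with the pullback
of the connection form under `δ^* E → E`. -/
def ConnectionData.pullback : ConnectionData n X (Pullback D hδ) W where
  proj := ⟨Pullback.fst D hδ, Pullback.continuous_fst D hδ⟩
  act y g := ⟨(y.1.1, D.act y.1.2 g), y.2.trans (D.proj_act _ _).symm⟩
  proj_act _ _ := rfl
  form y := (D.form (Pullback.snd D hδ y)).comp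
    (mfderiv 𝓘(ℝ, W) 𝓘(ℝ, W) (Pullback.snd D hδ) y)

end Pullback

/-! ### Quotients -/

/-- `q` exhibits the connection `D` on `E → N` as the quotient of the connection `D'` on `E' → N'`
by the action `T` of `Γ` on `E'`: it is a surjective local diffeomorphism whose fibers are the
orbits of `Γ`, it covers `p : N' → N`, it is `G₀`-equivariant and `q^* Ω = Ω'`. -/
structure IsQuotientConnection {n : ℕ} {N E W N' E' W' Γ : Type*}
    [TopologicalSpace N] [TopologicalSpace E] [NormedAddCommGroup W] [NormedSpace ℝ W]
    [ChartedSpace W E] [TopologicalSpace N'] [TopologicalSpace E'] [NormedAddCommGroup W']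
    [NormedSpace ℝ W'] [ChartedSpace W' E'] [Group Γ]
    (D' : ConnectionData n N' E' W') (D : ConnectionData n N E W) (p : N' → N)
    (T : Γ →* Equiv.Perm E') (q : E' → E) : Prop where
  surjective : Function.Surjective q
  isLocalDiffeomorph : IsLocalDiffeomorph 𝓘(ℝ, W') 𝓘(ℝ, W) ∞ q
  fibers : ∀ y z, q y = q z ↔ ∃ γ, T γ y = z
  proj_comp : ∀ y, D.proj (q y) = p (D'.proj y)
  equivariant : ∀ y g, q (D'.act y g) = D.act (q y) g
  form_comp : ∀ (y : E') (v : TangentSpace 𝓘(ℝ, W') y),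
    D.form (q y) (mfderiv 𝓘(ℝ, W') 𝓘(ℝ, W) q y v) = D'.form y v

/-- A morphism `ρ : Γ → PGL(n+1, ℝ)` along which `δ : X → ℝPⁿ` is equivariant makes `Γ` act on the
pullback of the model by automorphisms: `γ (x, g) = (γ x, ρ(γ) g)`. -/
def holonomyAction {n : ℕ} {X Γ : Type*} [TopologicalSpace X] [Group Γ] (a : Γ →* Equiv.Perm X)
    {δ : X → RP n} (hδ : IsLocalHomeomorph δ) (ρ : Γ →* G n)
    (hρ : ∀ γ x, δ (a γ x) = ρ γ • δ x) :
    Γ →* Equiv.Perm (Pullback (model n) hδ) :=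
  MonoidHom.toHomPerm
    { toFun := fun γ y => ⟨(a γ y.1.1, ρ γ * y.1.2), by
        change δ (a γ y.1.1) = (ρ γ * y.1.2) • basePt n
        rw [hρ, mul_smul]
        exact congrArg (ρ γ • ·) y.2⟩
      map_one' := by
        funext y
        refine Subtype.ext (Prod.ext ?_ ?_)
        · change a 1 y.1.1 = y.1.1
          rw [map_one]; rfl
        · change ρ 1 * y.1.2 = y.1.2
          rw [map_one, one_mul]
      map_mul' := fun γ γ' => by
        funext y
        refine Subtype.ext (Prod.ext ?_ ?_)
        · change a (γ * γ') y.1.1 = a γ (a γ' y.1.1)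
          rw [map_mul]; rfl
        · change ρ (γ * γ') * y.1.2 = ρ γ * (ρ γ' * y.1.2)
          rw [map_mul, mul_assoc] }

/-! ### The fundamental group as the group of deck transformations -/

section Deck

variable {M X : Type*} [TopologicalSpace M] [TopologicalSpace X]

/-- The group of deck transformations of `p : X → M`. -/
def Deck (p : X → M) : Subgroup (X ≃ₜ X) where
  carrier := {τ | ∀ x, p (τ x) = p x}
  mul_mem' {σ τ} hσ hτ x := (hσ (τ x)).trans (hτ x)
  one_mem' _ := rfl
  inv_mem' {τ} hτ x := by
    have := hτ (τ.symm x)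
    rw [Homeomorph.apply_symm_apply] at this
    exact this.symm

theorem exists_deck [SimplyConnectedSpace X] [LocallyPathConnectedSpace X] {p : X → M}
    (hp : IsCoveringMap p) (a b : X) (h : p a = p b) : ∃ τ : Deck p, τ.1 a = b := by
  obtain ⟨F, ⟨hF, hF'⟩, -⟩ :=
    hp.existsUnique_continuousMap_lifts ⟨p, hp.continuous⟩ a b h.symm
  obtain ⟨F', ⟨hG, hG'⟩, -⟩ :=
    hp.existsUnique_continuousMap_lifts ⟨p, hp.continuous⟩ b a h
  have hF'' : ∀ x, p (F x) = p x := fun x => congrFun hF' x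
  have hG'' : ∀ x, p (F' x) = p x := fun x => congrFun hG' x
  have h1 : F' ∘ F = id := hp.eq_of_comp_eq (F'.continuous.comp F.continuous) continuous_id
    (funext fun x => (hG'' (F x)).trans (hF'' x)) a (by simp [hF, hG])
  have h2 : F ∘ F' = id := hp.eq_of_comp_eq (F.continuous.comp F'.continuous) continuous_id
    (funext fun x => (hF'' (F' x)).trans (hG'' x)) b (by simp [hF, hG])
  exact ⟨⟨⟨⟨F, F', congrFun h1, congrFun h2⟩, F.continuous, F'.continuous⟩, hF''⟩, hF⟩

variable [SimplyConnectedSpace X] {p : X → M} (hp : IsCoveringMap p) (x₀ : X)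

/-- The class of the loop `p ∘ c`, for any path `c` from `τ x₀` to `x₀`. -/
def loopClass (τ : Deck p) : FundamentalGroup M (p x₀) :=
  .mk (((PathConnectedSpace.somePath (τ.1 x₀) x₀).map hp.continuous).cast (τ.2 x₀).symm rfl)

theorem loopClass_eq (τ : Deck p) (c : Path (τ.1 x₀) x₀) :
    loopClass hp x₀ τ = .mk ((c.map hp.continuous).cast (τ.2 x₀).symm rfl) := by
  have h := SimplyConnectedSpace.paths_homotopic (PathConnectedSpace.somePath (τ.1 x₀) x₀) c
  exact Path.Homotopic.Quotient.eq.2 ((h.map ⟨p, hp.continuous⟩).pathCast _ _)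

theorem monodromy_loopClass (τ : Deck p) :
    hp.monodromy (loopClass hp x₀ τ) ⟨τ.1 x₀, τ.2 x₀⟩ = ⟨x₀, rfl⟩ := by
  refine hp.monodromy_eq_of_map_eq
    (Path.Homotopic.Quotient.mk (PathConnectedSpace.somePath (τ.1 x₀) x₀)) ?_
  rfl

/-- The isomorphism of the group of deck transformations of the universal cover with the
fundamental group, which maps `τ` to the class of the projection to `M` of any path from `τ x₀` to
`x₀`. (In Mathlib `α * β` in the fundamental group runs through `β` first.) -/
def deckEquiv (hX : LocallyPathConnectedSpace X) : Deck p ≃* FundamentalGroup M (p x₀) :=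
  MulEquiv.ofBijective
    (MonoidHom.mk' (loopClass hp x₀) (fun τ σ => by
      let cτ := PathConnectedSpace.somePath (τ.1 x₀) x₀
      let cσ := PathConnectedSpace.somePath (σ.1 x₀) x₀
      rw [loopClass_eq hp x₀ (τ * σ) ((cσ.map τ.1.continuous).trans cτ), FundamentalGroup.mul_def,
        loopClass_eq hp x₀ τ cτ, loopClass_eq hp x₀ σ cσ]
      refine congrArg Path.Homotopic.Quotient.mk (Path.ext (funext fun t => ?_))
      change p (((cσ.map τ.1.continuous).trans cτ) t) = _
      rw [Path.trans_apply, Path.trans_apply]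
      split_ifs
      · exact τ.2 _
      · rfl))
    ⟨fun τ σ h => by
      have h' : loopClass hp x₀ τ = loopClass hp x₀ σ := h
      have h1 := monodromy_loopClass hp x₀ τ
      have h2 := monodromy_loopClass hp x₀ σ
      rw [← h'] at h2
      have h3 := congrArg Subtype.val ((hp.monodromy_bijective _).1 (h1.trans h2.symm))
      have h4 := hp.eq_of_comp_eq τ.1.continuous σ.1.continuous
        (funext fun x => (τ.2 x).trans (σ.2 x).symm) x₀ h3
      exact Subtype.ext (Homeomorph.ext (congrFun h4)), fun γ => by
      obtain ⟨e, he⟩ := (hp.monodromy_bijective γ).2 ⟨x₀, rfl⟩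
      obtain ⟨τ, hτ⟩ := exists_deck hp x₀ e.1 e.2.symm
      refine ⟨τ, ?_⟩
      obtain ⟨e, hpe⟩ := e
      obtain rfl : τ.1 x₀ = e := hτ
      have hx : x₀ = (hp.monodromy γ ⟨τ.1 x₀, hpe⟩).1 := congrArg Subtype.val he.symm
      obtain ⟨c, hc⟩ := Path.Homotopic.Quotient.mk_surjective
        ((hp.liftPathQuotient γ ⟨τ.1 x₀, hpe⟩).cast rfl hx)
      refine (loopClass_eq hp x₀ τ c).trans ?_
      change Path.Homotopic.Quotient.cast (Path.Homotopic.Quotient.map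
        (Path.Homotopic.Quotient.mk c) ⟨p, hp.continuous⟩) _ _ = γ
      rw [hc, Path.Homotopic.Quotient.map_cast, hp.map_liftPathQuotient]
      exact (((Path.Homotopic.Quotient.cast_cast _ _ _ _ _).trans
        (Path.Homotopic.Quotient.cast_cast γ _ _ _ _))).trans
          (Path.Homotopic.Quotient.cast_rfl_rfl γ)⟩

/-- The action of the fundamental group on the universal cover by deck transformations. -/
def pi1Action (hX : LocallyPathConnectedSpace X) : FundamentalGroup M (p x₀) →* Equiv.Perm X :=
  MonoidHom.comp
    { toFun := fun τ : Deck p => τ.1.toEquiv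
      map_one' := rfl
      map_mul' := fun _ _ => rfl }
    (deckEquiv hp x₀ hX).symm.toMonoidHom

end Deck

end ProjConn

end

noncomputable section

namespace ProjConn

set_option maxSynthPendingDepth 3

/-! ### Total linear differential equations `dF = θ F` -/

section LinearFrobenius

/-! On the total space consider the equation `dm = m Ω` for a matrix valued function `m`.
Differentiating it gives `0 = dm ∧ Ω + m dΩ = m (dΩ + Ω ∧ Ω)`, so flatness is the integrability
condition, and there are local solutions with any initial value (`exists_hasFDerivAt_linear`, by
solving along rays). Where `m` is invertible, its class `F = [m]` in `PGL` pulls the Maurer–Cartan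
form back to `Ω` (`exists_isDevAt`, `IsDevAt.model_form`). Such an `F` is a local diffeomorphism
because both forms are pointwise isomorphisms, and two of them differ near a point by a constant
left factor (`IsDevAt.unique`).

For `A` in `𝔤₀` the equation along the flow of `A⃗` reads `m' = m A`, hence `F (e · exp A) = F e ·
exp A`. Combined with transport by the structure group this yields, over small open sets of the
base, developing maps on the whole preimage with `F (e · g) = F e · g` (`exists_isDevOn`). The left
factor relating two of them is locally constant on the base, so their germs form a covering space
with discrete fiber `PGL` (`devCore`). The universal covering map lifts to it, and the lift is a
family of maps `Φ x`, from the fiber of `E` over `p x` to `PGL`, which locally in `x` come from a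
single developing map (`exists_isGlobalDev`).

Everything is read off from `Φ`. The point `δ x = Φ x e • [e₀]` does not depend on `e`, by
equivariance. The relation `Φ (γ x) = ρ γ * Φ x` defines the holonomy, by local uniqueness and
connectedness. The quotient map sends `(x, g)` to the unique `e` over `p x` with `Φ x e = g`.
Locally `F ∘ q` is the map `(x, g) ↦ g`, which makes `q` a local diffeomorphism and identifies the
connection forms. -/

theorem two_le_infty : (2 : WithTop ℕ∞) ≤ ∞ := WithTop.coe_le_coe.2 le_top

variable {W V : Type*} [NormedAddCommGroup W] [NormedSpace ℝ W]
  [NormedAddCommGroup V] [NormedSpace ℝ V]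

/-- A solution of the total linear equation `dF = θ F` which vanishes at a point vanishes nearby. -/
theorem eventually_eq_zero_of_hasFDerivAt_linear {θ : W → W →L[ℝ] V →L[ℝ] V} {F : W → V} {y₀ : W}
    (hθ : ContinuousAt θ y₀) (hF : ∀ᶠ y in 𝓝 y₀, HasFDerivAt F ((θ y).flip (F y)) y)
    (h0 : F y₀ = 0) : ∀ᶠ y in 𝓝 y₀, F y = 0 := by
  have hb : ∀ᶠ y in 𝓝 y₀, ‖θ y‖ < ‖θ y₀‖ + 1 := 
    (Filter.Tendsto.norm hθ).eventually_lt_const (by linarith)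
  obtain ⟨r, hr, hball⟩ := Metric.eventually_nhds_iff_ball.1 (hF.and hb)
  refine Metric.eventually_nhds_iff_ball.2 ⟨r, hr, fun y hy => ?_⟩
  have hmem : ∀ t ∈ Icc (0 : ℝ) 1, y₀ + t • (y - y₀) ∈ Metric.ball y₀ r := fun t ht =>
    (convex_ball y₀ r).add_smul_sub_mem (Metric.mem_ball_self hr) hy ht
  have hd : ∀ t ∈ Icc (0 : ℝ) 1, HasDerivAt (fun t : ℝ => F (y₀ + t • (y - y₀)))
      (θ (y₀ + t • (y - y₀)) (y - y₀) (F (y₀ + t • (y - y₀)))) t := by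
    intro t ht
    have h1 : HasDerivAt (fun t : ℝ => y₀ + t • (y - y₀)) (y - y₀) t := by
      simpa using ((hasDerivAt_id t).smul_const (y - y₀)).const_add y₀
    exact (hball _ (hmem t ht)).1.comp_hasDerivAt t h1
  -- Grönwall along the segment from `y₀` to `y`: the restriction `f` satisfies `‖f'‖ ≤ K ‖f‖` and
  -- `f 0 = 0`.
  have key := eq_zero_of_abs_deriv_le_mul_abs_self_of_eq_zero_right
    (f := fun t : ℝ => F (y₀ + t • (y - y₀))) (K := (‖θ y₀‖ + 1) * ‖y - y₀‖) (a := 0) (b := 1)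
    (fun t ht => (hd t ht).continuousAt.continuousWithinAt)
    (fun t ht => (hd t (Ico_subset_Icc_self ht)).hasDerivWithinAt) (by simpa using h0)
    (fun t ht => by
      have h2 := (hball _ (hmem t (Ico_subset_Icc_self ht))).2.le
      calc _ ≤ ‖θ (y₀ + t • (y - y₀))‖ * ‖y - y₀‖ * ‖F (y₀ + t • (y - y₀))‖ :=
            ContinuousLinearMap.le_opNorm₂ _ _ _
        _ ≤ _ := by gcongr)
  simpa using key 1 (by simp)

/-- Bootstrapping: solutions of `dF = θ F` with `θ` smooth are smooth. -/
theorem contDiffOn_of_hasFDerivAt_linear {θ : W → W →L[ℝ] V →L[ℝ] V} {F : W → V} {s : Set W}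
    (hs : IsOpen s) (hθ : ContDiffOn ℝ ∞ θ s)
    (hF : ∀ y ∈ s, HasFDerivAt F ((θ y).flip (F y)) y) : ContDiffOn ℝ ∞ F s := by
  refine contDiffOn_infty.2 fun k => ?_
  induction k with
  | zero => exact contDiffOn_zero.2 fun y hy => (hF y hy).continuousAt.continuousWithinAt
  | succ k ih =>
    push_cast
    refine (contDiffOn_succ_iff_fderiv_of_isOpen hs).2
      ⟨fun y hy => (hF y hy).differentiableAt.differentiableWithinAt, fun h => (WithTop.coe_ne_top h).elim, ?_⟩
    refine ContDiffOn.congr (f := fun y => (θ y).flip (F y)) ?_ fun y hy => (hF y hy).fderiv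
    have h1 : ContDiffOn ℝ k (fun y => (θ y).flip) s :=
      (ContinuousLinearMap.flipₗᵢ ℝ W V V).contDiff.comp_contDiffOn
        (hθ.of_le (by exact_mod_cast le_top))
    exact h1.clm_apply ih

/-- Solutions of the equation `dF = θ F` along the rays from the origin. -/
theorem exists_ray_solution [CompleteSpace V] {θ : W → W →L[ℝ] V →L[ℝ] V} {r C : ℝ} (hr : 0 < r)
    (hC : 0 ≤ C) (hθ : ContinuousOn θ (Metric.ball 0 r)) (hb : ∀ y ∈ Metric.ball 0 r, ‖θ y‖ ≤ C)
    (hrC : C * r ≤ 1 / 2) (x₀ : V) {w : W} (hw : w ∈ Metric.ball 0 r) :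
    ∃ α : ℝ → V, α 0 = x₀ ∧
      ∀ t ∈ Icc (0 : ℝ) 1, HasDerivWithinAt α (θ (t • w) w (α t)) (Icc 0 1) t := by
  have hmem : ∀ t ∈ Icc (0 : ℝ) 1, t • w ∈ Metric.ball (0 : W) r := fun t ht =>
    (convex_ball (0 : W) r).smul_mem_of_zero_mem (Metric.mem_ball_self hr) hw ht
  have hnorm : ∀ t ∈ Icc (0 : ℝ) 1, ‖θ (t • w) w‖ ≤ 1 / 2 := fun t ht =>
    ((θ (t • w)).le_opNorm w).trans ((mul_le_mul (hb _ (hmem t ht)) (mem_ball_zero_iff.1 hw).le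
      (norm_nonneg _) hC).trans hrC)
  -- On the ball of radius `‖x₀‖` about `x₀` vectors have norm at most `2 ‖x₀‖`, so by `hnorm` the
  -- speed is at most `‖x₀‖` and the solution cannot leave the ball before time `1`.
  have hP : IsPicardLindelof (fun t x => θ (t • w) w x) (tmin := 0) (tmax := 1) ⟨0, by simp⟩ x₀
      ‖x₀‖₊ 0 ‖x₀‖₊ 1 := by
    refine ⟨fun t ht => ?_, fun x _ => ?_, fun t ht x hx => ?_, by simp⟩
    · refine (LipschitzWith.of_dist_le_mul fun x y => ?_).lipschitzOnWith
      rw [dist_eq_norm, dist_eq_norm, ← map_sub]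
      refine ((θ (t • w) w).le_opNorm _).trans ?_
      have := hnorm t ht
      gcongr
      simpa using this.trans (by norm_num)
    · have h1 : ContinuousOn (fun t : ℝ => θ (t • w)) (Icc 0 1) :=
        hθ.comp (by fun_prop) hmem
      exact (h1.clm_apply continuousOn_const).clm_apply continuousOn_const
    · have h1 : ‖x‖ ≤ 2 * ‖x₀‖ := by
        have h2 : ‖x - x₀‖ ≤ ‖x₀‖ := by simpa [dist_eq_norm] using hx
        linarith [norm_le_norm_add_norm_sub' x x₀]
      calc ‖θ (t • w) w x‖ ≤ ‖θ (t • w) w‖ * ‖x‖ := (θ (t • w) w).le_opNorm _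
        _ ≤ 1 / 2 * (2 * ‖x₀‖) := mul_le_mul (hnorm t ht) h1 (norm_nonneg _) (by norm_num)
        _ = _ := by simp
  exact hP.exists_eq_forall_mem_Icc_hasDerivWithinAt₀

/-- Mean value inequality for `f` minus its linear part at `y`: on the segment to `z` the derivative
of this difference is at most `C ‖z - y‖`. -/
theorem norm_sub_sub_fderiv_le {X : Type*} [NormedAddCommGroup X] [NormedSpace ℝ X] {f : W → X}
    {s : Set W} (hs : Convex ℝ s) {C : ℝ} (hC : 0 ≤ C) (hf : ∀ y ∈ s, DifferentiableAt ℝ f y)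
    (hL : ∀ y ∈ s, ∀ z ∈ s, ‖fderiv ℝ f y - fderiv ℝ f z‖ ≤ C * ‖y - z‖) {y z : W} (hy : y ∈ s)
    (hz : z ∈ s) : ‖f z - f y - fderiv ℝ f y (z - y)‖ ≤ C * ‖z - y‖ ^ 2 := by
  have hseg : segment ℝ y z ⊆ s := hs.segment_subset hy hz
  have := (convex_segment y z).norm_image_sub_le_of_norm_hasFDerivWithin_le' (f := f)
    (f' := fderiv ℝ f) (φ := fderiv ℝ f y) (C := C * ‖z - y‖)
    (fun x hx => (hf x (hseg hx)).hasFDerivAt.hasFDerivWithinAt)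
    (fun x hx => (hL x (hseg hx) y hy).trans (by
      gcongr
      obtain ⟨t, ht, rfl⟩ := (segment_eq_image' ℝ y z ▸ hx : x ∈ _)
      rw [add_sub_cancel_left, norm_smul, Real.norm_of_nonneg ht.1]
      exact mul_le_of_le_one_left (norm_nonneg _) ht.2)) (left_mem_segment ℝ y z)
      (right_mem_segment ℝ y z)
  calc _ ≤ _ := this
    _ = _ := by ring


/-- The estimate behind the differentiability of solutions along rays in the initial direction. -/
theorem exists_norm_ray_solution_sub_le {θ : W → W →L[ℝ] V →L[ℝ] V} {r C C₁ C₂ : ℝ}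
    (hC : 0 ≤ C) (hC₁ : 0 ≤ C₁) (hC₂ : 0 ≤ C₂) (hr1 : r ≤ 1) (hrC : C * r ≤ 1 / 2)
    (hd : ∀ y ∈ Metric.ball 0 r, DifferentiableAt ℝ θ y)
    (hb : ∀ y ∈ Metric.ball 0 r, ‖θ y‖ ≤ C)
    (hb₁ : ∀ y ∈ Metric.ball 0 r, ‖fderiv ℝ θ y‖ ≤ C₁)
    (hL : ∀ y ∈ Metric.ball 0 r, ∀ z ∈ Metric.ball 0 r,
      ‖fderiv ℝ θ y - fderiv ℝ θ z‖ ≤ C₂ * ‖y - z‖)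
    (hint : ∀ y ∈ Metric.ball 0 r, ∀ u v x, fderiv ℝ θ y u v x + θ y v (θ y u x) =
      fderiv ℝ θ y v u x + θ y u (θ y v x)) {x₀ : V} {α : W → ℝ → V} (hα0 : ∀ w, α w 0 = x₀)
    (hα : ∀ w ∈ Metric.ball 0 r, ∀ t ∈ Icc (0 : ℝ) 1,
      HasDerivWithinAt (α w) (θ (t • w) w (α w t)) (Icc 0 1) t) :
    ∃ K : ℝ, ∀ y ∈ Metric.ball 0 r, ∀ z ∈ Metric.ball 0 r,
      ‖α z 1 - α y 1 - θ y (z - y) (α y 1)‖ ≤ K * ‖z - y‖ ^ 2 := by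
  have hrr : ∀ w ∈ Metric.ball (0 : W) r, ‖w‖ ≤ r := fun w hw => (mem_ball_zero_iff.1 hw).le
  have hmem : ∀ w ∈ Metric.ball (0 : W) r, ∀ t ∈ Icc (0 : ℝ) 1, t • w ∈ Metric.ball (0 : W) r :=
    fun w hw t ht => (convex_ball (0 : W) r).smul_mem_of_zero_mem
      (Metric.mem_ball_self ((norm_nonneg w).trans_lt (mem_ball_zero_iff.1 hw))) hw ht
  have hnorm : ∀ w ∈ Metric.ball (0 : W) r, ∀ t ∈ Icc (0 : ℝ) 1, ‖θ (t • w) w‖ ≤ 1 / 2 :=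
    fun w hw t ht => ((θ (t • w)).le_opNorm w).trans ((mul_le_mul (hb _ (hmem w hw t ht)) (hrr w hw)
      (norm_nonneg _) hC).trans hrC)
  have hright : ∀ {f : ℝ → V} {f' : V} {t : ℝ}, t ∈ Ico (0 : ℝ) 1 →
      HasDerivWithinAt f f' (Icc 0 1) t → HasDerivWithinAt f f' (Ici t) t := fun ht h =>
    h.mono_of_mem_nhdsWithin (Icc_mem_nhdsGE_of_mem ht)
  -- A bound for all ray solutions at once, uniform in the direction because `‖θ (t • w) w‖ ≤ 1 /
  -- 2`.
  set B := gronwallBound ‖x₀‖ (1 / 2) 0 1 with hB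
  have hBnn : 0 ≤ B := by rw [hB, gronwallBound_ε0]; positivity
  have hαB : ∀ w ∈ Metric.ball 0 r, ∀ t ∈ Icc (0 : ℝ) 1, ‖α w t‖ ≤ B := by
    intro w hw t ht
    have := norm_le_gronwallBound_of_norm_deriv_right_le (f := α w) (δ := ‖x₀‖) (K := 1 / 2)
      (ε := 0) (a := 0) (b := 1) (fun t ht => (hα w hw t ht).continuousWithinAt)
      (fun t ht => hright ht (hα w hw t (Ico_subset_Icc_self ht))) (by rw [hα0])
      (fun t ht => by
        rw [add_zero]
        exact ((θ (t • w) w).le_opNorm _).trans (by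
          gcongr; exact hnorm w hw t (Ico_subset_Icc_self ht))) t ht
    refine this.trans (gronwallBound_mono (norm_nonneg _) le_rfl (by norm_num) ?_)
    simpa using ht.2
  -- Coefficient of `‖h‖ ^ 2` in the error terms `n2` and `n3`: the Taylor remainder of `θ` (`C₂`),
  -- the change of `θ` applied to `h` (`C₁`), and the correction term inserted into the equation
  -- (`(C₁ + C) * C`). The assumption `r ≤ 1` removes the factors `‖y‖` and `‖y + h‖`.
  set M := ((C₂ + C₁) + (C₁ + C) * C) * B with hM
  have hMnn : 0 ≤ M := by positivity
  refine ⟨M * gronwallBound 0 (1 / 2) 1 1, fun y hy z hz => ?_⟩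
  obtain ⟨h, rfl⟩ : ∃ h, z = y + h := ⟨z - y, by simp⟩
  rw [add_sub_cancel_left]
  have hh2 : ∀ t ∈ Icc (0 : ℝ) 1, ‖t • h‖ ≤ ‖h‖ := fun t ht => by
    rw [norm_smul, Real.norm_of_nonneg ht.1]
    exact mul_le_of_le_one_left (norm_nonneg _) ht.2
  have hLip : ∀ t ∈ Icc (0 : ℝ) 1, ‖θ (t • (y + h)) - θ (t • y)‖ ≤ C₁ * ‖h‖ := by
    intro t ht
    have := (convex_ball (0 : W) r).norm_image_sub_le_of_norm_fderiv_le hd hb₁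
      (hmem y hy t ht) (hmem _ hz t ht)
    refine this.trans ?_
    rw [← smul_sub, add_sub_cancel_left]
    exact mul_le_mul_of_nonneg_left (hh2 t ht) hC₁
  have hTay : ∀ t ∈ Icc (0 : ℝ) 1,
      ‖θ (t • (y + h)) - θ (t • y) - t • fderiv ℝ θ (t • y) h‖ ≤ C₂ * ‖h‖ ^ 2 := by
    intro t ht
    have := norm_sub_sub_fderiv_le (convex_ball (0 : W) r) hC₂ hd hL (hmem y hy t ht)
      (hmem _ hz t ht)
    rw [← smul_sub, add_sub_cancel_left, map_smul] at this
    refine this.trans ?_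
    have := hh2 t ht
    gcongr
  -- When `y` moves by `h`, the point `t • y` moves by `t • h`, so a solution of `dF = θ F` changes
  -- to first order by `t • θ (t • y) h (α y t)`. Grönwall is applied to what remains after
  -- subtracting this.
  have hcont := norm_le_gronwallBound_of_norm_deriv_right_le
    (f := fun t => α (y + h) t - α y t - t • θ (t • y) h (α y t))
    (f' := fun t => θ (t • (y + h)) (y + h) (α (y + h) t) - θ (t • y) y (α y t) -
      (t • (fderiv ℝ θ (t • y) y h (α y t) + θ (t • y) h (θ (t • y) y (α y t))) +
        (1 : ℝ) • θ (t • y) h (α y t)))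
    (δ := 0) (K := 1 / 2) (ε := M * ‖h‖ ^ 2) (a := 0) (b := 1)
  have hder : ∀ t ∈ Icc (0 : ℝ) 1,
      HasDerivWithinAt (fun t => α (y + h) t - α y t - t • θ (t • y) h (α y t))
        (θ (t • (y + h)) (y + h) (α (y + h) t) - θ (t • y) y (α y t) -
      (t • (fderiv ℝ θ (t • y) y h (α y t) + θ (t • y) h (θ (t • y) y (α y t))) +
        (1 : ℝ) • θ (t • y) h (α y t))) (Icc 0 1) t := by
    intro t ht
    refine ((hα _ hz t ht).sub (hα y hy t ht)).sub ?_
    have h1 : HasDerivAt (fun t : ℝ => t • y) y t := by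
      simpa using (hasDerivAt_id t).smul_const y
    have h2 : HasDerivAt (fun t : ℝ => θ (t • y)) (fderiv ℝ θ (t • y) y) t :=
      (hd _ (hmem y hy t ht)).hasFDerivAt.comp_hasDerivAt t h1
    have h3 : HasDerivAt (fun t : ℝ => θ (t • y) h) (fderiv ℝ θ (t • y) y h) t := by
      simpa using h2.clm_apply (hasDerivAt_const t h)
    exact (hasDerivAt_id t).hasDerivWithinAt.smul (h3.hasDerivWithinAt.clm_apply (hα y hy t ht))
  have hfin := hcont (fun t ht => (hder t ht).continuousWithinAt)
    (fun t ht => hright ht (hder t (Ico_subset_Icc_self ht))) (by simp [hα0])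
    (fun t ht' => by
      have ht := Ico_subset_Icc_self ht'
      set Δ := α (y + h) t - α y t - t • θ (t • y) h (α y t) with hΔ
      have e1 : α (y + h) t = Δ + α y t + t • θ (t • y) h (α y t) := by rw [hΔ]; abel
      have e2 : θ (t • (y + h)) (y + h) (α (y + h) t) - θ (t • y) y (α y t) -
          (t • (fderiv ℝ θ (t • y) y h (α y t) + θ (t • y) h (θ (t • y) y (α y t))) +
          (1 : ℝ) • θ (t • y) h (α y t)) =
          θ (t • (y + h)) (y + h) Δ +
          (((θ (t • (y + h)) - θ (t • y) - t • fderiv ℝ θ (t • y) h) y +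
            (θ (t • (y + h)) - θ (t • y)) h) (α y t) +
          t • ((θ (t • (y + h)) - θ (t • y)) (y + h) + θ (t • y) h) (θ (t • y) h (α y t))) := by
        -- Integrability exchanges `y` and `h` in the derivative of the correction term. All terms
        -- of first order in `h` then cancel, apart from those absorbed in `Δ`.
        rw [hint _ (hmem y hy t ht), e1]
        simp only [map_add, map_smul, _root_.add_apply,
          _root_.sub_apply, _root_.smul_apply, smul_add, smul_sub,
          one_smul]
        abel
      have n1 : ‖θ (t • (y + h)) (y + h) Δ‖ ≤ 1 / 2 * ‖Δ‖ :=
        ((θ (t • (y + h)) (y + h)).le_opNorm _).trans (by gcongr; exact hnorm _ hz t ht)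
      have n2 : ‖((θ (t • (y + h)) - θ (t • y) - t • fderiv ℝ θ (t • y) h) y +
            (θ (t • (y + h)) - θ (t • y)) h) (α y t)‖ ≤ ((C₂ + C₁) * ‖h‖ ^ 2) * B := by
        refine (ContinuousLinearMap.le_opNorm _ _).trans
          (mul_le_mul ?_ (hαB y hy t ht) (norm_nonneg _) (by positivity))
        refine (norm_add_le _ _).trans ?_
        have a1 := (ContinuousLinearMap.le_opNorm
          (θ (t • (y + h)) - θ (t • y) - t • fderiv ℝ θ (t • y) h) y).trans
          (mul_le_mul (hTay t ht) ((hrr y hy).trans hr1) (norm_nonneg _) (by positivity))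
        have a2 := (ContinuousLinearMap.le_opNorm (θ (t • (y + h)) - θ (t • y)) h).trans
          (mul_le_mul_of_nonneg_right (hLip t ht) (norm_nonneg _))
        refine (add_le_add a1 a2).trans (le_of_eq ?_)
        ring
      have n3 : ‖t • ((θ (t • (y + h)) - θ (t • y)) (y + h) + θ (t • y) h)
          (θ (t • y) h (α y t))‖ ≤ ((C₁ + C) * ‖h‖) * (C * ‖h‖ * B) := by
        rw [norm_smul, Real.norm_of_nonneg ht.1]
        refine (mul_le_of_le_one_left (norm_nonneg _) ht.2).trans ?_
        have a0 := (θ (t • y)).le_opNorm h |>.trans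
          (mul_le_mul_of_nonneg_right (hb _ (hmem y hy t ht)) (norm_nonneg _))
        have a1 := (ContinuousLinearMap.le_opNorm (θ (t • (y + h)) - θ (t • y)) (y + h)).trans
          (mul_le_mul (hLip t ht) ((hrr _ hz).trans hr1) (norm_nonneg _) (by positivity))
        refine (ContinuousLinearMap.le_opNorm _ _).trans (mul_le_mul ?_ ?_ (norm_nonneg _)
          (by positivity))
        · refine (norm_add_le _ _).trans ((add_le_add a1 a0).trans (le_of_eq ?_))
          ring
        · exact (ContinuousLinearMap.le_opNorm _ _).trans
            (mul_le_mul a0 (hαB y hy t ht) (norm_nonneg _) (by positivity))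
      rw [e2]
      refine (norm_add_le _ _).trans (add_le_add n1 ((norm_add_le _ _).trans
        ((add_le_add n2 n3).trans (le_of_eq ?_))))
      rw [hM]
      ring) 1 (by simp)
  simp only [one_smul, sub_zero] at hfin
  refine hfin.trans (le_of_eq ?_)
  -- With initial value zero the Grönwall bound is proportional to the inhomogeneity, so `M * ‖h‖ ^
  -- 2` factors out.
  rw [gronwallBound_of_K_ne_0 (by norm_num), gronwallBound_of_K_ne_0 (by norm_num)]
  simp only [zero_mul, zero_add]
  ring

/-- The candidate `F w` is the value at time `1` of the solution along the ray to `w`. The quadratic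
estimate holds between any two points of the ball, so it gives the derivative at every nearby point
and not only at the origin. -/
theorem exists_hasFDerivAt_linear_zero [CompleteSpace V] {θ : W → W →L[ℝ] V →L[ℝ] V}
    (hθ : ContDiffAt ℝ ∞ θ 0)
    (hint : ∀ᶠ y in 𝓝 0, ∀ u v x, fderiv ℝ θ y u v x + θ y v (θ y u x) =
      fderiv ℝ θ y v u x + θ y u (θ y v x)) (x₀ : V) :
    ∃ F : W → V, F 0 = x₀ ∧ ∀ᶠ y in 𝓝 0, HasFDerivAt F ((θ y).flip (F y)) y := by
  have h1 : ∀ᶠ y in 𝓝 (0 : W), ContDiffAt ℝ 2 θ y :=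
    (hθ.of_le (two_le_infty)).eventually (by simp)
  have h2 : ContDiffAt ℝ 1 (fderiv ℝ θ) 0 :=
    hθ.fderiv_right (by rw [one_add_one_eq_two]; exact two_le_infty)
  obtain ⟨K, t, ht, hK⟩ := h2.exists_lipschitzOnWith
  have h3 : ∀ᶠ y in 𝓝 (0 : W), ‖θ y‖ < ‖θ 0‖ + 1 :=
    (Filter.Tendsto.norm hθ.continuousAt).eventually_lt_const (by linarith)
  have h4 : ∀ᶠ y in 𝓝 (0 : W), ‖fderiv ℝ θ y‖ < ‖fderiv ℝ θ 0‖ + 1 :=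
    (Filter.Tendsto.norm h2.continuousAt).eventually_lt_const (by linarith)
  obtain ⟨R, hR, hball⟩ := Metric.eventually_nhds_iff_ball.1
    (h1.and (h3.and (h4.and (hint.and ht))))
  set C := ‖θ 0‖ + 1 with hC
  have hCpos : 0 < C := by positivity
  -- Small enough for the local bounds on `θ` and its derivative, for `r ≤ 1`, and for `C * r ≤ 1 /
  -- 2`.
  set r := min R (min 1 (1 / 2 / C)) with hr
  have hrpos : 0 < r := by positivity
  have hsub : ∀ y ∈ Metric.ball (0 : W) r, y ∈ Metric.ball (0 : W) R := fun y hy =>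
    Metric.ball_subset_ball (min_le_left _ _) hy
  have hrC : C * r ≤ 1 / 2 := by
    have : r ≤ 1 / 2 / C := (min_le_right _ _).trans (min_le_right _ _)
    rw [le_div_iff₀ hCpos] at this
    linarith
  have hdiff : ∀ y ∈ Metric.ball (0 : W) r, DifferentiableAt ℝ θ y := fun y hy =>
    (hball y (hsub y hy)).1.differentiableAt (by simp)
  have hsol : ∀ w : W, ∃ α : ℝ → V, α 0 = x₀ ∧ (w ∈ Metric.ball 0 r →
      ∀ t ∈ Icc (0 : ℝ) 1, HasDerivWithinAt α (θ (t • w) w (α t)) (Icc 0 1) t) := by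
    intro w
    by_cases hw : w ∈ Metric.ball 0 r
    · obtain ⟨α, h, h'⟩ := exists_ray_solution hrpos hCpos.le
        (fun y hy => (hdiff y hy).continuousAt.continuousWithinAt)
        (fun y hy => (hball y (hsub y hy)).2.1.le) hrC x₀ hw
      exact ⟨α, h, fun _ => h'⟩
    -- Outside the ball any curve from `x₀` serves; it only makes `α` total.
    · exact ⟨fun _ => x₀, rfl, fun h => absurd h hw⟩
  choose α hα0 hα using hsol
  obtain ⟨K', hK'⟩ := exists_norm_ray_solution_sub_le hCpos.le
    (by positivity : 0 ≤ ‖fderiv ℝ θ 0‖ + 1) K.coe_nonneg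
    ((min_le_right _ _).trans (min_le_left _ _)) hrC hdiff
    (fun y hy => (hball y (hsub y hy)).2.1.le) (fun y hy => (hball y (hsub y hy)).2.2.1.le)
    (fun y hy z hz => by
      have := hK.dist_le_mul y (hball y (hsub y hy)).2.2.2.2 z (hball z (hsub z hz)).2.2.2.2
      rwa [dist_eq_norm, dist_eq_norm] at this)
    (fun y hy => (hball y (hsub y hy)).2.2.2.1) hα0 hα
  refine ⟨fun w => α w 1, ?_, Metric.eventually_nhds_iff_ball.2 ⟨r, hrpos, fun y hy => ?_⟩⟩
  -- The ray to the origin does not move, so its solution is constant and `F 0` is the initial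
  -- value.
  · have hc : ∀ t ∈ Icc (0 : ℝ) 1, HasDerivWithinAt (α 0) 0 (Icc 0 1) t := fun t ht => by
      simpa using hα 0 (Metric.mem_ball_self hrpos) t ht
    have := (convex_Icc (0 : ℝ) 1).norm_image_sub_le_of_norm_hasDerivWithin_le (C := 0) hc
      (by simp) (left_mem_Icc.2 zero_le_one) (right_mem_Icc.2 zero_le_one)
    rw [← hα0 0]
    simpa [sub_eq_zero] using this
  · have hO : (fun z => α z 1 - α y 1 - θ y (z - y) (α y 1)) =O[𝓝 y] fun z => ‖z - y‖ ^ 2 := by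
      refine Asymptotics.IsBigO.of_bound K' ?_
      filter_upwards [Metric.isOpen_ball.mem_nhds hy] with z hz
      simpa using hK' y hy z hz
    rw [hasFDerivAt_iff_isLittleO]
    refine hO.trans_isLittleO ?_
    have h5 : Filter.Tendsto (fun z : W => z - y) (𝓝 y) (𝓝 0) := by
      simpa using Continuous.tendsto (by fun_prop : Continuous fun z : W => z - y) y
    exact (Asymptotics.isLittleO_norm_pow_id (E' := W) one_lt_two).comp_tendsto h5

/-- **Frobenius theorem** for total linear differential equations `dF = θ F`: if the integrability
condition holds, there are local smooth solutions with any initial value. -/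
theorem exists_hasFDerivAt_linear [CompleteSpace V] {θ : W → W →L[ℝ] V →L[ℝ] V} {y₀ : W}
    (hθ : ContDiffAt ℝ ∞ θ y₀)
    (hint : ∀ᶠ y in 𝓝 y₀, ∀ u v x, fderiv ℝ θ y u v x + θ y v (θ y u x) =
      fderiv ℝ θ y v u x + θ y u (θ y v x)) (x₀ : V) :
    ∃ F : W → V, F y₀ = x₀ ∧ ∀ᶠ y in 𝓝 y₀, HasFDerivAt F ((θ y).flip (F y)) y := by
  have ht : Filter.Tendsto (fun y : W => y + y₀) (𝓝 0) (𝓝 y₀) := by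
    simpa using Continuous.tendsto (by fun_prop : Continuous fun y : W => y + y₀) 0
  obtain ⟨F, h0, hF⟩ := exists_hasFDerivAt_linear_zero (θ := fun y => θ (y + y₀))
    (ContDiffAt.comp 0 (by simpa using hθ) (by fun_prop))
    (by simpa only [fderiv_comp_add_right] using ht.eventually hint) x₀
  refine ⟨fun y => F (y - y₀), by simpa using h0, ?_⟩
  have ht' : Filter.Tendsto (fun y : W => y - y₀) (𝓝 y₀) (𝓝 0) := by
    simpa using Continuous.tendsto (by fun_prop : Continuous fun y : W => y - y₀) y₀
  filter_upwards [ht'.eventually hF] with y hy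
  rw [sub_add_cancel] at hy
  exact (hasFDerivAt_comp_sub y₀).2 hy

end LinearFrobenius

/-! ### Local diffeomorphisms -/

section LocalDiffeomorph

/-- A smooth map with a smooth local inverse is a local diffeomorphism. -/
theorem isLocalDiffeomorphAt_of_inverse {V₁ H₁ X V₂ H₂ Y : Type*}
    [NormedAddCommGroup V₁] [NormedSpace ℝ V₁] [TopologicalSpace H₁] [TopologicalSpace X]
    [ChartedSpace H₁ X] [NormedAddCommGroup V₂] [NormedSpace ℝ V₂] [TopologicalSpace H₂]
    [TopologicalSpace Y] [ChartedSpace H₂ Y] {I : ModelWithCorners ℝ V₁ H₁}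
    {J : ModelWithCorners ℝ V₂ H₂} {f : X → Y} {g : Y → X} {a : X}
    (hf : ∀ᶠ x in 𝓝 a, ContMDiffAt I J ∞ f x) (hg : ∀ᶠ y in 𝓝 (f a), ContMDiffAt J I ∞ g y)
    (hgf : ∀ᶠ x in 𝓝 a, g (f x) = x) (hfg : ∀ᶠ y in 𝓝 (f a), f (g y) = y) :
    IsLocalDiffeomorphAt I J ∞ f a := by
  obtain ⟨U, hU, hUo, haU⟩ := eventually_nhds_iff.1 (hf.and hgf)
  obtain ⟨V, hV, hVo, haV⟩ := eventually_nhds_iff.1 (hg.and hfg)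
  have hfc : ContinuousOn f U := fun x hx => (hU x hx).1.continuousAt.continuousWithinAt
  have hgc : ContinuousOn g V := fun x hx => (hV x hx).1.continuousAt.continuousWithinAt
  refine ⟨⟨⟨f, g, U ∩ f ⁻¹' V, V ∩ g ⁻¹' U, ?_, ?_, ?_, ?_⟩, ?_, ?_, ?_, ?_⟩, ⟨haU, haV⟩,
    fun _ _ => rfl⟩
  · rintro x ⟨hx, hx'⟩
    exact ⟨hx', by rw [mem_preimage, (hU x hx).2]; exact hx⟩
  · rintro y ⟨hy, hy'⟩
    exact ⟨hy', by rw [mem_preimage, (hV y hy).2]; exact hy⟩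
  · exact fun x hx => (hU x hx.1).2
  · exact fun y hy => (hV y hy.1).2
  · exact hfc.isOpen_inter_preimage hUo hVo
  · exact hgc.isOpen_inter_preimage hVo hUo
  · exact fun x hx => (hU x hx.1).1.contMDiffWithinAt
  · exact fun y hy => (hV y hy.1).1.contMDiffWithinAt

variable {V₁ X V₂ Y : Type*}
    [NormedAddCommGroup V₁] [NormedSpace ℝ V₁] [TopologicalSpace X]
    [ChartedSpace V₁ X] [NormedAddCommGroup V₂] [NormedSpace ℝ V₂]
    [TopologicalSpace Y] [ChartedSpace V₂ Y]

theorem contMDiffAt_chart_symm [IsManifold 𝓘(ℝ, V₁) ∞ X] {a : X} {y : V₁}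
    (hy : y ∈ (chartAt V₁ a).target) :
    ContMDiffAt 𝓘(ℝ, V₁) 𝓘(ℝ, V₁) ∞ (chartAt V₁ a).symm y :=
  (contMDiffOn_chart_symm (I := 𝓘(ℝ, V₁)) (x := a)).contMDiffAt
    ((chartAt V₁ a).open_target.mem_nhds hy)

theorem contMDiffAt_chart [IsManifold 𝓘(ℝ, V₁) ∞ X] {a x : X}
    (hx : x ∈ (chartAt V₁ a).source) :
    ContMDiffAt 𝓘(ℝ, V₁) 𝓘(ℝ, V₁) ∞ (chartAt V₁ a) x :=
  (contMDiffOn_chart (I := 𝓘(ℝ, V₁)) (x := a)).contMDiffAt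
    ((chartAt V₁ a).open_source.mem_nhds hx)

theorem isInvertible_mfderiv_chart [IsManifold 𝓘(ℝ, V₁) ∞ X] {a x : X}
    (hx : x ∈ (chartAt V₁ a).source) :
    (mfderiv 𝓘(ℝ, V₁) 𝓘(ℝ, V₁) (chartAt V₁ a) x).IsInvertible := by
  have : IsManifold 𝓘(ℝ, V₁) 1 X := .of_le (n := ∞) (by exact_mod_cast le_top)
  have h := mdifferentiable_chart (I := 𝓘(ℝ, V₁)) a
  refine ContinuousLinearMap.IsInvertible.of_inverse
    (g := mfderiv 𝓘(ℝ, V₁) 𝓘(ℝ, V₁) (chartAt V₁ a).symm (chartAt V₁ a x)) ?_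
    (h.symm_comp_deriv hx)
  have := h.comp_symm_deriv ((chartAt V₁ a).map_source hx)
  rwa [(chartAt V₁ a).left_inv hx] at this

theorem isInvertible_mfderiv_chart_symm [IsManifold 𝓘(ℝ, V₁) ∞ X] {a : X} {y : V₁}
    (hy : y ∈ (chartAt V₁ a).target) :
    (mfderiv 𝓘(ℝ, V₁) 𝓘(ℝ, V₁) (chartAt V₁ a).symm y).IsInvertible := by
  have : IsManifold 𝓘(ℝ, V₁) 1 X := .of_le (n := ∞) (by exact_mod_cast le_top)
  have h := mdifferentiable_chart (I := 𝓘(ℝ, V₁)) a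
  refine ContinuousLinearMap.IsInvertible.of_inverse
    (g := mfderiv 𝓘(ℝ, V₁) 𝓘(ℝ, V₁) (chartAt V₁ a) ((chartAt V₁ a).symm y)) ?_
    (h.comp_symm_deriv hy)
  have := h.symm_comp_deriv ((chartAt V₁ a).map_target hy)
  rwa [(chartAt V₁ a).right_inv hy] at this

/-- **Inverse function theorem**: a smooth map between manifolds whose derivatives are invertible
is a local diffeomorphism. -/
theorem isLocalDiffeomorphAt_of_isInvertible_mfderiv [CompleteSpace V₁]
    [IsManifold 𝓘(ℝ, V₁) ∞ X] [IsManifold 𝓘(ℝ, V₂) ∞ Y] {f : X → Y} {a : X}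
    (hf : ∀ᶠ x in 𝓝 a, ContMDiffAt 𝓘(ℝ, V₁) 𝓘(ℝ, V₂) ∞ f x ∧
      (mfderiv 𝓘(ℝ, V₁) 𝓘(ℝ, V₂) f x).IsInvertible) :
    IsLocalDiffeomorphAt 𝓘(ℝ, V₁) 𝓘(ℝ, V₂) ∞ f a := by
  set χ := chartAt V₁ a with hχ
  set ψ := chartAt V₂ (f a) with hψ
  have haχ : a ∈ χ.source := mem_chart_source _ _
  have hfψ : f a ∈ ψ.source := mem_chart_source _ _
  set F : V₁ → V₂ := fun y => ψ (f (χ.symm y)) with hF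
  have hχs : Filter.Tendsto χ.symm (𝓝 (χ a)) (𝓝 a) := by
    have := χ.continuousAt_symm (χ.map_source haχ)
    rwa [ContinuousAt, χ.left_inv haχ] at this
  have hev : ∀ᶠ y in 𝓝 (χ a), ContDiffAt ℝ ∞ F y ∧ (fderiv ℝ F y).IsInvertible := by
    have h1 : ∀ᶠ x in 𝓝 a, f x ∈ ψ.source :=
      hf.self_of_nhds.1.continuousAt.eventually_mem (ψ.open_source.mem_nhds hfψ)
    filter_upwards [hχs.eventually (hf.and h1), χ.open_target.mem_nhds (χ.map_source haχ)]
      with y ⟨⟨hy1, hy2⟩, hy3⟩ hy4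
    have c1 := contMDiffAt_chart_symm (a := a) hy4
    have c2 := contMDiffAt_chart (a := f a) hy3
    have c3 : ContMDiffAt 𝓘(ℝ, V₁) 𝓘(ℝ, V₂) ∞ (f ∘ χ.symm) y := ContMDiffAt.comp y hy1 c1
    have c4 : ContMDiffAt 𝓘(ℝ, V₁) 𝓘(ℝ, V₂) ∞ (ψ ∘ (f ∘ χ.symm)) y := ContMDiffAt.comp y c2 c3
    refine ⟨c4.contDiffAt, ?_⟩
    rw [← mfderiv_eq_fderiv]
    change (mfderiv 𝓘(ℝ, V₁) 𝓘(ℝ, V₂) (ψ ∘ (f ∘ χ.symm)) y).IsInvertible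
    have hne : (∞ : WithTop ℕ∞) ≠ 0 := by simp
    rw [mfderiv_comp y (c2.mdifferentiableAt hne) (c3.mdifferentiableAt hne),
      mfderiv_comp y (hy1.mdifferentiableAt hne) (c1.mdifferentiableAt hne)]
    exact (isInvertible_mfderiv_chart hy3).comp (hy2.comp (isInvertible_mfderiv_chart_symm hy4))
  obtain ⟨hF1, L, hL⟩ := hev.self_of_nhds
  have hFd : HasFDerivAt F (L : V₁ →L[ℝ] V₂) (χ a) := by
    rw [hL]; exact (hF1.differentiableAt (by simp)).hasFDerivAt
  set Φ := hF1.toOpenPartialHomeomorph F hFd (by simp) with hΦ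
  have hΦF : ∀ y, Φ y = F y := fun y => rfl
  have hmem : χ a ∈ Φ.source := hF1.mem_toOpenPartialHomeomorph_source hFd (by simp)
  have hFa : F (χ a) = ψ (f a) := by simp only [hF]; rw [χ.left_inv haχ]
  have hmem' : ψ (f a) ∈ Φ.target := by
    have := Φ.map_source hmem; rwa [hΦF, hFa] at this
  have hΦs : Φ.symm (ψ (f a)) = χ a := by
    rw [← hFa, ← hΦF, Φ.left_inv hmem]
  have hΦt : Filter.Tendsto Φ.symm (𝓝 (ψ (f a))) (𝓝 (χ a)) := by
    have := Φ.continuousAt_symm hmem'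
    rwa [ContinuousAt, hΦs] at this
  have hψc : Filter.Tendsto ψ (𝓝 (f a)) (𝓝 (ψ (f a))) := ψ.continuousAt hfψ
  have hχc : Filter.Tendsto χ (𝓝 a) (𝓝 (χ a)) := χ.continuousAt haχ
  have hfc : Filter.Tendsto f (𝓝 a) (𝓝 (f a)) := hf.self_of_nhds.1.continuousAt
  refine isLocalDiffeomorphAt_of_inverse (g := χ.symm ∘ (Φ.symm ∘ ψ)) (hf.mono fun x h => h.1)
    ?_ ?_ ?_
  -- Smoothness of the inverse is needed on a neighbourhood, so the derivative is inverted anew at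
  -- each nearby point.
  · filter_upwards [ψ.open_source.mem_nhds hfψ, hψc.eventually (Φ.open_target.mem_nhds hmem'),
      (hΦt.comp hψc).eventually hev,
      (hΦt.comp hψc).eventually (χ.open_target.mem_nhds (χ.map_source haχ))] with y h1 h2 h3 h4
    obtain ⟨h3, L', hL'⟩ := h3
    have h5 : ContDiffAt ℝ ∞ Φ.symm (ψ y) := Φ.contDiffAt_symm (f₀' := L') h2
      (by rw [hL']; exact (h3.differentiableAt (by simp)).hasFDerivAt) h3
    exact ContMDiffAt.comp y (contMDiffAt_chart_symm h4)
      (ContMDiffAt.comp y h5.contMDiffAt (contMDiffAt_chart h1))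
  · filter_upwards [χ.open_source.mem_nhds haχ, hχc.eventually (Φ.open_source.mem_nhds hmem)]
      with x h1 h2
    have : ψ (f x) = Φ (χ x) := by rw [hΦF]; simp only [hF]; rw [χ.left_inv h1]
    simp only [Function.comp_apply]
    rw [this, Φ.left_inv h2, χ.left_inv h1]
  · have hlim : Filter.Tendsto (fun y => f (χ.symm (Φ.symm (ψ y)))) (𝓝 (f a)) (𝓝 (f a)) :=
      hfc.comp (hχs.comp (hΦt.comp hψc))
    filter_upwards [ψ.open_source.mem_nhds hfψ, hψc.eventually (Φ.open_target.mem_nhds hmem'),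
      hlim.eventually (ψ.open_source.mem_nhds hfψ)] with y h1 h2 h3
    refine ψ.injOn h3 h1 ?_
    have := Φ.right_inv h2
    rwa [hΦF] at this

end LocalDiffeomorph

/-! ### Smooth maps to `PGL` -/

section Calculus

attribute [local instance] Matrix.normedAddCommGroup Matrix.normedSpace

/-- The topology of the space of matrices, as the topology underlying the sup norm. -/
abbrev matTopology (n : ℕ) : TopologicalSpace (Mat n) :=
  (Matrix.normedAddCommGroup (m := Fin (n + 1)) (n := Fin (n + 1))
    (α := ℝ)).toMetricSpace.toPseudoMetricSpace.toUniformSpace.toTopologicalSpace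

attribute [local instance] matTopology

/-- Matrix multiplication as a continuous bilinear map. -/
def mulBilin (n : ℕ) : Mat n →L[ℝ] Mat n →L[ℝ] Mat n :=
  LinearMap.toContinuousLinearMap
    ((LinearMap.toContinuousLinearMap (𝕜 := ℝ) (E := Mat n) (F' := Mat n)).toLinearMap.comp
      (LinearMap.mul ℝ (Mat n)))

@[simp]
theorem mulBilin_apply {n : ℕ} (A B : Mat n) : mulBilin n A B = A * B := rfl

/-- The inclusion of `𝔤` into the matrices as a continuous linear map. -/
def toMatL (n : ℕ) : 𝔤 n →L[ℝ] Mat n := LinearMap.toContinuousLinearMap (toMat n)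

@[simp]
theorem toMatL_apply {n : ℕ} (A : 𝔤 n) : toMatL n A = toMat n A := rfl

/-- The trace free part as a continuous linear map. -/
def traceFreeL (n : ℕ) : Mat n →L[ℝ] 𝔤 n := LinearMap.toContinuousLinearMap (traceFree n)

theorem traceFreeL_apply {n : ℕ} (A : Mat n) : traceFreeL n A = traceFree n A := rfl

theorem traceFree_toMat {n : ℕ} (A : 𝔤 n) : traceFree n (toMat n A) = A :=
  toMat_injective n (by rw [traceFree_coe, trace_toMat, zero_smul, sub_zero])

theorem traceFree_one (n : ℕ) : traceFree n 1 = 0 := by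
  have hn : ((n : ℝ) + 1) ≠ 0 := by positivity
  refine toMat_injective n ?_
  rw [traceFree_coe, map_zero, Matrix.trace_one, smul_smul]
  simp [hn]

/-- The chart of `PGL` at the identity, on the level of matrices. -/
def normTraceFree (n : ℕ) (A : Mat n) : 𝔤 n := (((n : ℝ) + 1) / A.trace) • traceFreeL n A

theorem chartOne_cls {n : ℕ} (g : GLn n) : chartOne n (cls g) = normTraceFree n g := by
  change traceFree n _ = _
  rw [map_smul]
  rfl

/-- The trace as a continuous linear map. -/
def traceL (n : ℕ) : Mat n →L[ℝ] ℝ :=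
  LinearMap.toContinuousLinearMap (Matrix.traceLinearMap (Fin (n + 1)) ℝ ℝ)

theorem contDiffAt_normTraceFree {n : ℕ} {A : Mat n} (hA : A.trace ≠ 0) :
    ContDiffAt ℝ ∞ (normTraceFree n) A :=
  (contDiffAt_const.div (traceL n).contDiff.contDiffAt hA).smul (traceFreeL n).contDiff.contDiffAt

/-- In the product rule the scalar factor equals `1` at the identity, and its derivative is
multiplied by the trace free part of `1`, which is zero. -/
theorem hasFDerivAt_normTraceFree_one (n : ℕ) :
    HasFDerivAt (normTraceFree n) (traceFreeL n) 1 := by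
  have hn : ((n : ℝ) + 1) ≠ 0 := by positivity
  have ht : traceL n 1 = (n : ℝ) + 1 := by
    change (1 : Mat n).trace = _
    simp
  have hne : traceL n 1 ≠ 0 := by rw [ht]; exact hn
  have h1 : HasFDerivAt (fun A : Mat n => ((n : ℝ) + 1) / traceL n A)
      (fderiv ℝ (fun A : Mat n => ((n : ℝ) + 1) / traceL n A) 1) 1 :=
    (ContDiffAt.differentiableAt (n := 1)
      (contDiffAt_const.div (traceL n).contDiff.contDiffAt hne) one_ne_zero).hasFDerivAt
  have h2 := h1.smul (traceFreeL n).hasFDerivAt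
  refine h2.congr_fderiv ?_
  ext1 X
  simp [ht, hn, traceFreeL_apply, traceFree_one]

/-- The class in `PGL` of an invertible matrix. -/
def clsMat {n : ℕ} (A : Mat n) : G n := cls (toGL A)

theorem toGL_mul {n : ℕ} {A B : Mat n} (hA : A.det ≠ 0) (hB : B.det ≠ 0) :
    toGL (A * B) = toGL A * toGL B := by
  refine Units.ext ?_
  rw [toGL_coe (by rw [Matrix.det_mul]; exact mul_ne_zero hA hB), Units.val_mul, toGL_coe hA,
    toGL_coe hB]

theorem clsMat_mul {n : ℕ} {A B : Mat n} (hA : A.det ≠ 0) (hB : B.det ≠ 0) :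
    clsMat (A * B) = clsMat A * clsMat B := by
  rw [clsMat, toGL_mul hA hB]; rfl

theorem clsMat_one (n : ℕ) : clsMat (1 : Mat n) = 1 := by
  have : toGL (1 : Mat n) = 1 := Units.ext (by rw [toGL_coe (by simp)]; rfl)
  rw [clsMat, this]; rfl

theorem det_inv_ne_zero {n : ℕ} {A : Mat n} (hA : A.det ≠ 0) : A⁻¹.det ≠ 0 := by
  rw [Matrix.det_nonsing_inv, Ring.inverse_eq_inv']
  exact inv_ne_zero hA

theorem clsMat_inv {n : ℕ} {A : Mat n} (hA : A.det ≠ 0) : clsMat A⁻¹ = (clsMat A)⁻¹ := by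
  refine eq_inv_of_mul_eq_one_left ?_
  rw [← clsMat_mul (det_inv_ne_zero hA) hA, Matrix.nonsing_inv_mul _ (Ne.isUnit hA), clsMat_one]

theorem exists_clsMat {n : ℕ} (g : G n) : ∃ A : Mat n, A.det ≠ 0 ∧ clsMat A = g := by
  obtain ⟨k, rfl⟩ := Matrix.ProjGenLinGroup.mk_surjective g
  exact ⟨k, k.det_ne_zero, by rw [clsMat, toGL_val]⟩

theorem continuousAt_clsMat {n : ℕ} {A : Mat n} (hA : A.det ≠ 0) :
    ContinuousAt (clsMat (n := n)) A :=
  isOpenQuotientMap_cls.continuous.continuousAt.comp (continuousOn_toGL.continuousAt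
    ((isOpen_ne_fun continuous_id.matrix_det continuous_const).mem_nhds hA))

theorem eventually_det_ne_zero {n : ℕ} {A : Mat n} (hA : A.det ≠ 0) :
    ∀ᶠ B in 𝓝 A, B.det ≠ 0 :=
  (isOpen_ne_fun continuous_id.matrix_det continuous_const).mem_nhds hA

/-- The class map in the chart at `[A]`. -/
theorem chartAt_clsMat {n : ℕ} {A B : Mat n} (hA : A.det ≠ 0) (hB : B.det ≠ 0) :
    chartAt (𝔤 n) (clsMat A) (clsMat B) = normTraceFree n (A⁻¹ * B) := by
  change chartOne n ((clsMat A)⁻¹ * clsMat B) = _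
  rw [← clsMat_inv hA, ← clsMat_mul (det_inv_ne_zero hA) hB]
  rw [clsMat, chartOne_cls, toGL_coe]
  rw [Matrix.det_mul]
  exact mul_ne_zero (det_inv_ne_zero hA) hB

/-- Left translation by `[A]⁻¹` is built into the chart at `[A]`, so this derivative is the trace
free part of `A⁻¹ dA`, the Maurer–Cartan form in matrix terms. -/
theorem hasFDerivAt_chartAt_clsMat {n : ℕ} {A : Mat n} (hA : A.det ≠ 0) :
    HasFDerivAt (fun B => chartAt (𝔤 n) (clsMat A) (clsMat B))
      ((traceFreeL n).comp (mulBilin n A⁻¹)) A := by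
  have h1 : HasFDerivAt (fun B => normTraceFree n (A⁻¹ * B))
      ((traceFreeL n).comp (mulBilin n A⁻¹)) A := by
    refine HasFDerivAt.comp A (g := normTraceFree n) (f := fun B => A⁻¹ * B) ?_
      (mulBilin n A⁻¹).hasFDerivAt
    rw [Matrix.nonsing_inv_mul _ (Ne.isUnit hA)]
    exact hasFDerivAt_normTraceFree_one n
  refine h1.congr_of_eventuallyEq ?_
  filter_upwards [eventually_det_ne_zero hA] with B hB using chartAt_clsMat hA hB

theorem contMDiffAt_clsMat {n : ℕ} {A : Mat n} (hA : A.det ≠ 0) :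
    ContMDiffAt 𝓘(ℝ, Mat n) 𝓘(ℝ, 𝔤 n) ∞ (clsMat (n := n)) A := by
  rw [contMDiffAt_iff_target]
  refine ⟨continuousAt_clsMat hA, ?_⟩
  have hn : ((n : ℝ) + 1) ≠ 0 := by positivity
  have h1 : ContDiffAt ℝ ∞ (fun B => normTraceFree n (A⁻¹ * B)) A := by
    refine ContDiffAt.comp A (g := normTraceFree n) (f := fun B => A⁻¹ * B)
      (contDiffAt_normTraceFree ?_) (mulBilin n A⁻¹).contDiff.contDiffAt
    rw [Matrix.nonsing_inv_mul _ (Ne.isUnit hA), Matrix.trace_one]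
    simpa using hn
  refine (h1.congr_of_eventuallyEq ?_).contMDiffAt
  filter_upwards [eventually_det_ne_zero hA] with B hB using chartAt_clsMat hA hB

/-- The Maurer–Cartan form of the model is the derivative of the chart at the base point. -/
theorem model_form_eq {n : ℕ} (g : G n) :
    (model n).form g = mfderiv 𝓘(ℝ, 𝔤 n) 𝓘(ℝ, 𝔤 n) (chartAt (𝔤 n) g) g := rfl

theorem model_form_isInvertible {n : ℕ} (g : G n) : ((model n).form g).IsInvertible :=
  isInvertible_mfderiv_chart (mem_chart_source _ g)

/-- The Maurer–Cartan form pulls back to `A⁻¹ dA` on matrices. -/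
theorem model_form_comp_mfderiv_clsMat {n : ℕ} {A : Mat n} (hA : A.det ≠ 0) :
    ((model n).form (clsMat A)).comp (mfderiv 𝓘(ℝ, Mat n) 𝓘(ℝ, 𝔤 n) clsMat A) =
      (traceFreeL n).comp (mulBilin n A⁻¹) := by
  have hne : (∞ : WithTop ℕ∞) ≠ 0 := by simp
  rw [model_form_eq]
  have h := mfderiv_comp A (I := 𝓘(ℝ, Mat n)) (I' := 𝓘(ℝ, 𝔤 n)) (I'' := 𝓘(ℝ, 𝔤 n))
    ((contMDiffAt_chart (mem_chart_source (𝔤 n) (clsMat A))).mdifferentiableAt hne)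
    ((contMDiffAt_clsMat hA).mdifferentiableAt hne)
  refine h.symm.trans ?_
  rw [mfderiv_eq_fderiv]
  exact (hasFDerivAt_chartAt_clsMat hA).fderiv

end Calculus

/-! ### The connection form in charts -/

/-- Naturality of the exterior derivative of 1-forms under change of coordinates. -/
theorem fderiv_pullback_sub_swap {W X V : Type*} [NormedAddCommGroup W] [NormedSpace ℝ W]
    [NormedAddCommGroup X] [NormedSpace ℝ X] [NormedAddCommGroup V] [NormedSpace ℝ V]
    {f : X → X →L[ℝ] V} {g : W → W →L[ℝ] V} {τ : W → X} {y : W}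
    (hτ : ContDiffAt ℝ 2 τ y) (hf : DifferentiableAt ℝ f (τ y))
    (hg : ∀ᶠ z in 𝓝 y, g z = (f (τ z)).comp (fderiv ℝ τ z)) (u v : W) :
    fderiv ℝ g y u v - fderiv ℝ g y v u =
      fderiv ℝ f (τ y) (fderiv ℝ τ y u) (fderiv ℝ τ y v) -
        fderiv ℝ f (τ y) (fderiv ℝ τ y v) (fderiv ℝ τ y u) := by
  have h1 : DifferentiableAt ℝ (fderiv ℝ τ) y :=
    (hτ.fderiv_right (m := 1) (by rw [one_add_one_eq_two])).differentiableAt one_ne_zero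
  have h2 := (hf.hasFDerivAt.comp y (hτ.differentiableAt two_ne_zero).hasFDerivAt).clm_comp
    h1.hasFDerivAt
  have h3 : HasFDerivAt g _ y := h2.congr_of_eventuallyEq hg
  -- The only terms not of the form `dΩ` involve the second derivative of `τ`; by symmetry they
  -- cancel on antisymmetrising.
  have hs : fderiv ℝ (fderiv ℝ τ) y u v = fderiv ℝ (fderiv ℝ τ) y v u :=
    hτ.isSymmSndFDerivAt (by simp) u v
  rw [h3.fderiv]
  simp [hs]

namespace ConnectionData

variable {n : ℕ} {N E W : Type*} [TopologicalSpace N] [TopologicalSpace E]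
  [NormedAddCommGroup W] [NormedSpace ℝ W] [ChartedSpace W E] {D : ConnectionData n N E W}

theorem IsProjectiveConnection.finiteDimensional [ChartedSpace (EuclideanSpace ℝ (Fin n)) N]
    [IsManifold 𝓘(ℝ, W) ∞ E] (hD : D.IsProjectiveConnection) (e : E) : FiniteDimensional ℝ W := by
  obtain ⟨L, -⟩ := hD.form_isInvertible e
  exact LinearEquiv.finiteDimensional (V := 𝔤 n) (V₂ := W) L.symm.toLinearEquiv

/-- As `W` is finite dimensional, smoothness may be tested on each fixed vector `w`. There the
function is `Ω` on the tangent bundle composed with the tangent map of the inverse chart, along the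
constant field `w`. -/
theorem contDiffOn_formInChart [ChartedSpace (EuclideanSpace ℝ (Fin n)) N]
    [IsManifold 𝓘(ℝ, W) ∞ E] (hD : D.IsProjectiveConnection) (e : E) :
    ContDiffOn ℝ ∞ (D.formInChart e) (chartAt W e).target := by
  have := hD.finiteDimensional e
  have : IsManifold 𝓘(ℝ, W) 1 E := .of_le (n := ∞) (by exact_mod_cast le_top)
  have ho := (chartAt W e).open_target
  refine contDiffOn_clm_apply.2 fun w => ?_
  rw [← contMDiffOn_iff_contDiffOn]
  have h1 : ContMDiff 𝓘(ℝ, W) 𝓘(ℝ, W).tangent ∞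
      (fun y : W => (⟨y, w⟩ : TangentBundle 𝓘(ℝ, W) W)) :=
    contMDiff_vectorSpace_iff_contDiff (V := fun _ : W => w).2 contDiff_const
  have h2 := (contMDiffOn_chart_symm (I := 𝓘(ℝ, W)) (n := ∞) (x := e)).contMDiffOn_tangentMapWithin
    (m := ∞) (by simp) ho.uniqueMDiffOn
  have h3 := hD.contMDiff_form.comp_contMDiffOn
    (h2.comp (h1.contMDiffOn (s := (chartAt W e).target)) fun y hy => hy)
  refine h3.congr fun y hy => ?_
  simp only [formInChart, tangentMapWithin, Function.comp_apply]
  rw [mfderivWithin_of_mem_nhds (ho.mem_nhds hy)]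
  rfl

theorem formInChart_comp_mfderiv [IsManifold 𝓘(ℝ, W) ∞ E] {e x : E}
    (hx : x ∈ (chartAt W e).source) :
    (D.formInChart e (chartAt W e x)).comp (mfderiv 𝓘(ℝ, W) 𝓘(ℝ, W) (chartAt W e) x) =
      D.form x := by
  have : IsManifold 𝓘(ℝ, W) 1 E := .of_le (n := ∞) (by exact_mod_cast le_top)
  have h := (mdifferentiable_chart (I := 𝓘(ℝ, W)) e).symm_comp_deriv hx
  -- The form sits at `(chartAt W e).symm (chartAt W e x)`, which equals `x` only propositionally,
  -- so the base point is generalised.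
  have key : ∀ x', x' = x → (D.form x').comp ((mfderiv 𝓘(ℝ, W) 𝓘(ℝ, W) (chartAt W e).symm
      (chartAt W e x)).comp (mfderiv 𝓘(ℝ, W) 𝓘(ℝ, W) (chartAt W e) x) : W →L[ℝ] W) =
      (D.form x : W →L[ℝ] 𝔤 n) := by
    rintro x' rfl
    refine ContinuousLinearMap.ext fun v => ?_
    exact congrArg (D.form x') (DFunLike.congr_fun h v)
  exact key _ ((chartAt W e).left_inv hx)

/-- Coordinate expressions of `Ω` in two charts are pullbacks of each other under the transition
map: the input for `fderiv_pullback_sub_swap`. -/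
theorem eventually_formInChart_eq [IsManifold 𝓘(ℝ, W) ∞ E] (e x : E) {y : W}
    (hy : y ∈ (chartAt W e).target) (hyx : (chartAt W e).symm y ∈ (chartAt W x).source) :
    ∀ᶠ z in 𝓝 y, D.formInChart e z =
      (D.formInChart x (chartAt W x ((chartAt W e).symm z))).comp
        (fderiv ℝ (fun z => chartAt W x ((chartAt W e).symm z)) z) := by
  have hne : (∞ : WithTop ℕ∞) ≠ 0 := by simp
  filter_upwards [(chartAt W e).open_target.mem_nhds hy,
    ((chartAt W e).continuousAt_symm hy).eventually_mem ((chartAt W x).open_source.mem_nhds hyx)]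
    with z h1 h2
  rw [← mfderiv_eq_fderiv]
  have h3 := mfderiv_comp z (I := 𝓘(ℝ, W)) (I' := 𝓘(ℝ, W)) (I'' := 𝓘(ℝ, W))
    ((contMDiffAt_chart h2).mdifferentiableAt hne)
    ((contMDiffAt_chart_symm (a := e) h1).mdifferentiableAt hne)
  refine ContinuousLinearMap.ext fun v => ?_
  refine Eq.trans ?_ (congrArg (D.formInChart x (chartAt W x ((chartAt W e).symm z)))
    (DFunLike.congr_fun h3 v).symm)
  exact (DFunLike.congr_fun (formInChart_comp_mfderiv (D := D) h2)
    (mfderiv 𝓘(ℝ, W) 𝓘(ℝ, W) (chartAt W e).symm z v)).symm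

/-- The tangent space at `e` is identified with `W` by the preferred chart at `e`, whose derivative
there is therefore the identity. -/
theorem formInChart_self [IsManifold 𝓘(ℝ, W) ∞ E] (e : E) :
    D.formInChart e (chartAt W e e) = D.form e := by
  have h := formInChart_comp_mfderiv (D := D) (mem_chart_source W e)
  have h2 : mfderiv 𝓘(ℝ, W) 𝓘(ℝ, W) (chartAt W e) e = ContinuousLinearMap.id ℝ W := by
    have : IsManifold 𝓘(ℝ, W) 1 E := .of_le (n := ∞) (by exact_mod_cast le_top)
    refine ContinuousLinearMap.ext fun v => ?_
    have h3 := mfderiv_chartAt_eq_tangentCoordChange (I := 𝓘(ℝ, W)) (mem_chart_source W e)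
    refine (DFunLike.congr_fun h3 v).trans ?_
    exact tangentCoordChange_self (I := 𝓘(ℝ, W)) (E := W) (x := e) (z := e) (v := v)
      (mem_extChartAt_source e)
  rw [h2] at h
  exact h

/-- Vanishing of the curvature, in an arbitrary chart. -/
theorem IsFlat.formInChart [ChartedSpace (EuclideanSpace ℝ (Fin n)) N]
    [IsManifold 𝓘(ℝ, W) ∞ E] (hD : D.IsProjectiveConnection) (hflat : D.IsFlat) (e : E) {y : W}
    (hy : y ∈ (chartAt W e).target) (u v : W) :
    toMat n (fderiv ℝ (D.formInChart e) y u v - fderiv ℝ (D.formInChart e) y v u) +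
      (toMat n (D.formInChart e y u) * toMat n (D.formInChart e y v) -
        toMat n (D.formInChart e y v) * toMat n (D.formInChart e y u)) = 0 := by
  -- The curvature at a point is defined in the preferred chart of that same point. Hence `y` is
  -- first moved by `τ` to the chart at `x`, where the hypothesis applies.
  set x := (chartAt W e).symm y with hx
  have hxs : x ∈ (chartAt W x).source := mem_chart_source W x
  set τ : W → W := fun z => chartAt W x ((chartAt W e).symm z) with hτ
  have hev := eventually_formInChart_eq (D := D) e x hy hxs
  have hτc : ContDiffAt ℝ 2 τ y := by
    rw [← contMDiffAt_iff_contDiffAt]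
    exact (ContMDiffAt.comp y (contMDiffAt_chart hxs) (contMDiffAt_chart_symm hy)).of_le
      two_le_infty
  have hf : DifferentiableAt ℝ (D.formInChart x) (τ y) :=
    ((contDiffOn_formInChart hD x).contDiffAt ((chartAt W x).open_target.mem_nhds
      ((chartAt W x).map_source hxs))).differentiableAt (by simp)
  rw [fderiv_pullback_sub_swap hτc hf hev, hev.self_of_nhds]
  have h := hflat x (fderiv ℝ τ y u) (fderiv ℝ τ y v)
  unfold curvature dForm at h
  rw [← formInChart_self] at h
  exact h

end ConnectionData

/-! ### Local developing maps on the total space -/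

section LocalDeveloping

attribute [local instance] Matrix.normedAddCommGroup Matrix.normedSpace matTopology

/-- `X ↦ A X` for `X ∈ 𝔤`. -/
def mulToMat {n : ℕ} (A : Mat n) : 𝔤 n →L[ℝ] Mat n := (mulBilin n A).comp (toMatL n)

@[simp]
theorem mulToMat_apply {n : ℕ} (A : Mat n) (X : 𝔤 n) : mulToMat A X = A * toMat n X := rfl

/-- `X ↦ (A ↦ A X)` for `X ∈ 𝔤`. -/
def rightMul (n : ℕ) : 𝔤 n →L[ℝ] Mat n →L[ℝ] Mat n := (mulBilin n).flip.comp (toMatL n)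

@[simp]
theorem rightMul_apply {n : ℕ} (X : 𝔤 n) (A : Mat n) : rightMul n X A = A * toMat n X := rfl

variable {n : ℕ} {N E W : Type*} [TopologicalSpace N] [TopologicalSpace E]
  [NormedAddCommGroup W] [NormedSpace ℝ W] [ChartedSpace W E]

/-- The matrix valued function `m` lifts the `PGL`-valued function `F` at `e`, and satisfies
`dm = m Ω` there. -/
structure IsLiftAt (D : ConnectionData n N E W) (F : E → G n) (m : E → Mat n) (e : E) : Prop where
  det_ne : (m e).det ≠ 0
  eq : F e = clsMat (m e)
  contMDiffAt : ContMDiffAt 𝓘(ℝ, W) 𝓘(ℝ, Mat n) ∞ m e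
  hasMFDerivAt : HasMFDerivAt 𝓘(ℝ, W) 𝓘(ℝ, Mat n) m e ((mulToMat (m e)).comp (D.form e))

/-- `F` pulls back the Maurer–Cartan form to the connection form near `e`. -/
def IsDevAt (D : ConnectionData n N E W) (F : E → G n) (e : E) : Prop :=
  ∃ m : E → Mat n, ∀ᶠ x in 𝓝 e, IsLiftAt D F m x

variable {D : ConnectionData n N E W} {F F' : E → G n} {m : E → Mat n} {e : E}

theorem IsDevAt.eventually (h : IsDevAt D F e) : ∀ᶠ x in 𝓝 e, IsDevAt D F x := by
  obtain ⟨m, hm⟩ := h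
  exact hm.eventually_nhds.mono fun x hx => ⟨m, hx⟩

theorem IsDevAt.congr (h : IsDevAt D F e) (hF : ∀ᶠ x in 𝓝 e, F' x = F x) : IsDevAt D F' e := by
  obtain ⟨m, hm⟩ := h
  refine ⟨m, (hm.and hF).mono fun x hx => ⟨hx.1.1, hx.2.trans hx.1.2, hx.1.3, hx.1.4⟩⟩

/-- The equation `dm = m Ω` is preserved when `m` is multiplied on the left by a constant matrix. -/
theorem IsDevAt.const_mul (h : IsDevAt D F e) (g : G n) : IsDevAt D (fun x => g * F x) e := by
  obtain ⟨m, hm⟩ := h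
  obtain ⟨A, hA, rfl⟩ := exists_clsMat g
  refine ⟨fun x => A * m x, hm.mono fun x hx => ⟨?_, ?_, ?_, ?_⟩⟩
  · rw [Matrix.det_mul]; exact mul_ne_zero hA hx.det_ne
  · rw [clsMat_mul hA hx.det_ne, hx.eq]
  · exact ContMDiffAt.comp x (I' := 𝓘(ℝ, Mat n)) (mulBilin n A).contMDiff.contMDiffAt hx.contMDiffAt
  · have h1 : HasMFDerivAt 𝓘(ℝ, Mat n) 𝓘(ℝ, Mat n) (mulBilin n A) (m x) (mulBilin n A) :=
      (mulBilin n A).hasMFDerivAt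
    have h2 := HasMFDerivAt.comp x h1 hx.hasMFDerivAt
    refine HasMFDerivAt.congr_mfderiv (f' := _) h2 (ContinuousLinearMap.ext fun v => ?_)
    exact (mul_assoc A (m x) (toMat n (D.form x v))).symm

theorem IsLiftAt.contMDiffAt_dev {x : E} (hx : IsLiftAt D F m x)
    (hF : ∀ᶠ z in 𝓝 x, F z = clsMat (m z)) :
    ContMDiffAt 𝓘(ℝ, W) 𝓘(ℝ, 𝔤 n) ∞ F x :=
  (ContMDiffAt.comp x (contMDiffAt_clsMat hx.det_ne) hx.contMDiffAt).congr_of_eventuallyEq hF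

theorem IsDevAt.contMDiffAt (h : IsDevAt D F e) : ContMDiffAt 𝓘(ℝ, W) 𝓘(ℝ, 𝔤 n) ∞ F e := by
  obtain ⟨m, hm⟩ := h
  exact hm.self_of_nhds.contMDiffAt_dev (hm.mono fun x hx => hx.eq)

/-- Developing maps pull back the Maurer–Cartan form to the connection form. -/
theorem IsDevAt.model_form (h : IsDevAt D F e) (v : TangentSpace 𝓘(ℝ, W) e) :
    (model n).form (F e) (mfderiv 𝓘(ℝ, W) 𝓘(ℝ, 𝔤 n) F e v) = D.form e v := by
  obtain ⟨m, hm⟩ := h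
  have hF : F =ᶠ[𝓝 e] clsMat ∘ m := hm.mono fun x hx => hx.eq
  have he := hm.self_of_nhds
  have hne : (∞ : WithTop ℕ∞) ≠ 0 := by simp
  have h1 : HasMFDerivAt 𝓘(ℝ, W) 𝓘(ℝ, 𝔤 n) F e _ :=
    (HasMFDerivAt.comp e ((contMDiffAt_clsMat he.det_ne).mdifferentiableAt hne).hasMFDerivAt
      he.hasMFDerivAt).congr_of_eventuallyEq hF
  rw [h1.mfderiv]
  have key : ∀ g, g = clsMat (m e) → (model n).form g (mfderiv 𝓘(ℝ, Mat n) 𝓘(ℝ, 𝔤 n) clsMat (m e)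
      (m e * toMat n (D.form e v)) : 𝔤 n) = D.form e v := by
    rintro g rfl
    refine (DFunLike.congr_fun (model_form_comp_mfderiv_clsMat he.det_ne)
      (m e * toMat n (D.form e v))).trans ?_
    change traceFree n ((m e)⁻¹ * (m e * toMat n (D.form e v))) = _
    rw [← mul_assoc, Matrix.nonsing_inv_mul _ (Ne.isUnit he.det_ne), one_mul, traceFree_toMat]
  exact key _ he.eq

/-- With `hasMFDerivAt_comp_chart` as its counterpart in the other direction, this translates `dm =
m Ω` into an equation `dM = θ M` on `W`, where `θ` is right multiplication by the coordinate
expression of `Ω`. -/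
theorem hasFDerivAt_comp_chart_symm [IsManifold 𝓘(ℝ, W) ∞ E] {y : W}
    (hy : y ∈ (chartAt W e).target)
    (hm : HasMFDerivAt 𝓘(ℝ, W) 𝓘(ℝ, Mat n) m ((chartAt W e).symm y)
      ((mulToMat (m ((chartAt W e).symm y))).comp (D.form ((chartAt W e).symm y)))) :
    HasFDerivAt (fun y => m ((chartAt W e).symm y))
      (((rightMul n).comp (D.formInChart e y)).flip (m ((chartAt W e).symm y))) y := by
  have h1 := ((contMDiffAt_chart_symm (a := e) hy).mdifferentiableAt (by simp)).hasMFDerivAt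
  exact (HasMFDerivAt.comp y hm h1).hasFDerivAt

theorem hasMFDerivAt_comp_chart [IsManifold 𝓘(ℝ, W) ∞ E] {M : W → Mat n} {x : E}
    (hx : x ∈ (chartAt W e).source)
    (hM : HasFDerivAt M (((rightMul n).comp (D.formInChart e (chartAt W e x))).flip
      (M (chartAt W e x))) (chartAt W e x)) :
    HasMFDerivAt 𝓘(ℝ, W) 𝓘(ℝ, Mat n) (fun x => M (chartAt W e x)) x
      ((mulToMat (M (chartAt W e x))).comp (D.form x)) := by
  have h1 := ((contMDiffAt_chart hx).mdifferentiableAt (by simp)).hasMFDerivAt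
  have h2 := HasMFDerivAt.comp x hM.hasMFDerivAt h1
  convert h2 using 1
  rw [← ConnectionData.formInChart_comp_mfderiv hx]
  rfl

variable [ChartedSpace (EuclideanSpace ℝ (Fin n)) N] [IsManifold 𝓘(ℝ, W) ∞ E]

/-- Local existence of developing maps. -/
theorem exists_isDevAt (hD : D.IsProjectiveConnection) (hflat : D.IsFlat) (e : E) :
    ∃ F, IsDevAt D F e := by
  set χ := chartAt W e with hχ
  have he : e ∈ χ.source := mem_chart_source W e
  have hy : χ e ∈ χ.target := χ.map_source he
  have hsm := ConnectionData.contDiffOn_formInChart hD e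
  set θ : W → W →L[ℝ] Mat n →L[ℝ] Mat n := fun y => (rightMul n).comp (D.formInChart e y) with hθ
  have hθc : ContDiffOn ℝ ∞ θ χ.target := contDiffOn_const.clm_comp hsm
  have hfd : ∀ y ∈ χ.target, ∀ u v A,
      fderiv ℝ θ y u v A = A * toMat n (fderiv ℝ (D.formInChart e) y u v) := by
    intro y hy u v A
    have h1 : HasFDerivAt (D.formInChart e) (fderiv ℝ (D.formInChart e) y) y :=
      ((hsm.contDiffAt (χ.open_target.mem_nhds hy)).differentiableAt (by simp)).hasFDerivAt
    have h2 := ((ContinuousLinearMap.compL ℝ W (𝔤 n) (Mat n →L[ℝ] Mat n))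
      (rightMul n)).hasFDerivAt.comp y h1
    have h3 : HasFDerivAt θ _ y := h2
    rw [h3.fderiv]
    rfl
  -- Integrability of `dM = M Ω` is `A * (dΩ + Ω ∧ Ω)(u, v) = 0`, which is flatness. The initial
  -- value `1` makes `M` invertible near the center.
  obtain ⟨M, hM0, hM⟩ := exists_hasFDerivAt_linear (θ := θ) (y₀ := χ e)
    (hθc.contDiffAt (χ.open_target.mem_nhds hy)) (by
      filter_upwards [χ.open_target.mem_nhds hy] with y hy u v A
      have h := ConnectionData.IsFlat.formInChart hD hflat e hy u v
      rw [hfd y hy, hfd y hy]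
      change A * _ + A * toMat n (D.formInChart e y u) * toMat n (D.formInChart e y v) =
        A * _ + A * toMat n (D.formInChart e y v) * toMat n (D.formInChart e y u)
      rw [map_sub] at h
      rw [← sub_eq_zero, mul_assoc, mul_assoc, ← mul_zero A, ← h]
      noncomm_ring) (1 : Mat n)
  have hMs : ∀ᶠ y in 𝓝 (χ e), ContDiffAt ℝ ∞ M y := by
    obtain ⟨s, hs, hso, hes⟩ := eventually_nhds_iff.1 (hM.and (χ.open_target.mem_nhds hy))
    have := contDiffOn_of_hasFDerivAt_linear hso (hθc.mono fun y hy => (hs y hy).2)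
      fun y hy => (hs y hy).1
    filter_upwards [hso.mem_nhds hes] with y hy using this.contDiffAt (hso.mem_nhds hy)
  have hdet : ∀ᶠ y in 𝓝 (χ e), (M y).det ≠ 0 :=
    hM.self_of_nhds.continuousAt.eventually (eventually_det_ne_zero (by rw [hM0]; simp))
  refine ⟨fun x => clsMat (M (χ x)), fun x => M (χ x), ?_⟩
  filter_upwards [χ.open_source.mem_nhds he, (χ.continuousAt he).eventually hMs,
    (χ.continuousAt he).eventually hM, (χ.continuousAt he).eventually hdet] with x h1 h2 h3 h4
  exact ⟨h4, rfl, ContMDiffAt.comp x h2.contMDiffAt (contMDiffAt_chart h1),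
    hasMFDerivAt_comp_chart h1 h3⟩

/-- Local uniqueness of developing maps. -/
theorem IsDevAt.unique (hD : D.IsProjectiveConnection) (h : IsDevAt D F e) (h' : IsDevAt D F' e) :
    ∃ g : G n, ∀ᶠ x in 𝓝 e, F' x = g * F x := by
  obtain ⟨m, hm⟩ := h
  obtain ⟨m', hm'⟩ := h'
  have hd := hm.self_of_nhds.det_ne
  have hd' := hm'.self_of_nhds.det_ne
  -- With this constant, `C * m - m'` solves the same linear equation and vanishes at `e`, hence
  -- near `e`.
  set C : Mat n := m' e * (m e)⁻¹ with hC
  have hCd : C.det ≠ 0 := by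
    rw [hC, Matrix.det_mul]; exact mul_ne_zero hd' (det_inv_ne_zero hd)
  set χ := chartAt W e with hχ
  have he : e ∈ χ.source := mem_chart_source W e
  have hy : χ e ∈ χ.target := χ.map_source he
  have hθ : ContinuousAt (fun y => (rightMul n).comp (D.formInChart e y)) (χ e) :=
    (contDiffOn_const.clm_comp (ConnectionData.contDiffOn_formInChart hD e)).continuousOn.continuousAt
      (χ.open_target.mem_nhds hy)
  have hs : Filter.Tendsto χ.symm (𝓝 (χ e)) (𝓝 e) := by
    have := χ.continuousAt_symm hy
    rwa [ContinuousAt, χ.left_inv he] at this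
  have key := eventually_eq_zero_of_hasFDerivAt_linear
    (F := fun y => C * m (χ.symm y) - m' (χ.symm y)) hθ (by
      filter_upwards [χ.open_target.mem_nhds hy, hs.eventually hm, hs.eventually hm']
        with y h1 h2 h3
      have a1 := (mulBilin n C).hasFDerivAt.comp y (hasFDerivAt_comp_chart_symm h1 h2.hasMFDerivAt)
      have a2 := hasFDerivAt_comp_chart_symm h1 h3.hasMFDerivAt
      refine (a1.sub a2).congr_fderiv ?_
      refine ContinuousLinearMap.ext fun v => ?_
      change C * (m (χ.symm y) * toMat n (D.formInChart e y v)) -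
        m' (χ.symm y) * toMat n (D.formInChart e y v) =
        (C * m (χ.symm y) - m' (χ.symm y)) * toMat n (D.formInChart e y v)
      noncomm_ring) (by
      rw [χ.left_inv he, hC, mul_assoc, Matrix.nonsing_inv_mul _ (Ne.isUnit hd), mul_one, sub_self])
  refine ⟨clsMat C, ?_⟩
  filter_upwards [(χ.continuousAt he).eventually key, χ.open_source.mem_nhds he, hm, hm']
    with x h1 h2 h3 h4
  rw [χ.left_inv h2, sub_eq_zero] at h1
  rw [h3.eq, h4.eq, ← clsMat_mul hCd h3.det_ne, h1]

theorem contMDiff_act_right (hD : D.IsProjectiveConnection) (g : G₀ n) :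
    ContMDiff 𝓘(ℝ, W) 𝓘(ℝ, W) ∞ fun x => D.act x g :=
  hD.contMDiff_act.comp (contMDiff_id.prodMk contMDiff_const)

/-- Developing maps are transported by the action of the structure group. -/
theorem IsDevAt.act (hD : D.IsProjectiveConnection) {g : G₀ n} (h : IsDevAt D F (D.act e g)) :
    IsDevAt D (fun x => F (D.act x g) * (g : G n)⁻¹) e := by
  obtain ⟨m, hm⟩ := h
  obtain ⟨k, hk⟩ := Matrix.ProjGenLinGroup.mk_surjective (g : G n)⁻¹
  have hkd : (k : Mat n).det ≠ 0 := k.det_ne_zero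
  have hkc : clsMat (k : Mat n) = (g : G n)⁻¹ := by rw [clsMat, toGL_val]; exact hk
  have hact := contMDiff_act_right hD g
  refine ⟨fun x => m (D.act x g) * k, ?_⟩
  filter_upwards [hact.continuous.continuousAt.eventually hm] with x hx
  refine ⟨?_, ?_, ?_, ?_⟩
  · rw [Matrix.det_mul]; exact mul_ne_zero hx.det_ne hkd
  · rw [clsMat_mul hx.det_ne hkd, hx.eq, hkc]
  · exact ContMDiffAt.comp x (I' := 𝓘(ℝ, Mat n))
      ((mulBilin n).flip (k : Mat n)).contMDiff.contMDiffAt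
      (ContMDiffAt.comp x hx.contMDiffAt hact.contMDiffAt)
  · have h1 : HasMFDerivAt 𝓘(ℝ, Mat n) 𝓘(ℝ, Mat n) ((mulBilin n).flip (k : Mat n)) (m (D.act x g))
        ((mulBilin n).flip (k : Mat n)) := ((mulBilin n).flip (k : Mat n)).hasMFDerivAt
    have h0 := (hact.contMDiffAt (x := x)).mdifferentiableAt (by simp) |>.hasMFDerivAt
    have h2 := HasMFDerivAt.comp x h1 (HasMFDerivAt.comp x hx.hasMFDerivAt h0)
    refine HasMFDerivAt.congr_mfderiv (f' := _) h2 (ContinuousLinearMap.ext fun v => ?_)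
    -- Since `k` represents `g⁻¹`, equivariance replaces `Ω` by `k Ω k⁻¹`, and multiplication by `k`
    -- on the right turns `m k Ω k⁻¹` into `(m k) Ω`.
    change m (D.act x g) * toMat n (D.form (D.act x g)
        (mfderiv 𝓘(ℝ, W) 𝓘(ℝ, W) (fun x => D.act x g) x v)) * (k : Mat n) =
      m (D.act x g) * (k : Mat n) * toMat n (D.form x v)
    rw [hD.form_equivariant g x v, ← hk, toMat_Ad]
    simp only [mul_assoc]
    rw [Units.inv_mul, mul_one]

/-- The derivative of `F` intertwines `Ω` with the Maurer–Cartan form, and both are isomorphisms at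
each point. -/
theorem IsDevAt.isInvertible_mfderiv (hD : D.IsProjectiveConnection) (h : IsDevAt D F e) :
    (mfderiv 𝓘(ℝ, W) 𝓘(ℝ, 𝔤 n) F e).IsInvertible := by
  have h1 : ((model n).form (F e)).comp (mfderiv 𝓘(ℝ, W) 𝓘(ℝ, 𝔤 n) F e) = D.form e :=
    ContinuousLinearMap.ext fun v => h.model_form v
  obtain ⟨L, hL⟩ := model_form_isInvertible (F e)
  obtain ⟨L', hL'⟩ := hD.form_isInvertible e
  refine ⟨L'.trans L.symm, ?_⟩
  refine ContinuousLinearMap.ext fun v => L.injective ?_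
  have := DFunLike.congr_fun h1 v
  rw [← hL, ← hL'] at this
  simpa using this.symm

theorem IsDevAt.isLocalDiffeomorphAt (hD : D.IsProjectiveConnection) (h : IsDevAt D F e) :
    IsLocalDiffeomorphAt 𝓘(ℝ, W) 𝓘(ℝ, 𝔤 n) ∞ F e := by
  have := hD.finiteDimensional e
  have : CompleteSpace W := FiniteDimensional.complete ℝ W
  exact isLocalDiffeomorphAt_of_isInvertible_mfderiv
    (h.eventually.mono fun x hx => ⟨hx.contMDiffAt, hx.isInvertible_mfderiv hD⟩)

end LocalDeveloping

/-! ### The exponential map of the structure group -/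

/-- The exponential of matrices. -/
def matExp {n : ℕ} (A : Mat n) : Mat n := NormedSpace.exp A

theorem matExp_zero (n : ℕ) : matExp (0 : Mat n) = 1 := NormedSpace.exp_zero

theorem det_matExp_ne_zero {n : ℕ} (A : Mat n) : (matExp A).det ≠ 0 := det_exp_ne_zero A

theorem matExp_neg_mul {n : ℕ} (A : Mat n) : matExp (-A) * matExp A = 1 := by
  rw [matExp, matExp, Matrix.exp_neg, Matrix.nonsing_inv_mul _ (Ne.isUnit (det_exp_ne_zero A))]

section OperatorNorm

attribute [local instance] Matrix.linftyOpNormedRing Matrix.linftyOpNormedAlgebra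

theorem hasStrictFDerivAt_matExp_zero_aux (n : ℕ) :
    HasStrictFDerivAt (𝕜 := ℝ) (matExp (n := n)) (1 : Mat n →L[ℝ] Mat n) 0 := by
  have : CompleteSpace (Mat n) := FiniteDimensional.complete ℝ (Mat n)
  exact hasStrictFDerivAt_exp_zero (𝕂 := ℝ) (𝔸 := Mat n)

theorem hasDerivAt_matExp_smul_aux {n : ℕ} (A : Mat n) (t : ℝ) :
    HasDerivAt (fun t : ℝ => matExp (t • A)) (A * matExp (t • A)) t := by
  have : CompleteSpace (Mat n) := FiniteDimensional.complete ℝ (Mat n)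
  exact hasDerivAt_exp_smul_const' A t

theorem continuous_matExp (n : ℕ) : Continuous (matExp (n := n)) := by
  have : CompleteSpace (Mat n) := FiniteDimensional.complete ℝ (Mat n)
  let _ : NormedAlgebra ℚ (Mat n) := NormedAlgebra.restrictScalars ℚ ℝ (Mat n)
  exact NormedSpace.exp_continuous

end OperatorNorm

section Exp

attribute [local instance] Matrix.normedAddCommGroup Matrix.normedSpace matTopology

/-- The sup norm is not submultiplicative, so the calculus of the exponential is done in the
operator norm. Differentiability depends only on the topology, which the two norms share. -/
theorem hasStrictFDerivAt_matExp_zero (n : ℕ) :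
    HasStrictFDerivAt (matExp (n := n)) (ContinuousLinearMap.id ℝ (Mat n)) 0 :=
  hasStrictFDerivAt_matExp_zero_aux n

theorem hasDerivAt_matExp_smul {n : ℕ} (A : Mat n) (t : ℝ) :
    HasDerivAt (fun t : ℝ => matExp (t • A)) (A * matExp (t • A)) t :=
  hasDerivAt_matExp_smul_aux A t

theorem coe_expG₀ {n : ℕ} (A : 𝔤₀ n) :
    ((expG₀ A : G₀ n) : G n) = clsMat (matExp (toMat n A.1)) := rfl

theorem expG₀_zero (n : ℕ) : expG₀ (0 : 𝔤₀ n) = 1 := by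
  refine Subtype.ext ?_
  rw [coe_expG₀]
  simp [matExp_zero, clsMat_one]

theorem continuous_expG₀ (n : ℕ) : Continuous (expG₀ (n := n)) := by
  refine Continuous.subtype_mk (continuous_iff_continuousAt.2 fun A => ?_) _
  exact ContinuousAt.comp (g := clsMat) (continuousAt_clsMat (det_matExp_ne_zero _))
    ((continuous_matExp n).comp ((continuous_toMat n).comp continuous_subtype_val)).continuousAt

theorem chartG₀_expG₀ {n : ℕ} (A : 𝔤₀ n) (i : Fin (n + 1)) (j : Fin n) :
    chartG₀ n (expG₀ A) i j = matExp (toMat n A.1) i j.succ /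
      matExp (toMat n A.1) 0 0 := by
  change ((toGL (matExp (toMat n A.1)) : GLn n) : Mat n) i j.succ /
    ((toGL (matExp (toMat n A.1)) : GLn n) : Mat n) 0 0 = _
  rw [toGL_coe (det_matExp_ne_zero _)]

/-- An entry of a matrix, as a continuous linear map. -/
def entryL (n : ℕ) (i j : Fin (n + 1)) : Mat n →L[ℝ] ℝ :=
  LinearMap.toContinuousLinearMap (Matrix.entryLinearMap ℝ ℝ i j)

@[simp]
theorem entryL_apply {n : ℕ} (i j : Fin (n + 1)) (A : Mat n) : entryL n i j A = A i j := rfl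

/-- The derivative at the origin of the exponential map of `G₀` in the global chart. -/
def dexpG₀ (n : ℕ) : 𝔤₀ n →L[ℝ] (Fin (n + 1) → Fin n → ℝ) :=
  ContinuousLinearMap.pi fun i => ContinuousLinearMap.pi fun j =>
    (entryL n i j.succ - (1 : Mat n) i j.succ • entryL n 0 0).comp
      ((toMatL n).comp (𝔤₀ n).subtypeL)

/-- Complete the given columns by a zero first column and take the trace free part. The multiple of
`1` so removed cancels between the entry `(i, j)` and the entry `(0, 0)`. -/
theorem dexpG₀_surjective (n : ℕ) : Function.Surjective (dexpG₀ n) := by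
  intro b
  let B : Mat n := Matrix.of fun i => Fin.cons 0 (b i)
  refine ⟨⟨traceFree n B, fun i => ?_⟩, ?_⟩
  · rw [traceFree_coe]
    simp [B, Fin.succ_ne_zero]
  · funext i j
    change toMat n (traceFree n B) i j.succ - (1 : Mat n) i j.succ *
      toMat n (traceFree n B) 0 0 = b i j
    rw [traceFree_coe]
    simp [B]
    ring

/-- In the global chart the exponential is a quotient of entries of `e^A` by the upper left one; the
quotient rule at the identity gives `A i j - δ i j * A 0 0`. -/
theorem hasStrictFDerivAt_chartG₀_expG₀ (n : ℕ) :
    HasStrictFDerivAt (fun A : 𝔤₀ n => chartG₀ n (expG₀ A)) (dexpG₀ n) 0 := by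
  have h0 : HasStrictFDerivAt (fun A : 𝔤₀ n => matExp (toMat n A.1))
      ((toMatL n).comp (𝔤₀ n).subtypeL) 0 := by
    have h1 := ((toMatL n).comp (𝔤₀ n).subtypeL).hasStrictFDerivAt (x := 0)
    have h2 : HasStrictFDerivAt (matExp (n := n))
      (ContinuousLinearMap.id ℝ (Mat n)) (((toMatL n).comp (𝔤₀ n).subtypeL) 0) := by
      rw [map_zero]; exact hasStrictFDerivAt_matExp_zero n
    exact h2.comp 0 h1
  refine hasStrictFDerivAt_pi.2 fun i => hasStrictFDerivAt_pi.2 fun j => ?_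
  have e1 : matExp (toMat n ((0 : 𝔤₀ n) : 𝔤 n)) = (1 : Mat n) := by simp [matExp_zero]
  have h1 : HasStrictFDerivAt (fun A : 𝔤₀ n => matExp (toMat n A.1) i j.succ)
      ((entryL n i j.succ).comp ((toMatL n).comp (𝔤₀ n).subtypeL)) 0 :=
    (entryL n i j.succ).hasStrictFDerivAt.comp 0 h0
  have h2 : HasStrictFDerivAt (fun A : 𝔤₀ n => matExp (toMat n A.1) 0 0)
      ((entryL n 0 0).comp ((toMatL n).comp (𝔤₀ n).subtypeL)) 0 :=
    (entryL n 0 0).hasStrictFDerivAt.comp 0 h0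
  have hne : matExp (toMat n ((0 : 𝔤₀ n) : 𝔤 n)) 0 0 ≠ 0 := by rw [e1]; simp
  have h3 := h1.mul (HasStrictDerivAt.comp_hasStrictFDerivAt
    (f := fun A : 𝔤₀ n => matExp (toMat n A.1) 0 0) 0 (hasStrictDerivAt_inv hne) h2)
  simp only [chartG₀_expG₀, div_eq_mul_inv]
  refine h3.congr_fderiv ?_
  refine ContinuousLinearMap.ext fun A => ?_
  rw [e1]
  change _ = toMat n A.1 i j.succ - (1 : Mat n) i j.succ * toMat n A.1 0 0
  simp [matExp_zero]
  ring

/-- The exponential map of `G₀` is open at the origin. -/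
theorem image_expG₀_mem_nhds {n : ℕ} {B : Set (𝔤₀ n)} (hB : B ∈ 𝓝 0) :
    expG₀ '' B ∈ 𝓝 (1 : G₀ n) := by
  have h := (hasStrictFDerivAt_chartG₀_expG₀ n).map_nhds_eq_of_surj
    (LinearMap.range_eq_top.2 (dexpG₀_surjective n))
  have h1 : (fun A : 𝔤₀ n => chartG₀ n (expG₀ A)) '' B ∈ 𝓝 (chartG₀ n (1 : G₀ n)) := by
    rw [← expG₀_zero, ← h]
    exact Filter.image_mem_map hB
  have h2 : Filter.Tendsto (chartG₀ n) (𝓝 1) (𝓝 (chartG₀ n 1)) :=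
    (chartG₀ n).continuousAt (mem_univ _)
  filter_upwards [h2 h1] with g hg
  obtain ⟨A, hA, hAg⟩ := hg
  exact ⟨A, hA, (chartG₀ n).injOn (mem_univ _) (mem_univ _) hAg⟩

end Exp

/-! ### Equivariant local developing maps -/

section Equivariant

attribute [local instance] Matrix.normedAddCommGroup Matrix.normedSpace matTopology

variable {n : ℕ} {N E W : Type*} [TopologicalSpace N] [TopologicalSpace E]
  [NormedAddCommGroup W] [NormedSpace ℝ W] [ChartedSpace W E]
  [ChartedSpace (EuclideanSpace ℝ (Fin n)) N] [IsManifold 𝓘(ℝ, W) ∞ E]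
  {D : ConnectionData n N E W} {F F' : E → G n} {m : E → Mat n} {e : E}

/-- Along the flow of `A⃗`, a developing map is multiplied by the exponential of `A`. -/
theorem dev_act_expG₀ (hD : D.IsProjectiveConnection) (A : 𝔤₀ n)
    (hm : ∀ t ∈ Icc (0 : ℝ) 1, IsLiftAt D F m (D.act e (expG₀ (t • A)))) :
    F (D.act e (expG₀ A)) = F e * (expG₀ A : G n) := by
  set γ : ℝ → E := fun t => D.act e (expG₀ (t • A)) with hγ
  set X : Mat n := toMat n A.1 with hX
  -- The velocity of the curve is `A⃗` and `Ω (A⃗) = A`, so `dm = m Ω` becomes `m' = m X`.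
  have hd : ∀ t ∈ Icc (0 : ℝ) 1, HasDerivAt (fun t => m (γ t)) (m (γ t) * X) t := by
    intro t ht
    have h1 := HasMFDerivAt.comp t (hm t ht).hasMFDerivAt (hD.flow_eq A e t)
    rw [hasDerivAt_iff_hasFDerivAt]
    refine HasFDerivAt.congr_fderiv h1.hasFDerivAt (ContinuousLinearMap.ext_ring ?_)
    refine Eq.trans ?_ (one_smul ℝ (m (γ t) * X)).symm
    change m (γ t) * toMat n (D.form (γ t) ((1 : ℝ) • (D.form (γ t)).inverse A.1)) = _
    rw [one_smul, (hD.form_isInvertible (γ t)).self_apply_inverse]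
  have hx : ∀ t : ℝ, HasDerivAt (fun t : ℝ => matExp (t • (-X)))
      (-X * matExp (t • (-X))) t := hasDerivAt_matExp_smul (-X)
  -- Hence `m (γ t) * e^{-tX}` is constant.
  have hc : ∀ t ∈ Icc (0 : ℝ) 1,
      HasDerivAt (fun t => m (γ t) * matExp (t • (-X))) 0 t := by
    intro t ht
    have h1 := (((mulBilin n).hasFDerivAt.comp_hasDerivAt t (hd t ht))).clm_apply (hx t)
    refine h1.congr_deriv ?_
    simp [mul_assoc]
  have hconst := constant_of_has_deriv_right_zero
    (f := fun t => m (γ t) * matExp (t • (-X))) (a := 0) (b := 1)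
    (fun t ht => (hc t ht).continuousAt.continuousWithinAt)
    (fun t ht => (hc t (Ico_subset_Icc_self ht)).hasDerivWithinAt) 1 (by simp)
  have hγ0 : γ 0 = e := by simp [hγ, expG₀_zero, hD.act_one]
  have hγ1 : γ 1 = D.act e (expG₀ A) := by simp [hγ]
  simp only [one_smul, zero_smul, matExp_zero, mul_one, hγ0, hγ1] at hconst
  have hexp := matExp_neg_mul X
  have hme : m (D.act e (expG₀ A)) = m e * matExp X := by
    rw [← hconst, mul_assoc, hexp, mul_one]
  have l0 := hm 0 (by simp)
  have l1 := hm 1 (by simp)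
  rw [show D.act e (expG₀ ((0 : ℝ) • A)) = e from hγ0] at l0
  rw [one_smul] at l1
  rw [l1.eq, l0.eq, hme, clsMat_mul l0.det_ne (det_matExp_ne_zero X)]
  rfl

/-- The structure group acts transitively on the fibers. -/
theorem exists_act_eq (hD : D.IsProjectiveConnection) {e e' : E} (h : D.proj e = D.proj e') :
    ∃ g, D.act e g = e' := by
  obtain ⟨U, φ, hU, hx, hs, ht, hp, ha, -, -⟩ := hD.locally_trivial (D.proj e)
  have key : ∀ e', D.proj e' = D.proj e → ∃ k, φ (D.proj e, k) = e' := by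
    intro e' he'
    have hmem : e' ∈ φ.target := by rw [ht, mem_preimage, he']; exact hx
    have h2 : φ.symm e' ∈ U ×ˢ univ := hs ▸ φ.map_target hmem
    have h3 := hp _ h2.1 (φ.symm e').2
    rw [Prod.mk.eta, φ.right_inv hmem, he'] at h3
    exact ⟨(φ.symm e').2, by rw [h3, Prod.mk.eta, φ.right_inv hmem]⟩
  obtain ⟨k, hk⟩ := key e rfl
  obtain ⟨k', hk'⟩ := key e' h.symm
  exact ⟨k⁻¹ * k', by rw [← hk, ← ha _ hx, mul_inv_cancel_left, hk']⟩

theorem proj_surjective (hD : D.IsProjectiveConnection) : Function.Surjective D.proj := by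
  intro x
  obtain ⟨U, φ, hU, hx, hs, ht, hp, -⟩ := hD.locally_trivial x
  exact ⟨φ (x, 1), hp x hx 1⟩

/-- Through each point there is a smooth local section. -/
theorem exists_local_section (hD : D.IsProjectiveConnection) (e : E) :
    ∃ s : N → E, s (D.proj e) = e ∧ ∀ᶠ x in 𝓝 (D.proj e), D.proj (s x) = x ∧
      ContMDiffAt 𝓘(ℝ, EuclideanSpace ℝ (Fin n)) 𝓘(ℝ, W) ∞ s x := by
  obtain ⟨U, φ, hU, hx, hs, ht, hp, ha, hsm, -⟩ := hD.locally_trivial (D.proj e)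
  have hmem : e ∈ φ.target := by rw [ht]; exact hx
  refine ⟨fun x => φ (x, (φ.symm e).2), ?_, ?_⟩
  · have h2 : φ.symm e ∈ U ×ˢ univ := hs ▸ φ.map_target hmem
    have h3 := hp _ h2.1 (φ.symm e).2
    rw [Prod.mk.eta, φ.right_inv hmem] at h3
    simp only [h3, Prod.mk.eta, φ.right_inv hmem]
  · filter_upwards [hU.mem_nhds hx] with x hx
    have hxs : (x, (φ.symm e).2) ∈ φ.source := by rw [hs]; exact ⟨hx, mem_univ _⟩
    exact ⟨hp x hx _, ContMDiffAt.comp x (hsm.contMDiffAt (φ.open_source.mem_nhds hxs))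
      (contMDiffAt_id.prodMk contMDiffAt_const)⟩

/-- `F` is a developing map on the part of the bundle over `U`. -/
structure IsDevOn (D : ConnectionData n N E W) (F : E → G n) (U : Set N) : Prop where
  isDevAt : ∀ e, D.proj e ∈ U → IsDevAt D F e
  act : ∀ e, D.proj e ∈ U → ∀ g, F (D.act e g) = F e * (g : G n)

/-- Existence of equivariant developing maps, locally on the base. -/
theorem exists_isDevOn (hD : D.IsProjectiveConnection) (hflat : D.IsFlat) (x : N) :
    ∃ (U : Set N) (F : E → G n), IsOpen U ∧ x ∈ U ∧ IsDevOn D F U := by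
  obtain ⟨U, φ, hU, hx, hs, ht, hp, ha, hsm, -⟩ := hD.locally_trivial x
  have hsrc : ∀ u ∈ U, ∀ g, (u, g) ∈ φ.source := fun u hu g => by rw [hs]; exact ⟨hu, mem_univ _⟩
  have hsymm : ∀ u ∈ U, ∀ g, φ.symm (φ (u, g)) = (u, g) := fun u hu g => φ.left_inv (hsrc u hu g)
  have hrep : ∀ e, D.proj e ∈ U → φ (D.proj e, (φ.symm e).2) = e := by
    intro e he
    have hmem : e ∈ φ.target := by rw [ht]; exact he
    have h2 : φ.symm e ∈ U ×ˢ univ := hs ▸ φ.map_target hmem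
    have h3 := hp _ h2.1 (φ.symm e).2
    rw [Prod.mk.eta, φ.right_inv hmem] at h3
    rw [h3, Prod.mk.eta, φ.right_inv hmem]
  obtain ⟨f, m, hm⟩ := exists_isDevAt hD hflat (φ (x, 1))
  have hφc : ContinuousAt (fun y : N × 𝔤₀ n => φ (y.1, expG₀ y.2)) (x, 0) := by
    refine ContinuousAt.comp (g := φ) (φ.continuousAt (hsrc x hx _)) ?_
    exact (continuous_fst.prodMk ((continuous_expG₀ n).comp continuous_snd)).continuousAt
  have hev : ∀ᶠ y in 𝓝 x ×ˢ 𝓝 (0 : 𝔤₀ n), IsLiftAt D f m (φ (y.1, expG₀ y.2)) := by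
    rw [← nhds_prod_eq]
    refine hφc.eventually ?_
    simp only [expG₀_zero]
    exact hm
  obtain ⟨p, hpx, q, hq, hpq⟩ := Filter.eventually_prod_iff.1 hev
  obtain ⟨r, hr, hball⟩ := Metric.eventually_nhds_iff_ball.1 hq
  obtain ⟨U₁, hU₁, hU₁o, hxU₁⟩ := eventually_nhds_iff.1 hpx
  -- The ball is convex, so the flow line from `(u, 1)` to `(u, exp A)` stays where `m` lifts `f`.
  have hflow : ∀ u ∈ U ∩ U₁, ∀ A ∈ Metric.ball (0 : 𝔤₀ n) r,
      f (φ (u, expG₀ A)) = f (φ (u, 1)) * (expG₀ A : G n) := by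
    intro u hu A hA
    have hact : ∀ g, D.act (φ (u, 1)) g = φ (u, g) := fun g => by rw [← ha u hu.1, one_mul]
    rw [← hact]
    refine dev_act_expG₀ (m := m) hD A fun t ht => ?_
    rw [hact]
    refine hpq (hU₁ u hu.2) (hball _ ?_)
    exact (convex_ball (0 : 𝔤₀ n) r).smul_mem_of_zero_mem (Metric.mem_ball_self hr) hA ht
  -- Restrict `f` to the section `u ↦ φ (u, 1)` and extend it by equivariance. This reaches the
  -- whole of each fiber even if `G₀` is disconnected, where flows alone would not suffice.
  refine ⟨U ∩ U₁, fun e => f (φ (D.proj e, 1)) * ((φ.symm e).2 : G n), hU.inter hU₁o, ⟨hx, hxU₁⟩,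
    fun e he => ?_, fun e he g => ?_⟩
  · set k := (φ.symm e).2 with hk
    have hek : D.act e k⁻¹ = φ (D.proj e, 1) := by
      conv_lhs => rw [← hrep e he.1]
      rw [← ha _ he.1, ← hk, mul_inv_cancel]
    have hdev : IsDevAt D f (D.act e k⁻¹) := by
      rw [hek]
      refine ⟨m, ?_⟩
      have hmem : φ (D.proj e, 1) ∈ φ.target := φ.map_source (hsrc _ he.1 _)
      have hc : Filter.Tendsto φ.symm (𝓝 (φ (D.proj e, 1))) (𝓝 (D.proj e, 1)) := by
        have := φ.continuousAt_symm hmem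
        rwa [ContinuousAt, hsymm _ he.1] at this
      have h1 : ∀ᶠ y in 𝓝 (D.proj e, (1 : G₀ n)), y.1 ∈ U ∩ U₁ ∧
          y.2 ∈ expG₀ '' Metric.ball (0 : 𝔤₀ n) r := by
        rw [nhds_prod_eq]
        exact Filter.prod_mem_prod ((hU.inter hU₁o).mem_nhds he)
          (image_expG₀_mem_nhds (Metric.ball_mem_nhds (0 : 𝔤₀ n) hr))
      filter_upwards [φ.open_target.mem_nhds hmem, hc.eventually h1] with z hz ⟨hz1, A, hA, hAz⟩
      have := hpq (hU₁ _ hz1.2) (hball A hA)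
      rwa [hAz, Prod.mk.eta, φ.right_inv hz] at this
    -- Near `e` the extension agrees with `f` transported by `k⁻¹`: there `r_{k⁻¹} z` is `φ (π z,
    -- exp A)` with `A` small, and `hflow` compares its value with that at `φ (π z, 1)`.
    refine (hdev.act hD).congr ?_
    have hmem : e ∈ φ.target := by rw [ht]; exact he.1
    have hkc : Filter.Tendsto (fun z => (φ.symm z).2 * k⁻¹) (𝓝 e) (𝓝 1) := by
      have h1 : ContinuousAt (fun z => (φ.symm z).2 * k⁻¹) e :=
        ((φ.continuousAt_symm hmem).snd).mul continuousAt_const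
      have h2 : (φ.symm e).2 * k⁻¹ = 1 := by rw [← hk, mul_inv_cancel]
      rwa [ContinuousAt, h2] at h1
    filter_upwards [D.proj.continuous.continuousAt.eventually_mem ((hU.inter hU₁o).mem_nhds he),
      hkc (image_expG₀_mem_nhds (Metric.ball_mem_nhds (0 : 𝔤₀ n) hr))] with z hz hz'
    obtain ⟨A, hA, hAz⟩ := hz'
    have h1 : D.act z k⁻¹ = φ (D.proj z, expG₀ A) := by
      conv_lhs => rw [← hrep z hz.1]
      rw [← ha _ hz.1, hAz]
    rw [h1, hflow _ hz A hA, hAz]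
    simp [mul_assoc]
  · have h1 : D.act e g = φ (D.proj e, (φ.symm e).2 * g) := by
      rw [ha _ he.1, hrep e he.1]
    have h2 : (φ.symm (D.act e g)).2 = (φ.symm e).2 * g := by
      rw [h1, hsymm _ he.1]
    rw [h2, D.proj_act, mul_assoc, Subgroup.coe_mul]

end Equivariant

/-! ### The global developing map -/

section Global

variable {n : ℕ} {N E W : Type*} [TopologicalSpace N] [TopologicalSpace E]
  [NormedAddCommGroup W] [NormedSpace ℝ W] [ChartedSpace W E]
  [ChartedSpace (EuclideanSpace ℝ (Fin n)) N] [IsManifold 𝓘(ℝ, W) ∞ E]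
  {D : ConnectionData n N E W} {F F' : E → G n} {U U' : Set N} {e e' : E}

/-- Moving along a fiber multiplies both maps on the right by the same `g`, which cancels in the
quotient. The comparison factor is thus a function on the base. -/
theorem IsDevOn.mul_inv_eq (hD : D.IsProjectiveConnection) (h : IsDevOn D F U)
    (h' : IsDevOn D F' U') (he : D.proj e ∈ U) (he' : D.proj e ∈ U') (hee : D.proj e' = D.proj e) :
    F e' * (F' e')⁻¹ = F e * (F' e)⁻¹ := by
  obtain ⟨g, rfl⟩ := exists_act_eq hD hee.symm
  rw [h.act e he, h'.act e he']
  group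

/-- Uniqueness gives a constant factor near one point of the fiber. A local section brings this to a
neighbourhood in the base, and `IsDevOn.mul_inv_eq` spreads it over whole fibers. -/
theorem IsDevOn.eventually_eq_mul (hD : D.IsProjectiveConnection) (hU : IsOpen U)
    (hU' : IsOpen U') (h : IsDevOn D F U) (h' : IsDevOn D F' U') {x : N} (hx : x ∈ U)
    (hx' : x ∈ U') : ∃ g : G n, ∀ᶠ y in 𝓝 x, ∀ e, D.proj e = y → F e = g * F' e := by
  obtain ⟨e, rfl⟩ := proj_surjective hD x
  obtain ⟨g, hg⟩ := (h'.isDevAt e hx').unique hD (h.isDevAt e hx)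
  obtain ⟨s, hs, hs'⟩ := exists_local_section hD e
  have hsc : Filter.Tendsto s (𝓝 (D.proj e)) (𝓝 e) := by
    have := hs'.self_of_nhds.2.continuousAt
    rwa [ContinuousAt, hs] at this
  refine ⟨g, ?_⟩
  filter_upwards [hsc.eventually hg, hs', hU.mem_nhds hx, hU'.mem_nhds hx'] with y h1 h2 h3 h4 e' he'
  have h5 := h.mul_inv_eq hD h' (e := s y) (e' := e') (by rw [h2.1]; exact h3)
    (by rw [h2.1]; exact h4) (by rw [h2.1, he'])
  rw [h1, mul_inv_cancel_right] at h5
  exact mul_inv_eq_iff_eq_mul.1 h5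

/-- The group `PGL` with the discrete topology. -/
def DiscreteG (n : ℕ) : Type := G n

instance (n : ℕ) : TopologicalSpace (DiscreteG n) := ⊥

instance (n : ℕ) : DiscreteTopology (DiscreteG n) := ⟨rfl⟩

/-- The underlying element of `PGL`. -/
def DiscreteG.toG {n : ℕ} (g : DiscreteG n) : G n := g

/-- An element of `PGL`, seen as an element of the discrete group. -/
def DiscreteG.ofG {n : ℕ} (g : G n) : DiscreteG n := g

/-- The covering space of the base formed by the germs of developing maps: in terms of the local
developing maps `F i`, the germ of `g F i` has the coordinate `g`. -/
def devCore (hD : D.IsProjectiveConnection) (U : N → Set N) (F : N → E → G n)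
    (hU : ∀ x, IsOpen (U x)) (hx : ∀ x, x ∈ U x) (hF : ∀ x, IsDevOn D (F x) (U x)) :
    FiberBundleCore N N (DiscreteG n) where
  baseSet := U
  isOpen_baseSet := hU
  indexAt := id
  mem_baseSet_at := hx
  -- Rewriting `v F i` as `w F j` gives `w = v F i (F j)⁻¹`. The value may be taken at any point of
  -- the fiber, here at the one chosen by `surjInv`.
  coordChange i j x v := .ofG (v.toG * (F i (Function.surjInv (proj_surjective hD) x) *
    (F j (Function.surjInv (proj_surjective hD) x))⁻¹))
  coordChange_self i x _ v := by rw [mul_inv_cancel, mul_one]; rfl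
  continuousOn_coordChange i j := by
    intro ⟨x, v⟩ hxv
    obtain ⟨g, hg⟩ := (hF i).eventually_eq_mul hD (hU i) (hU j) (hF j) hxv.1.1 hxv.1.2
    refine ContinuousAt.continuousWithinAt (continuousAt_const (y := DiscreteG.ofG (v.toG * g)) |>.congr ?_)
    have h1 : ∀ᶠ y : N × DiscreteG n in 𝓝 (x, v), y.2 = v :=
      continuous_snd.continuousAt.eventually_mem
        ((isOpen_discrete {v}).mem_nhds (mem_singleton v) : {v} ∈ 𝓝 (x, v).2)
    filter_upwards [continuous_fst.continuousAt.eventually hg, h1] with y h2 h3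
    rw [h3, h2 _ (Function.surjInv_eq (proj_surjective hD) y.1), mul_inv_cancel_right]
  coordChange_comp i j k x _ v := by
    change (v.toG * _) * _ = v.toG * _
    group

/-- For `x` near `x₁`, the map `Φ x` on the fiber over `p x` is the restriction of a developing map
near the fiber over `p x₁`. -/
def IsGlobalDev (D : ConnectionData n N E W) {M' : Type*} [TopologicalSpace M'] (p : M' → N)
    (Φ : M' → E → G n) : Prop :=
  ∀ x₁, ∃ (U : Set N) (F : E → G n), IsOpen U ∧ p x₁ ∈ U ∧ IsDevOn D F U ∧
    ∀ᶠ x in 𝓝 x₁, p x ∈ U ∧ ∀ e, D.proj e = p x → Φ x e = F e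

/-- The developing map of a flat connection, on the pullback to the universal cover. -/
theorem exists_isGlobalDev (hD : D.IsProjectiveConnection) (hflat : D.IsFlat) {M' : Type*}
    [TopologicalSpace M'] [SimplyConnectedSpace M'] [LocallyPathConnectedSpace M'] {p : M' → N}
    (hp : Continuous p) (x₀ : M') :
    ∃ Φ : M' → E → G n, IsGlobalDev D p Φ := by
  choose U F hU hxU hF using exists_isDevOn hD hflat
  set Z := devCore hD U F hU hxU hF with hZ
  -- A fiber bundle with discrete fiber is a covering, so `p` lifts from the simply connected space,
  -- here starting at the germ of the chosen map at `p x₀`.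
  have hcov : IsCoveringMap Z.proj := FiberBundle.isCoveringMap (F := DiscreteG n) (E := Z.Fiber)
  obtain ⟨L, ⟨-, hL⟩, -⟩ := hcov.existsUnique_continuousMap_lifts ⟨p, hp⟩ x₀
    (⟨p x₀, (1 : G n)⟩ : Z.TotalSpace) rfl
  have hLp : ∀ x, (L x).1 = p x := fun x => congrFun hL x
  -- The germ `L x` evaluated on the fiber over `p x`; its coordinate refers to the developing map
  -- indexed by the point `p x` itself.
  refine ⟨fun x e => DiscreteG.toG (L x).2 * F (L x).1 e, fun x₁ => ?_⟩
  set i := p x₁ with hi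
  have hpi : ∀ᶠ x in 𝓝 x₁, p x ∈ U i := hp.continuousAt.eventually_mem ((hU i).mem_nhds (hxU i))
  have hc : ContinuousAt (fun x => (Z.localTriv i (L x)).2) x₁ := by
    refine ContinuousAt.snd ?_
    refine ContinuousAt.comp (g := Z.localTriv i) ?_ L.continuous.continuousAt
    refine (Z.localTriv i).continuousOn_toFun.continuousAt
      ((Z.localTriv i).open_source.mem_nhds ?_)
    rw [FiberBundleCore.mem_localTriv_source, hLp]
    exact hxU i
  -- In one fixed trivialisation the lift has a locally constant coordinate `c`, so near `x₁` all `Φ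
  -- x` are restrictions of the single map `c * F i`.
  have hconst : ∀ᶠ x in 𝓝 x₁, (Z.localTriv i (L x)).2 = (Z.localTriv i (L x₁)).2 :=
    hc.eventually_mem (isOpen_discrete {(Z.localTriv i (L x₁)).2} |>.mem_nhds rfl)
  set c : G n := DiscreteG.toG (Z.localTriv i (L x₁)).2 with hc
  refine ⟨U i, fun e => c * F i e, hU i, hxU i, ⟨fun e he => ((hF i).isDevAt e he).const_mul c,
    fun e he g => ?_⟩, ?_⟩
  · rw [(hF i).act e he, mul_assoc]
  · filter_upwards [hpi, hconst] with x h1 h2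
    refine ⟨h1, fun e he => ?_⟩
    have h3 : DiscreteG.toG (L x).2 * (F (L x).1 (Function.surjInv (proj_surjective hD) (L x).1) *
      (F i (Function.surjInv (proj_surjective hD) (L x).1))⁻¹ : G n) = c := h2
    rw [(hF (L x).1).mul_inv_eq hD (hF i) (e := e) (by rw [he, hLp]; exact hxU _)
      (by rw [he]; exact h1) (by rw [Function.surjInv_eq (proj_surjective hD) _, he, hLp])] at h3
    rw [← h3]
    group

end Global

/-! ### The model bundle over projective space -/

section ModelBundle

theorem clsMat_smul_basePt {n : ℕ} {A : Mat n} (hA : A.det ≠ 0) :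
    ∃ h : (fun i => A i 0) ≠ 0, clsMat A • basePt n = Projectivization.mk ℝ (fun i => A i 0) h := by
  have h : (fun i => A i 0) ≠ 0 := fun h =>
    hA (Matrix.det_eq_zero_of_column_eq_zero 0 fun i => congrFun h i)
  refine ⟨h, ?_⟩
  rw [clsMat, cls_smul_basePt]
  simp only [toGL_coe hA]

/-- A map to projective space with smooth homogeneous coordinates is smooth. -/
theorem contMDiffAt_of_homogeneous {n : ℕ} {V X : Type*} [NormedAddCommGroup V] [NormedSpace ℝ V]
    [TopologicalSpace X] [ChartedSpace V X] {f : X → RP n} {v : X → Fin (n + 1) → ℝ} {a : X}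
    (hv : ∀ k, ContMDiffAt 𝓘(ℝ, V) 𝓘(ℝ, ℝ) ∞ (fun x => v x k) a)
    (hf : ∀ᶠ x in 𝓝 a, ∃ h : v x ≠ 0, f x = Projectivization.mk ℝ (v x) h) :
    ContMDiffAt 𝓘(ℝ, V) 𝓘(ℝ, EuclideanSpace ℝ (Fin n)) ∞ f a := by
  obtain ⟨ha, -⟩ := hf.self_of_nhds
  obtain ⟨i, hi⟩ := Function.ne_iff.1 ha
  have hsymm : ContMDiffAt 𝓘(ℝ, EuclideanSpace ℝ (Fin n)) 𝓘(ℝ, EuclideanSpace ℝ (Fin n)) ∞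
      (affineChart i).symm (WithLp.toLp 2 fun j : Fin n => v a (i.succAbove j) / v a i) :=
    contMDiffAt_symm_of_mem_maximalAtlas
      (IsManifold.subset_maximalAtlas ⟨i, rfl⟩) (mem_univ _)
  have hin : ContMDiffAt 𝓘(ℝ, V) 𝓘(ℝ, EuclideanSpace ℝ (Fin n)) ∞
      (fun x => WithLp.toLp 2 fun j : Fin n => v x (i.succAbove j) / v x i) a := by
    refine ContMDiffAt.comp (I' := 𝓘(ℝ, Fin n → ℝ)) a (g := WithLp.toLp 2)
      (PiLp.contDiff_toLp (𝕜 := ℝ) (n := ∞)).contMDiff.contMDiffAt ?_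
    exact contMDiffAt_pi_space.2 fun j => (hv _).div₀ (hv i) hi
  refine (hsymm.comp a hin).congr_of_eventuallyEq ?_
  filter_upwards [hf, (hv i).continuousAt.eventually_ne hi] with x ⟨hx, hfx⟩ hxi
  rw [hfx]
  exact ((affineChart i).left_inv (x := Projectivization.mk ℝ (v x) hx) hxi).symm

attribute [local instance] Matrix.normedAddCommGroup Matrix.normedSpace matTopology

/-- In the chart at `[A]` a point is `[A (1 + X)]`, and its image has the first column as
homogeneous coordinates, which is affine in `X`. -/
theorem contMDiff_smul_basePt (n : ℕ) :
    ContMDiff 𝓘(ℝ, 𝔤 n) 𝓘(ℝ, EuclideanSpace ℝ (Fin n)) ∞ fun g : G n => g • basePt n := by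
  intro g
  obtain ⟨A, hA, rfl⟩ := exists_clsMat g
  set c := chartAt (𝔤 n) (clsMat A) with hc
  refine contMDiffAt_of_homogeneous (v := fun h i => (A * (1 + toMat n (c h))) i 0) (fun k => ?_) ?_
  · have h1 : ContMDiffAt 𝓘(ℝ, 𝔤 n) 𝓘(ℝ, 𝔤 n) ∞ c (clsMat A) :=
      contMDiffAt_chart (mem_chart_source _ _)
    have h2 : ContDiff ℝ ∞ fun y : 𝔤 n => entryL n k 0 (mulBilin n A (1 + toMatL n y)) :=
      (entryL n k 0).contDiff.comp ((mulBilin n A).contDiff.comp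
        (contDiff_const.add (toMatL n).contDiff))
    exact h2.contMDiff.contMDiffAt.comp _ h1
  · filter_upwards [(chart_source_mem_nhds (𝔤 n) (clsMat A))] with h hh
    have ht : (1 + toMat n (c h)).det ≠ 0 := by
      have : c h ∈ c.target := c.map_source hh
      simpa [hc, chartPGL, chartAt, ChartedSpace.chartAt, chartOne] using this
    have hh' : clsMat (A * (1 + toMat n (c h))) = h := by
      rw [clsMat_mul hA ht]
      have h3 : c.symm (c h) = h := c.left_inv hh
      rw [← inv_inv (clsMat A)]
      exact h3
    obtain ⟨h4, h5⟩ := clsMat_smul_basePt (A := A * (1 + toMat n (c h)))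
      (by rw [Matrix.det_mul]; exact mul_ne_zero hA ht)
    exact ⟨h4, by rw [← h5, hh']⟩

/-- The projection of the model has smooth local sections. -/
theorem exists_model_section {n : ℕ} (g : G n) :
    ∃ σ : RP n → G n, σ (g • basePt n) = g ∧ ∀ᶠ l in 𝓝 (g • basePt n), σ l • basePt n = l ∧
      ContMDiffAt 𝓘(ℝ, EuclideanSpace ℝ (Fin n)) 𝓘(ℝ, 𝔤 n) ∞ σ l := by
  obtain ⟨A, hA, rfl⟩ := exists_clsMat g
  obtain ⟨h0, hb⟩ := clsMat_smul_basePt hA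
  obtain ⟨i, hi⟩ := Function.ne_iff.1 h0
  have hsrc : clsMat A • basePt n ∈ (affineChart i).source := by rw [hb]; exact hi
  -- Only the first column of `A` is changed, to a representative of the point with affine
  -- coordinates `y`. The scale `A i 0` makes `B` equal to `A` at the base point, hence invertible
  -- nearby.
  let B : EuclideanSpace ℝ (Fin n) → Mat n := fun y =>
    A + ∑ k, (A i 0 * homog i y k - A k 0) • Matrix.single k 0 (1 : ℝ)
  have hB0 : ∀ y k, B y k 0 = A i 0 * homog i y k := by
    intro y k
    simp [B, Matrix.sum_apply, Matrix.single_apply]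
  have hBA : B (affineChart i (clsMat A • basePt n)) = A := by
    have : ∀ k, A i 0 * homog i (affineChart i (clsMat A • basePt n)) k - A k 0 = 0 := by
      intro k
      rw [hb]
      change A i 0 * homog i (WithLp.toLp 2 fun j => A (i.succAbove j) 0 / A i 0) k - A k 0 = 0
      have hi' : A i 0 ≠ 0 := hi
      induction k using Fin.succAboveCases i with
      | x => simp [homog_self]
      | p j => rw [homog_succAbove]; field_simp; ring
    simp only [B, this, zero_smul, Finset.sum_const_zero, add_zero]
  have hBs : ContDiff ℝ ∞ B := by
    refine contDiff_const.add (ContDiff.sum fun k _ => ?_)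
    exact ((contDiff_const.mul (contDiff_homog i k)).sub contDiff_const).smul contDiff_const
  have hchart : ContinuousAt (affineChart i) (clsMat A • basePt n) :=
    (affineChart i).continuousAt hsrc
  refine ⟨fun l => clsMat (B (affineChart i l)), by simp only [hBA], ?_⟩
  have hdet : ∀ᶠ l in 𝓝 (clsMat A • basePt n), (B (affineChart i l)).det ≠ 0 := by
    have h1 : ContinuousAt (fun l => B (affineChart i l)) (clsMat A • basePt n) :=
      hBs.continuous.continuousAt.comp hchart
    exact h1.eventually (p := fun C : Mat n => C.det ≠ 0)
      (eventually_det_ne_zero (by beta_reduce; rw [hBA]; exact hA))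
  filter_upwards [hdet, (affineChart i).open_source.mem_nhds hsrc] with l hl hls
  constructor
  · obtain ⟨h4, h5⟩ := clsMat_smul_basePt hl
    refine h5.trans (Eq.trans ?_ ((affineChart i).left_inv hls))
    refine (Projectivization.mk_eq_mk_iff' ℝ _ _ _ _).2 ⟨A i 0, ?_⟩
    funext k
    rw [hB0]
    rfl
  · refine ContMDiffAt.comp (I' := 𝓘(ℝ, Mat n)) l (g := clsMat)
      (f := fun l => B (affineChart i l)) (contMDiffAt_clsMat hl) ?_
    refine ContMDiffAt.comp (I' := 𝓘(ℝ, EuclideanSpace ℝ (Fin n))) l (g := B)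
      hBs.contMDiff.contMDiffAt ?_
    exact contMDiffAt_of_mem_maximalAtlas (IsManifold.subset_maximalAtlas ⟨i, rfl⟩) hls

end ModelBundle

/-! ### Cancellation for local diffeomorphisms. -/

section LocalDiffeomorph

/-- Left cancellation of local diffeomorphisms. -/
theorem isLocalDiffeomorphAt_of_comp {V₁ X V₂ Y V₃ Z : Type*}
    [NormedAddCommGroup V₁] [NormedSpace ℝ V₁] [TopologicalSpace X] [ChartedSpace V₁ X]
    [NormedAddCommGroup V₂] [NormedSpace ℝ V₂] [TopologicalSpace Y] [ChartedSpace V₂ Y]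
    [NormedAddCommGroup V₃] [NormedSpace ℝ V₃] [TopologicalSpace Z] [ChartedSpace V₃ Z]
    {f : X → Y} {h : Y → Z} {k : X → Z} {a : X} (hf : ContinuousAt f a)
    (hh : IsLocalDiffeomorphAt 𝓘(ℝ, V₂) 𝓘(ℝ, V₃) ∞ h (f a))
    (hk : IsLocalDiffeomorphAt 𝓘(ℝ, V₁) 𝓘(ℝ, V₃) ∞ k a) (hhf : ∀ᶠ x in 𝓝 a, h (f x) = k x) :
    IsLocalDiffeomorphAt 𝓘(ℝ, V₁) 𝓘(ℝ, V₂) ∞ f a := by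
  obtain ⟨Φ, ha, hΦ⟩ := hh
  obtain ⟨Ψ, ha', hΨ⟩ := hk
  have h1 : ∀ᶠ x in 𝓝 a, x ∈ Ψ.source ∧ f x ∈ Φ.source ∧ Φ (f x) = Ψ x := by
    filter_upwards [Ψ.open_source.mem_nhds ha', hf.eventually_mem (Φ.open_source.mem_nhds ha), hhf]
      with x h1 h2 h3
    exact ⟨h1, h2, by rw [← hΦ h2, ← hΨ h1, h3]⟩
  have hΦc : ContMDiffAt 𝓘(ℝ, V₂) 𝓘(ℝ, V₃) ∞ Φ (f a) :=
    Φ.contMDiffOn.contMDiffAt (Φ.open_source.mem_nhds ha)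
  have hΨc : ContMDiffAt 𝓘(ℝ, V₃) 𝓘(ℝ, V₁) ∞ Ψ.symm (Φ (f a)) := by
    rw [h1.self_of_nhds.2.2]
    exact Ψ.symm.contMDiffOn.contMDiffAt (Ψ.open_target.mem_nhds (Ψ.map_source ha'))
  have h2 : ∀ᶠ y in 𝓝 (f a), y ∈ Φ.source ∧ Φ y ∈ Ψ.target := by
    filter_upwards [Φ.open_source.mem_nhds ha, hΦc.continuousAt.eventually_mem
      (Ψ.open_target.mem_nhds (h1.self_of_nhds.2.2 ▸ Ψ.map_source ha'))] with y hy hy'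
      using ⟨hy, hy'⟩
  have hc : Filter.Tendsto (fun y => Ψ.symm (Φ y)) (𝓝 (f a)) (𝓝 a) := by
    have h3 : Ψ.symm (Φ (f a)) = a := by
      rw [h1.self_of_nhds.2.2]; exact Ψ.left_inv ha'
    have h4 := (hΨc.comp (f a) hΦc).continuousAt
    rwa [ContinuousAt, Function.comp_apply, h3] at h4
  refine isLocalDiffeomorphAt_of_inverse (g := fun y => Ψ.symm (Φ y)) ?_ ?_ ?_ ?_
  · filter_upwards [h1.eventually_nhds] with x hx
    have hx0 := hx.self_of_nhds
    have ht : Ψ x ∈ Φ.target := by rw [← hx0.2.2]; exact Φ.map_source hx0.2.1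
    refine ContMDiffAt.congr_of_eventuallyEq (f := fun x => Φ.symm (Ψ x)) ?_ ?_
    · exact (Φ.symm.contMDiffOn.contMDiffAt (Φ.open_target.mem_nhds ht)).comp x
        (Ψ.contMDiffOn.contMDiffAt (Ψ.open_source.mem_nhds hx0.1))
    · filter_upwards [hx] with z hz
      rw [← hz.2.2]
      exact (Φ.left_inv hz.2.1).symm
  · filter_upwards [h2] with y hy
    exact (Ψ.symm.contMDiffOn.contMDiffAt (Ψ.open_target.mem_nhds hy.2)).comp y
      (Φ.contMDiffOn.contMDiffAt (Φ.open_source.mem_nhds hy.1))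
  · filter_upwards [h1] with x hx
    rw [hx.2.2]
    exact Ψ.left_inv hx.1
  · filter_upwards [h2, hc.eventually h1] with y hy hx
    refine Φ.injOn hx.2.1 hy.1 (hx.2.2.trans ?_)
    exact Ψ.right_inv hy.2

end LocalDiffeomorph

/-! ### Smoothness of the canonical map from the pullback bundle. -/

namespace Pullback

variable {n : ℕ} {N E W X : Type*} [TopologicalSpace N] [TopologicalSpace E] [TopologicalSpace X]
  [NormedAddCommGroup W] [NormedSpace ℝ W] [ChartedSpace W E] [IsManifold 𝓘(ℝ, W) ∞ E]
  (D : ConnectionData n N E W) {δ : X → N} (hδ : IsLocalHomeomorph δ)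

/-- The charts of `δ^* E` are those of `E` composed with this map, so it is the identity in suitable
charts. -/
theorem isLocalDiffeomorph_snd :
    IsLocalDiffeomorph 𝓘(ℝ, W) 𝓘(ℝ, W) ∞ (snd D hδ) := by
  intro y
  obtain ⟨h1, h2⟩ := (isLocalHomeomorph_snd D hδ y).choose_spec
  set ψ := (isLocalHomeomorph_snd D hδ y).choose with hψ
  have h3 : ∀ z, snd D hδ z = ψ z := fun z => congrFun h2 z
  have hc : chartAt W y = ψ.trans (chartAt W (snd D hδ y)) := rfl
  have hs : snd D hδ y ∈ (chartAt W (snd D hδ y)).source := mem_chart_source W _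
  have hsrc : ∀ᶠ z in 𝓝 y, z ∈ ψ.source ∧ snd D hδ z ∈ (chartAt W (snd D hδ y)).source := by
    filter_upwards [ψ.open_source.mem_nhds h1, (continuous_snd D hδ).continuousAt.eventually_mem
      ((chartAt W (snd D hδ y)).open_source.mem_nhds hs)] with z hz hz' using ⟨hz, hz'⟩
  have htgt : ∀ᶠ e in 𝓝 (snd D hδ y), e ∈ ψ.target ∧ e ∈ (chartAt W (snd D hδ y)).source := by
    filter_upwards [ψ.open_target.mem_nhds (h3 y ▸ ψ.map_source h1),
      (chartAt W (snd D hδ y)).open_source.mem_nhds hs] with z hz hz' using ⟨hz, hz'⟩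
  refine isLocalDiffeomorphAt_of_inverse (g := ψ.symm) ?_ ?_ ?_ ?_
  · filter_upwards [hsrc.eventually_nhds] with z hz
    have hz0 := hz.self_of_nhds
    have hzc : z ∈ (chartAt W y).source := by
      rw [hc]
      refine ⟨hz0.1, ?_⟩
      have := hz0.2
      rwa [h3 z] at this
    refine ContMDiffAt.congr_of_eventuallyEq
      (f := fun z => (chartAt W (snd D hδ y)).symm (chartAt W y z)) ?_ ?_
    · refine (contMDiffAt_chart_symm ?_).comp z (contMDiffAt_chart hzc)
      rw [hc]
      have := hz0.2
      rw [h3 z] at this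
      exact (chartAt W (snd D hδ y)).map_source this
    · filter_upwards [hz] with w hw
      refine ((chartAt W (snd D hδ y)).left_inv hw.2).symm.trans ?_
      rw [hc, h3 w]
      rfl
  · filter_upwards [htgt.eventually_nhds] with e he
    have he0 := he.self_of_nhds
    refine ContMDiffAt.congr_of_eventuallyEq
      (f := fun e => (chartAt W y).symm (chartAt W (snd D hδ y) e)) ?_ ?_
    · refine (contMDiffAt_chart_symm ?_).comp e (contMDiffAt_chart he0.2)
      rw [hc, OpenPartialHomeomorph.trans_target]
      refine ⟨(chartAt W (snd D hδ y)).map_source he0.2, ?_⟩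
      rw [mem_preimage, (chartAt W (snd D hδ y)).left_inv he0.2]
      exact he0.1
    · filter_upwards [he] with w hw
      rw [hc]
      change ψ.symm w = ψ.symm ((chartAt W (snd D hδ y)).symm (chartAt W (snd D hδ y) w))
      rw [(chartAt W (snd D hδ y)).left_inv hw.2]
  · filter_upwards [hsrc] with z hz
    rw [h3]
    exact ψ.left_inv hz.1
  · filter_upwards [htgt] with e he
    rw [h3]
    exact ψ.right_inv he.1

end Pullback

/-! ### Points of the bundle with prescribed base point and developed image. -/

section LocalLift

variable {n : ℕ} {N E W : Type*} [TopologicalSpace N] [TopologicalSpace E]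
  [NormedAddCommGroup W] [NormedSpace ℝ W] [ChartedSpace W E]
  [ChartedSpace (EuclideanSpace ℝ (Fin n)) N] [IsManifold 𝓘(ℝ, W) ∞ E]
  {D : ConnectionData n N E W} {F : E → G n} {U : Set N} {e e' : E}

/-- Two points of a fiber differ by some `g`; by equivariance equal values force `g = 1`. -/
theorem IsDevOn.eq_of_eq (hD : D.IsProjectiveConnection) (h : IsDevOn D F U)
    (he : D.proj e ∈ U) (hee : D.proj e = D.proj e') (hF : F e = F e') : e = e' := by
  obtain ⟨g, rfl⟩ := exists_act_eq hD hee
  rw [h.act e he, left_eq_mul] at hF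
  obtain rfl : g = 1 := Subtype.ext hF
  exact (hD.act_one e).symm

theorem mul_coe_smul_basePt {n : ℕ} (g : G n) (h : G₀ n) :
    (g * (h : G n)) • basePt n = g • basePt n :=
  (model n).proj_act g h

/-- Points of the bundle over `u x` with developed image `k x` depend continuously on `x`. -/
theorem IsDevOn.exists_lift (hD : D.IsProjectiveConnection) (hU : IsOpen U) (h : IsDevOn D F U)
    (he : D.proj e ∈ U) {X : Type*} [TopologicalSpace X] {a : X} {u : X → N} {k : X → G n}
    (hu : ContinuousAt u a) (hk : ContinuousAt k a) (hua : u a = D.proj e) (hka : k a = F e)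
    (huk : ∀ᶠ x in 𝓝 a, ∀ e, D.proj e = u x → k x • basePt n = F e • basePt n) :
    ∃ f : X → E, ContinuousAt f a ∧ f a = e ∧ ∀ᶠ x in 𝓝 a, D.proj (f x) = u x ∧ F (f x) = k x := by
  obtain ⟨s, hs, hs'⟩ := exists_local_section hD e
  rw [← hua] at hs hs' he
  have hsc : ContinuousAt (fun x => s (u x)) a :=
    ContinuousAt.comp (g := s) hs'.self_of_nhds.2.continuousAt hu
  have hFc : ContinuousAt (fun x => F (s (u x))) a := by
    refine ContinuousAt.comp (g := F) ?_ hsc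
    exact (h.isDevAt _ (by rwa [hs, ← hua])).contMDiffAt.continuousAt
  have hev : ∀ᶠ x in 𝓝 a, D.proj (s (u x)) = u x ∧ u x ∈ U ∧
      (F (s (u x)))⁻¹ * k x ∈ G₀ n := by
    filter_upwards [hu.eventually hs', hu.eventually_mem (hU.mem_nhds he), huk] with x h1 h2 h3
    refine ⟨h1.1, h2, ?_⟩
    rw [MulAction.mem_stabilizer_iff, mul_smul, h3 _ h1.1, inv_smul_smul]
  classical
  let c : X → G₀ n := fun x =>
    if hx : (F (s (u x)))⁻¹ * k x ∈ G₀ n then ⟨(F (s (u x)))⁻¹ * k x, hx⟩ else 1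
  have hc : ∀ x, (F (s (u x)))⁻¹ * k x ∈ G₀ n → (c x : G n) = (F (s (u x)))⁻¹ * k x := fun x hx => by
    simp only [c, dif_pos hx]
  have hcc : ContinuousAt c a := by
    rw [Topology.IsInducing.subtypeVal.continuousAt_iff]
    refine (hFc.inv.mul hk).congr ?_
    filter_upwards [hev] with x hx using (hc x hx.2.2).symm
  refine ⟨fun x => D.act (s (u x)) (c x), ?_, ?_, ?_⟩
  · exact ContinuousAt.comp (g := fun y : E × G₀ n => D.act y.1 y.2)
      hD.contMDiff_act.continuous.continuousAt (hsc.prodMk hcc)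
  · have : c a = 1 := Subtype.ext (by
      rw [hc a hev.self_of_nhds.2.2, hs, hka, inv_mul_cancel]; rfl)
    simp only [this, hD.act_one, hs]
  · filter_upwards [hev] with x hx
    refine ⟨(D.proj_act _ _).trans hx.1, ?_⟩
    rw [h.act _ (by rw [hx.1]; exact hx.2.1), hc x hx.2.2, mul_inv_cancel_left]

end LocalLift

/-! ### The developing map to projective space and its holonomy. -/

section GlobalDev

variable {n : ℕ} {N E W X : Type*} [TopologicalSpace N] [TopologicalSpace E]
  [NormedAddCommGroup W] [NormedSpace ℝ W] [ChartedSpace W E]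
  [ChartedSpace (EuclideanSpace ℝ (Fin n)) N] [IsManifold 𝓘(ℝ, W) ∞ E]
  [TopologicalSpace X]
  {D : ConnectionData n N E W} {p : X → N} {Φ : X → E → G n} {x : X} {e e' : E}

omit [ChartedSpace (EuclideanSpace ℝ (Fin n)) N] [IsManifold 𝓘(ℝ, W) ∞ E] in
theorem IsGlobalDev.act (h : IsGlobalDev D p Φ) (he : D.proj e = p x) (g : G₀ n) :
    Φ x (D.act e g) = Φ x e * (g : G n) := by
  obtain ⟨U, F, -, hx, hF, hΦ⟩ := h x
  rw [hΦ.self_of_nhds.2 _ he, hΦ.self_of_nhds.2 _ ((D.proj_act e g).trans he)]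
  exact hF.act e (by rwa [he]) g

theorem IsGlobalDev.eq_of_eq (hD : D.IsProjectiveConnection) (h : IsGlobalDev D p Φ)
    (he : D.proj e = p x) (he' : D.proj e' = p x) (hΦ : Φ x e = Φ x e') : e = e' := by
  obtain ⟨U, F, -, hx, hF, hF'⟩ := h x
  rw [hF'.self_of_nhds.2 _ he, hF'.self_of_nhds.2 _ he'] at hΦ
  exact hF.eq_of_eq hD (by rwa [he]) (he.trans he'.symm) hΦ

/-- The developing map with values in projective space. -/
def devMap (hD : D.IsProjectiveConnection) (p : X → N) (Φ : X → E → G n) (x : X) : RP n :=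
  Φ x (Function.surjInv (proj_surjective hD) (p x)) • basePt n

/-- Another point of the fiber changes `Φ x e` by a right factor in `G₀`, which fixes `[e₀]`. -/
theorem IsGlobalDev.devMap_eq (hD : D.IsProjectiveConnection) (h : IsGlobalDev D p Φ)
    (he : D.proj e = p x) : devMap hD p Φ x = Φ x e • basePt n := by
  obtain ⟨g, hg⟩ := exists_act_eq hD
    (he.trans (Function.surjInv_eq (proj_surjective hD) (p x)).symm)
  rw [devMap, ← hg, h.act he, mul_coe_smul_basePt]

/-- The elements of `PGL` over `δ x` form one coset of `G₀`, and equivariance makes `Φ x` reach all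
of it. With `IsGlobalDev.eq_of_eq` this is a bijection from the fiber of `E`. -/
theorem IsGlobalDev.exists_eq (hD : D.IsProjectiveConnection) (h : IsGlobalDev D p Φ) {g : G n}
    (hg : devMap hD p Φ x = g • basePt n) : ∃ e, D.proj e = p x ∧ Φ x e = g := by
  obtain ⟨e, he⟩ := proj_surjective hD (p x)
  have hmem : (Φ x e)⁻¹ * g ∈ G₀ n := by
    rw [MulAction.mem_stabilizer_iff, mul_smul, ← hg, h.devMap_eq hD he, inv_smul_smul]
  exact ⟨D.act e ⟨_, hmem⟩, (D.proj_act _ _).trans he, by rw [h.act he, mul_inv_cancel_left]⟩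

/-- Developing maps change under a deck transformation by a constant. -/
theorem IsGlobalDev.exists_holonomy [PreconnectedSpace X] (hD : D.IsProjectiveConnection)
    (h : IsGlobalDev D p Φ) {τ : X → X} (hτ : Continuous τ) (hpτ : ∀ x, p (τ x) = p x)
    (hp : Continuous p) :
    ∃ r : G n, ∀ x e, D.proj e = p x → Φ (τ x) e = r * Φ x e := by
  rcases isEmpty_or_nonempty X with hX | ⟨⟨y⟩⟩
  · exact ⟨1, fun x => isEmptyElim x⟩
  -- Since `p ∘ τ = p`, both `Φ (τ x)` and `Φ x` come from developing maps over a neighbourhood of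
  -- `p x₁`; these differ by a constant.
  have key : ∀ x₁, ∃ g : G n, ∀ᶠ x in 𝓝 x₁, ∀ e, D.proj e = p x → Φ (τ x) e = g * Φ x e := by
    intro x₁
    obtain ⟨U, F, hU, hx, hF, hF'⟩ := h x₁
    obtain ⟨V, K, hV, hxV, hK, hK'⟩ := h (τ x₁)
    obtain ⟨g, hg⟩ := hK.eventually_eq_mul hD hV hU hF (by rwa [← hpτ]) hx
    refine ⟨g, ?_⟩
    filter_upwards [hp.continuousAt.eventually hg, hF', hτ.continuousAt.eventually hK']
      with x h1 h2 h3 e he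
    rw [h2.2 e he, h3.2 e (by rw [he, hpτ]), h1 e he]
  let r : X → G n := fun x => Φ (τ x) (Function.surjInv (proj_surjective hD) (p x)) *
    (Φ x (Function.surjInv (proj_surjective hD) (p x)))⁻¹
  have hr : IsLocallyConstant r := by
    rw [IsLocallyConstant.iff_eventually_eq]
    intro x₁
    obtain ⟨g, hg⟩ := key x₁
    have hg' : ∀ᶠ x in 𝓝 x₁, r x = g := hg.mono fun x hx => by
      simp only [r, hx _ (Function.surjInv_eq (proj_surjective hD) (p x)), mul_inv_cancel_right]
    filter_upwards [hg'] with x hx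
    rw [hx, hg'.self_of_nhds]
  refine ⟨r y, fun x e he => ?_⟩
  obtain ⟨g, hg⟩ := key x
  have hx := hg.self_of_nhds
  have : r x = g := by
    simp only [r, hx _ (Function.surjInv_eq (proj_surjective hD) (p x)), mul_inv_cancel_right]
  rw [hr.apply_eq_of_preconnectedSpace y x, this, hx e he]

variable [ChartedSpace (EuclideanSpace ℝ (Fin n)) X]

/-- Locally `δ` is `p` followed by a section of `E`, by `F` and by the projection of the model. An
inverse runs back: a section `σ` of the model, the inverse of `F`, the projection of `E`, the
inverse of `p`. -/
theorem IsGlobalDev.isLocalDiffeomorph_devMap (hD : D.IsProjectiveConnection)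
    (h : IsGlobalDev D p Φ) (hp : IsLocalDiffeomorph 𝓘(ℝ, EuclideanSpace ℝ (Fin n))
      𝓘(ℝ, EuclideanSpace ℝ (Fin n)) ∞ p) :
    IsLocalDiffeomorph 𝓘(ℝ, EuclideanSpace ℝ (Fin n)) 𝓘(ℝ, EuclideanSpace ℝ (Fin n)) ∞
      (devMap hD p Φ) := by
  intro x₁
  obtain ⟨U, F, hU, hxU, hF, hΦ⟩ := h x₁
  obtain ⟨e₁, he₁⟩ := proj_surjective hD (p x₁)
  have heU : D.proj e₁ ∈ U := by rwa [he₁]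
  have hpc : ContMDiff 𝓘(ℝ, EuclideanSpace ℝ (Fin n)) 𝓘(ℝ, EuclideanSpace ℝ (Fin n)) ∞ p :=
    hp.contMDiff
  have hδ : ∀ᶠ x in 𝓝 x₁, p x ∈ U ∧ ∀ e, D.proj e = p x → devMap hD p Φ x = F e • basePt n :=
    hΦ.mono fun x hx => ⟨hx.1, fun e he => by rw [h.devMap_eq hD he, hx.2 e he]⟩
  have hδ₁ : devMap hD p Φ x₁ = F e₁ • basePt n := hδ.self_of_nhds.2 e₁ he₁
  -- smoothness
  obtain ⟨s, hs, hs'⟩ := exists_local_section hD e₁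
  rw [he₁] at hs hs'
  have hsmooth : ∀ᶠ x in 𝓝 x₁, ContMDiffAt 𝓘(ℝ, EuclideanSpace ℝ (Fin n))
      𝓘(ℝ, EuclideanSpace ℝ (Fin n)) ∞ (devMap hD p Φ) x := by
    filter_upwards [hδ.eventually_nhds,
      hpc.continuous.continuousAt.eventually hs'.eventually_nhds] with x hx hx'
    have hx0 := hx'.self_of_nhds
    refine ContMDiffAt.congr_of_eventuallyEq (f := fun x => F (s (p x)) • basePt n) ?_ ?_
    · refine (contMDiff_smul_basePt n).contMDiffAt.comp x (f := fun x => F (s (p x))) ?_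
      refine ContMDiffAt.comp (I' := 𝓘(ℝ, W)) x (g := F) ?_ ?_
      · exact (hF.isDevAt _ (by rw [hx0.1]; exact hx.self_of_nhds.1)).contMDiffAt
      · exact hx0.2.comp x hpc.contMDiffAt
    · filter_upwards [hx, hpc.continuous.continuousAt.eventually hx'] with y hy hy'
      exact hy.2 _ hy'.1
  -- the local inverse
  obtain ⟨σ, hσ, hσ'⟩ := exists_model_section (F e₁)
  obtain ⟨Ψ, he₁Ψ, hΨ⟩ := (hF.isDevAt e₁ heU).isLocalDiffeomorphAt hD
  obtain ⟨P, hxP, hP⟩ := hp x₁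
  have hσc : ContinuousAt (fun x => σ (devMap hD p Φ x)) x₁ := by
    refine ContinuousAt.comp (g := σ) ?_ hsmooth.self_of_nhds.continuousAt
    rw [hδ₁]
    exact hσ'.self_of_nhds.2.continuousAt
  -- The point `f x` lies over `p x` and develops to `σ (δ x)`. By continuity it stays in the domain
  -- where `F` is inverted, so `Ψ.symm (σ (δ x)) = f x`.
  obtain ⟨f, hfc, hf₁, hf⟩ := hF.exists_lift hD hU heU (u := p) hpc.continuous.continuousAt hσc
    he₁.symm (by rw [hδ₁, hσ]) (by
      filter_upwards [hδ, hsmooth.self_of_nhds.continuousAt.eventually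
        (p := fun l => σ l • basePt n = l) (by rw [hδ₁]; exact hσ'.mono fun l hl => hl.1)]
        with x hx hx' e he
      rw [hx', hx.2 e he])
  have hF₁ : F e₁ ∈ Ψ.target := by rw [hΨ he₁Ψ]; exact Ψ.map_source he₁Ψ
  have hΨs : ContMDiffOn 𝓘(ℝ, 𝔤 n) 𝓘(ℝ, W) ∞ Ψ.symm Ψ.target := Ψ.symm.contMDiffOn
  have hPs : ContMDiffOn 𝓘(ℝ, EuclideanSpace ℝ (Fin n)) 𝓘(ℝ, EuclideanSpace ℝ (Fin n)) ∞
    P.symm P.target := P.symm.contMDiffOn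
  have hΨ₁ : Ψ.symm (F e₁) = e₁ := by rw [hΨ he₁Ψ]; exact Ψ.left_inv he₁Ψ
  have hP₁ : P.symm (p x₁) = x₁ := by rw [hP hxP]; exact P.left_inv hxP
  have hxPt : p x₁ ∈ P.target := by rw [hP hxP]; exact P.map_source hxP
  have hσm : ∀ᶠ l in 𝓝 (F e₁ • basePt n), σ l ∈ Ψ.target :=
    hσ'.self_of_nhds.2.continuousAt.eventually_mem
      (Ψ.open_target.mem_nhds (by rw [hσ]; exact hF₁))
  have hec : ContinuousAt (fun l => Ψ.symm (σ l)) (F e₁ • basePt n) := by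
    refine ContinuousAt.comp (g := Ψ.symm) ?_ hσ'.self_of_nhds.2.continuousAt
    rw [hσ]
    exact (hΨs.contMDiffAt (Ψ.open_target.mem_nhds hF₁)).continuousAt
  have huc : ContinuousAt (fun l => D.proj (Ψ.symm (σ l))) (F e₁ • basePt n) :=
    D.proj.continuous.continuousAt.comp hec
  have hu₁ : D.proj (Ψ.symm (σ (F e₁ • basePt n))) = p x₁ := by rw [hσ, hΨ₁, he₁]
  have hum : ∀ᶠ l in 𝓝 (F e₁ • basePt n), D.proj (Ψ.symm (σ l)) ∈ P.target :=
    huc.eventually_mem (P.open_target.mem_nhds (by rw [hu₁]; exact hxPt))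
  have hxc : ContinuousAt (fun l => P.symm (D.proj (Ψ.symm (σ l)))) (F e₁ • basePt n) := by
    refine ContinuousAt.comp (g := P.symm) ?_ huc
    rw [hu₁]
    exact (hPs.contMDiffAt (P.open_target.mem_nhds hxPt)).continuousAt
  refine isLocalDiffeomorphAt_of_inverse (g := fun l => P.symm (D.proj (Ψ.symm (σ l)))) hsmooth
    ?_ ?_ ?_
  · rw [hδ₁]
    filter_upwards [hσ', hσm, hum] with l h1 h2 h3
    refine ContMDiffAt.comp (I' := 𝓘(ℝ, EuclideanSpace ℝ (Fin n))) l (g := P.symm)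
      (hPs.contMDiffAt (P.open_target.mem_nhds h3)) ?_
    refine hD.contMDiff_proj.contMDiffAt.comp l (f := fun l => Ψ.symm (σ l)) ?_
    exact ContMDiffAt.comp (I' := 𝓘(ℝ, 𝔤 n)) l (g := Ψ.symm)
      (hΨs.contMDiffAt (Ψ.open_target.mem_nhds h2)) h1.2
  · filter_upwards [hf, hfc.eventually_mem (by rw [hf₁]; exact Ψ.open_source.mem_nhds he₁Ψ),
      P.open_source.mem_nhds hxP] with x h1 h2 h3
    have h4 : Ψ.symm (σ (devMap hD p Φ x)) = f x := by
      rw [← h1.2, hΨ h2]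
      exact Ψ.left_inv h2
    rw [h4, h1.1, hP h3]
    exact P.left_inv h3
  · rw [hδ₁]
    have hx' : ∀ᶠ l in 𝓝 (F e₁ • basePt n), _ :=
      hxc.eventually (by simp only [hu₁, hP₁]; exact hδ)
    filter_upwards [hσ', hσm, hum, hx'] with l h1 h2 h3 h4
    have h5 : p (P.symm (D.proj (Ψ.symm (σ l)))) = D.proj (Ψ.symm (σ l)) :=
      (hP (P.map_target h3)).trans (P.right_inv h3)
    rw [h4.2 _ h5.symm]
    refine Eq.trans ?_ h1.1
    exact congrArg (· • basePt n) ((hΨ (Ψ.map_target h2)).trans (Ψ.right_inv h2))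

end GlobalDev

/-! ### The quotient map -/

/-- The image is open, and also closed: over an evenly covered neighbourhood of a point with empty
fiber all fibers are empty. -/
theorem surjective_of_isCoveringMap {M X : Type*} [TopologicalSpace M] [TopologicalSpace X]
    [PreconnectedSpace M] [Nonempty X] {p : X → M} (hp : IsCoveringMap p) :
    Function.Surjective p := by
  have hcl : IsClosed (range p) := by
    rw [← isOpen_compl_iff, isOpen_iff_mem_nhds]
    intro x hx
    obtain ⟨-, U, hxU, hU, -, H, -⟩ := hp x
    filter_upwards [hU.mem_nhds hxU]
    rintro _ hy ⟨z, rfl⟩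
    obtain ⟨w, hw⟩ := (H ⟨z, hy⟩).2
    exact hx ⟨w, hw⟩
  exact range_eq_univ.1 (IsClopen.eq_univ ⟨hcl, hp.isLocalHomeomorph.isOpenMap.isOpen_range⟩
    (range_nonempty p))

section Quotient

variable {n : ℕ} {N E W X Γ : Type*} [TopologicalSpace N] [TopologicalSpace E]
  [NormedAddCommGroup W] [NormedSpace ℝ W] [ChartedSpace W E]
  [ChartedSpace (EuclideanSpace ℝ (Fin n)) N] [IsManifold 𝓘(ℝ, W) ∞ E]
  [TopologicalSpace X] [Group Γ]
  {D : ConnectionData n N E W} {p : X → N} {Φ : X → E → G n}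

/-- The holonomy morphism: developing maps are equivariant under deck transformations. -/
theorem IsGlobalDev.exists_holonomy_hom [ConnectedSpace X] (hD : D.IsProjectiveConnection)
    (h : IsGlobalDev D p Φ) (hp : Continuous p) (a : Γ →* Equiv.Perm X)
    (ha : ∀ γ, Continuous (a γ)) (hpa : ∀ γ x, p (a γ x) = p x) :
    ∃ ρ : Γ →* G n, ∀ γ x e, D.proj e = p x → Φ (a γ x) e = ρ γ * Φ x e := by
  choose r hr using fun γ => h.exists_holonomy hD (ha γ) (hpa γ) hp
  obtain ⟨x⟩ : Nonempty X := inferInstance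
  obtain ⟨e, he⟩ := proj_surjective hD (p x)
  refine ⟨MonoidHom.mk' r fun γ γ' => ?_, hr⟩
  have h1 := hr (γ * γ') x e he
  rw [map_mul, Equiv.Perm.mul_apply, hr γ _ e (by rw [he, hpa]), hr γ' x e he, ← mul_assoc] at h1
  exact (mul_right_cancel h1).symm

variable {δ : X → RP n} (hδ : IsLocalHomeomorph δ)

/-- Locally `F ∘ q = snd` with `F` and `snd` local diffeomorphisms, so continuity of `q` is enough
to cancel `F`. -/
theorem IsGlobalDev.isLocalDiffeomorphAt_of_section (hD : D.IsProjectiveConnection)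
    (h : IsGlobalDev D p Φ) (hp : Continuous p) (hδ' : ∀ x e, D.proj e = p x → δ x = Φ x e • basePt n)
    {q : Pullback (model n) hδ → E} (hq : ∀ y, D.proj (q y) = p (Pullback.fst (model n) hδ y))
    (hΦq : ∀ y, Φ (Pullback.fst (model n) hδ y) (q y) = Pullback.snd (model n) hδ y)
    (y : Pullback (model n) hδ) :
    IsLocalDiffeomorphAt 𝓘(ℝ, 𝔤 n) 𝓘(ℝ, W) ∞ q y ∧ ∃ F, IsDevAt D F (q y) ∧
      ∀ᶠ z in 𝓝 y, F (q z) = Pullback.snd (model n) hδ z := by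
  obtain ⟨U, F, hU, hyU, hF, hΦ⟩ := h (Pullback.fst (model n) hδ y)
  have hqU : D.proj (q y) ∈ U := by rwa [hq]
  have hfst : ContinuousAt (Pullback.fst (model n) hδ) y :=
    (Pullback.continuous_fst (model n) hδ).continuousAt
  have hFq : ∀ᶠ z in 𝓝 y, F (q z) = Pullback.snd (model n) hδ z := by
    filter_upwards [hfst.eventually hΦ] with z hz
    rw [← hz.2 _ (hq z), hΦq]
  have hδz : ∀ z, Pullback.snd (model n) hδ z • basePt n = δ (Pullback.fst (model n) hδ z) :=
    fun z => z.2.symm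
  obtain ⟨f, hfc, hf1, hf⟩ := hF.exists_lift hD hU hqU
    (u := fun z => p (Pullback.fst (model n) hδ z)) (hp.continuousAt.comp hfst)
    (Pullback.continuous_snd (model n) hδ).continuousAt (hq y).symm hFq.self_of_nhds.symm (by
      filter_upwards [hfst.eventually hΦ] with z hz e he
      rw [hδz, hδ' _ _ he, hz.2 e he])
  -- No continuity of `q` is assumed: it agrees with the continuous lift `f` because `Φ` is
  -- injective on fibers.
  have hqc : ContinuousAt q y := by
    refine hfc.congr ?_
    filter_upwards [hf, hfst.eventually hΦ] with z h1 h2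
    refine h.eq_of_eq hD h1.1 (hq z) ?_
    rw [h2.2 _ h1.1, hΦq, h1.2]
  have hFd := hF.isDevAt _ hqU
  exact ⟨isLocalDiffeomorphAt_of_comp hqc (hFd.isLocalDiffeomorphAt hD)
    (Pullback.isLocalDiffeomorph_snd (model n) hδ y) hFq, F, hFd, hFq⟩

/-- A flat connection is the quotient of the pullback of the model along the developing map. -/
theorem IsGlobalDev.exists_isQuotientConnection (hD : D.IsProjectiveConnection)
    (h : IsGlobalDev D p Φ) (hp : Continuous p) (hps : Function.Surjective p)
    (hδ' : ∀ x, δ x = devMap hD p Φ x) (a : Γ →* Equiv.Perm X)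
    (hpa : ∀ x x', p x = p x' ↔ ∃ γ, a γ x = x') (ρ : Γ →* G n)
    (hρ : ∀ γ x e, D.proj e = p x → Φ (a γ x) e = ρ γ * Φ x e)
    (hρδ : ∀ γ x, δ (a γ x) = ρ γ • δ x) :
    ∃ q : Pullback (model n) hδ → E, IsQuotientConnection ((model n).pullback hδ) D p
      (holonomyAction a hδ ρ hρδ) q := by
  have hex : ∀ y : Pullback (model n) hδ, ∃ e, D.proj e = p (Pullback.fst (model n) hδ y) ∧
      Φ (Pullback.fst (model n) hδ y) e = Pullback.snd (model n) hδ y :=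
    fun y => h.exists_eq hD ((hδ' _).symm.trans y.2)
  -- Every algebraic property of `q` follows because `q (x, g)` is the only point over `p x` with
  -- developed image `g`.
  choose q hq hΦq using hex
  have hδe : ∀ x e, D.proj e = p x → δ x = Φ x e • basePt n := fun x e he => by
    rw [hδ', h.devMap_eq hD he]
  have huniq : ∀ y e, D.proj e = p (Pullback.fst (model n) hδ y) →
      Φ (Pullback.fst (model n) hδ y) e = Pullback.snd (model n) hδ y → q y = e :=
    fun y e he he' => h.eq_of_eq hD (hq y) he ((hΦq y).trans he'.symm)
  have hloc := h.isLocalDiffeomorphAt_of_section hδ hD hp hδe hq hΦq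
  refine ⟨q, fun e => ?_, fun y => (hloc y).1, fun y z => ⟨fun hyz => ?_, ?_⟩, hq, fun y g => ?_,
    fun y v => ?_⟩
  · obtain ⟨x, hx⟩ := hps (D.proj e)
    exact ⟨⟨(x, Φ x e), hδe x e hx.symm⟩, huniq _ e hx.symm rfl⟩
  -- Equal images lie over the same point of the base, so the first components differ by some `γ`;
  -- the holonomy relation then matches the second components.
  · obtain ⟨γ, hγ⟩ := (hpa (Pullback.fst (model n) hδ y) (Pullback.fst (model n) hδ z)).1
      (by rw [← hq, ← hq, hyz])
    refine ⟨γ, Subtype.ext (Prod.ext hγ ?_)⟩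
    change ρ γ * Pullback.snd (model n) hδ y = Pullback.snd (model n) hδ z
    rw [← hΦq y, ← hΦq z, ← hρ γ _ _ (hq y), hγ, hyz]
  · rintro ⟨γ, rfl⟩
    refine (huniq _ (q y) ?_ ?_).symm
    · exact (hq y).trans ((hpa _ _).2 ⟨γ, rfl⟩)
    · refine (hρ γ _ _ (hq y)).trans ?_
      rw [hΦq]
      rfl
  · refine huniq _ _ ((D.proj_act _ _).trans (hq y)) ?_
    refine (h.act (hq y) g).trans ?_
    rw [hΦq]
    rfl
  -- The form `Ω` is the pullback of the Maurer–Cartan form by `F`, and `F ∘ q = snd`, so `q` pulls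
  -- it back to the form of `δ^* G`.
  · obtain ⟨hqd, F, hF, hFq⟩ := hloc y
    have hne : (∞ : WithTop ℕ∞) ≠ 0 := by simp
    have h1 : HasMFDerivAt 𝓘(ℝ, 𝔤 n) 𝓘(ℝ, 𝔤 n) (fun z => F (q z)) y _ :=
      HasMFDerivAt.comp y (hF.contMDiffAt.mdifferentiableAt hne).hasMFDerivAt
        (hqd.mdifferentiableAt hne).hasMFDerivAt
    have h2 := (h1.congr_of_eventuallyEq (hFq.mono fun z hz => hz.symm)).mfderiv
    rw [← hF.model_form]
    change _ = (model n).form (Pullback.snd (model n) hδ y)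
      (mfderiv 𝓘(ℝ, 𝔤 n) 𝓘(ℝ, 𝔤 n) (Pullback.snd (model n) hδ) y v)
    have h3 : ∀ v, mfderiv 𝓘(ℝ, 𝔤 n) 𝓘(ℝ, 𝔤 n) (Pullback.snd (model n) hδ) y v =
      mfderiv 𝓘(ℝ, W) 𝓘(ℝ, 𝔤 n) F (q y) (mfderiv 𝓘(ℝ, 𝔤 n) 𝓘(ℝ, W) q y v) :=
      fun v => DFunLike.congr_fun h2 v
    rw [h3, hFq.self_of_nhds]

end Quotient

/-! ### The action of the fundamental group by deck transformations. -/

theorem continuous_pi1Action {M X : Type*} [TopologicalSpace M] [TopologicalSpace X]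
    [SimplyConnectedSpace X] {p : X → M} (hp : IsCoveringMap p) (x₀ : X)
    (hX : LocallyPathConnectedSpace X) (γ : FundamentalGroup M (p x₀)) :
    Continuous (pi1Action hp x₀ hX γ) :=
  ((deckEquiv hp x₀ hX).symm γ).1.continuous

theorem eq_iff_exists_pi1Action {M X : Type*} [TopologicalSpace M] [TopologicalSpace X]
    [SimplyConnectedSpace X] {p : X → M} (hp : IsCoveringMap p) (x₀ : X)
    (hX : LocallyPathConnectedSpace X) (x x' : X) :
    p x = p x' ↔ ∃ γ, pi1Action hp x₀ hX γ x = x' := by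
  constructor
  · intro h
    obtain ⟨τ, hτ⟩ := exists_deck hp x x' h
    refine ⟨deckEquiv hp x₀ hX τ, ?_⟩
    change ((deckEquiv hp x₀ hX).symm (deckEquiv hp x₀ hX τ)).1 x = x'
    rw [MulEquiv.symm_apply_apply, hτ]
  · rintro ⟨γ, rfl⟩
    exact (((deckEquiv hp x₀ hX).symm γ).2 x).symm

end ProjConn

end

/-- Let `D` be a flat projective connection `E → M` on a connected `n`-manifold `M`, and let
`p : M' → M` be the universal covering. Then there are a local diffeomorphism `δ : M' → ℝPⁿ` (the
developing map) and a morphism `ρ : π₁(M) → PGL(n+1, ℝ)` along which `δ` is equivariant, such that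
`D` is the quotient by the resulting action of `π₁(M)` of the pullback along `δ` of the model. -/
theorem mainTheorem4 {n : ℕ}
    {M : Type*} [TopologicalSpace M] [T2Space M] [ConnectedSpace M]
    [ChartedSpace (EuclideanSpace ℝ (Fin n)) M] [IsManifold 𝓘(ℝ, EuclideanSpace ℝ (Fin n)) ∞ M]
    {W : Type*} [NormedAddCommGroup W] [NormedSpace ℝ W]
    {E : Type*} [TopologicalSpace E] [ChartedSpace W E] [IsManifold 𝓘(ℝ, W) ∞ E]
    (D : ProjConn.ConnectionData n M E W) (hD : D.IsProjectiveConnection) (hflat : D.IsFlat)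
    {M' : Type*} [TopologicalSpace M'] [SimplyConnectedSpace M']
    [ChartedSpace (EuclideanSpace ℝ (Fin n)) M'] [IsManifold 𝓘(ℝ, EuclideanSpace ℝ (Fin n)) ∞ M']
    (p : M' → M) (hp : IsCoveringMap p)
    (hp_diff : IsLocalDiffeomorph 𝓘(ℝ, EuclideanSpace ℝ (Fin n)) 𝓘(ℝ, EuclideanSpace ℝ (Fin n)) ∞ p)
    (x₀ : M') :
    ∃ (δ : M' → ProjConn.RP n)
      (hδ : IsLocalDiffeomorph 𝓘(ℝ, EuclideanSpace ℝ (Fin n)) 𝓘(ℝ, EuclideanSpace ℝ (Fin n)) ∞ δ)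
      (ρ : FundamentalGroup M (p x₀) →* ProjConn.G n)
      (hρ : ∀ γ x, δ (ProjConn.pi1Action hp x₀
          (ChartedSpace.locallyPathConnectedSpace (EuclideanSpace ℝ (Fin n)) M') γ x) = ρ γ • δ x)
      (q : ProjConn.Pullback (ProjConn.model n) hδ.isLocalHomeomorph → E),
      ProjConn.IsQuotientConnection ((ProjConn.model n).pullback hδ.isLocalHomeomorph) D p
        (ProjConn.holonomyAction (ProjConn.pi1Action hp x₀
          (ChartedSpace.locallyPathConnectedSpace (EuclideanSpace ℝ (Fin n)) M'))
          hδ.isLocalHomeomorph ρ hρ) q := by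
  have hX : LocallyPathConnectedSpace M' :=
    ChartedSpace.locallyPathConnectedSpace (EuclideanSpace ℝ (Fin n)) M'
  obtain ⟨Φ, hΦ⟩ := ProjConn.exists_isGlobalDev hD hflat hp.continuous x₀
  have hδ := hΦ.isLocalDiffeomorph_devMap hD hp_diff
  have hpa := ProjConn.eq_iff_exists_pi1Action hp x₀ hX
  have hpγ : ∀ γ x, p (ProjConn.pi1Action hp x₀ hX γ x) = p x :=
    fun γ x => ((hpa _ _).2 ⟨γ, rfl⟩).symm
  obtain ⟨ρ, hρ⟩ := hΦ.exists_holonomy_hom hD hp.continuous (ProjConn.pi1Action hp x₀ hX)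
    (ProjConn.continuous_pi1Action hp x₀ hX) hpγ
  -- The points `x` and `γ x` have the same image under `p`, so both values of `δ` can be computed
  -- with the same `e`.
  have hρδ : ∀ γ x, ProjConn.devMap hD p Φ (ProjConn.pi1Action hp x₀ hX γ x) =
      ρ γ • ProjConn.devMap hD p Φ x := by
    intro γ x
    obtain ⟨e, he⟩ := ProjConn.proj_surjective hD (p x)
    rw [hΦ.devMap_eq hD he, hΦ.devMap_eq hD (he.trans (hpγ γ x).symm), hρ γ x e he, mul_smul]
  obtain ⟨q, hq⟩ := hΦ.exists_isQuotientConnection hδ.isLocalHomeomorph hD hp.continuous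
    (ProjConn.surjective_of_isCoveringMap hp) (fun _ => rfl) _ hpa ρ hρ hρδ
  exact ⟨_, hδ, ρ, hρδ, q, hq⟩
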